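/- Let $k$ be an algebraically closed field of characteristic $0$, let $G$ be a finite abelian group, $\chi : G \to k^\times$ a group homomorphism and $a \in G$, and write $\mathcal D = (G,\chi,a)$. Suppose that the orders of $\chi(a)\in k^\times$, of $a \in G$ and of $\chi \in \mathrm{Hom}(G,k^\times)$ are all equal to the same odd number $\ell$. Let $\theta = \chi(a)^{-1/2}$, meaning the square root of $\chi(a)^{-1}$ in $k$ that is a primitive $\ell$-th root of unity. Then there is an isomorphism of Hopf algebras $$\overline{D(H_{\mathcal D})} \;\simeq\; \mathfrak u_\theta(\mathfrak{sl}_2).$$ Here the following notation is used. * $H_{\mathcal D}$ is the Hopf algebra over $k$ generated by $G$ and an element $x$, subject to the relations of $G$ together with $x^\ell = 0$ and $xg = \chi(g)\,gx$ for $g \in G$, with $\Delta(g) = g\otimes g$, $\Delta(x) = x \otimes a + 1 \otimes x$, $\varepsilon(g)=1$, $\varepsilon(x)=0$, $S(g)=g^{-1}$, $S(x)=-xa^{-1}$. * For a finite-dimensional Hopf algebra $H$ over $k$ (with bijective antipode $S$), $D(H)$ is its Drinfel'd double: as a coalgebra $D(H) = (H^*)^{\mathrm{cop}} \otimes H$,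 with unit $\varepsilon\otimes 1$ and product $$(g \otimes h)(f \otimes l) = \sum g\,\bigl(h_1 \rightharpoonup f \leftharpoonup S^{-1}(h_3)\bigr) \otimes h_2\, l ,$$ where $\langle h \rightharpoonup f, b\rangle = \langle f, bh\rangle$ and $\langle f \leftharpoonup h, b\rangle = \langle f, hb\rangle$. * For a Hopf algebra $A$ over $k$, $G_C(A)$ is the set of central group-like elements of $A$, $(kG_C(A))^+$ is the intersection of the linear span $kG_C(A)$ with the kernel of the counit, and $\overline{A} = A / A\,(kG_C(A))^+$ with the quotient Hopf algebra structure. * $\mathfrak u_\theta(\mathfrak{sl}_2)$ is the one-parameter small quantum group: the Hopf algebra over $k$ generated by $e, f, \omega^{\pm 1}$ with relations $$e^\ell = 0 = f^\ell,\quad \omega^\ell = 1,\quad \omega e = \theta^2 e\omega,\quad \omega f = \theta^{-2} f\omega,\quad ef - fe = \frac{1}{\theta - \theta^{-1}}(\omega - \omega^{-1}),$$ and $\Delta(\omega)=\omega\otimes\omega$, $\Delta(e) = e\otimes 1 + \omega\otimes e$, $\Delta(f) = 1 \otimes f + f\otimes \omega^{-1}$, $\varepsilon(\omega)=1$, $\varepsilon(e)=\varepsilon(f)=0$,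 $S(\omega)=\omega^{-1}$, $S(e) = -\omega^{-1}e$, $S(f) = -f\omega$. (If $\ell = 1$, then $\theta=1$, $e=f=0$ and $\omega=1$; the last relation is then read as $ef-fe=0$ and $\mathfrak u_\theta(\mathfrak{sl}_2)=k$.) -/

import Mathlib

open TensorProduct Coalgebra HopfAlgebra

set_option linter.unusedSectionVars false
set_option linter.unusedSimpArgs false

/-- The antipode of the Hopf algebra `H` is bijective. -/
class HasBijectiveAntipode (k : Type*) (H : Type*) [CommSemiring k] [Semiring H]
    [HopfAlgebra k H] : Prop where
  bijective : Function.Bijective (antipode k : H →ₗ[k] H)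

section InverseAntipode

variable (k H : Type*) [Field k] [Ring H] [HopfAlgebra k H] [HasBijectiveAntipode k H]

/-- The inverse `S⁻¹` of the antipode. -/
noncomputable def antipodeInv : H →ₗ[k] H :=
  (LinearEquiv.ofBijective (antipode k : H →ₗ[k] H) HasBijectiveAntipode.bijective).symm

variable {k H}

@[simp] lemma antipode_antipodeInv (h : H) : antipode k (antipodeInv k H h) = h :=
  (LinearEquiv.ofBijective (antipode k : H →ₗ[k] H)
    HasBijectiveAntipode.bijective).apply_symm_apply h

@[simp] lemma antipodeInv_antipode (h : H) : antipodeInv k H (antipode k h) = h :=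
  (LinearEquiv.ofBijective (antipode k : H →ₗ[k] H)
    HasBijectiveAntipode.bijective).symm_apply_apply h

lemma antipodeInv_mul (g h : H) :
    antipodeInv k H (g * h) = antipodeInv k H h * antipodeInv k H g := by
  apply (HasBijectiveAntipode.bijective (k := k) (H := H)).1
  simp [antipode_mul_antidistrib]

@[simp] lemma antipodeInv_one : antipodeInv k H (1 : H) = 1 := by
  apply (HasBijectiveAntipode.bijective (k := k) (H := H)).1
  simp

@[simp] lemma counit_antipodeInv (h : H) : counit (R := k) (antipodeInv k H h) = counit h := by
  rw [← counit_antipode (R := k), antipode_antipodeInv]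

/-- `∑ S⁻¹(h₂) h₁ = ε(h)`. -/
lemma antipodeInv_mul_cop (h : H) :
    LinearMap.mul' k H (map (antipodeInv k H) .id (TensorProduct.comm k H H (comul h))) =
      algebraMap k H (counit h) := by
  apply (HasBijectiveAntipode.bijective (k := k) (H := H)).1
  have key : ∀ t : H ⊗[k] H, antipode k (LinearMap.mul' k H
      (map (antipodeInv k H) .id (TensorProduct.comm k H H t))) =
      LinearMap.mul' k H ((antipode k).rTensor H t) := by
    intro t
    induction t with
    | zero =>
        simp only [LinearMap.map_zero, LinearEquiv.map_zero, tmul_zero, zero_tmul, mul_zero, zero_mul,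
          smul_zero, zero_smul, LinearMap.zero_apply]
    | add x y hx hy => simp only [LinearMap.map_add, LinearEquiv.map_add, hx, hy]
    | tmul x y => simp [antipode_mul_antidistrib]
  rw [key, mul_antipode_rTensor_comul_apply]
  simp [Algebra.algebraMap_eq_smul_one]

/-- `∑ h₂ S⁻¹(h₁) = ε(h)`. -/
lemma mul_antipodeInv_cop (h : H) :
    LinearMap.mul' k H (map .id (antipodeInv k H) (TensorProduct.comm k H H (comul h))) =
      algebraMap k H (counit h) := by
  apply (HasBijectiveAntipode.bijective (k := k) (H := H)).1
  have key : ∀ t : H ⊗[k] H, antipode k (LinearMap.mul' k H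
      (map .id (antipodeInv k H) (TensorProduct.comm k H H t))) =
      LinearMap.mul' k H ((antipode k).lTensor H t) := by
    intro t
    induction t with
    | zero =>
        simp only [LinearMap.map_zero, LinearEquiv.map_zero, tmul_zero, zero_tmul, mul_zero, zero_mul,
          smul_zero, zero_smul, LinearMap.zero_apply]
    | add x y hx hy => simp only [LinearMap.map_add, LinearEquiv.map_add, hx, hy]
    | tmul x y => simp [antipode_mul_antidistrib]
  rw [key, mul_antipode_lTensor_comul_apply]
  simp [Algebra.algebraMap_eq_smul_one]

end InverseAntipode

section AntipodeComul

variable {k H : Type*} [Field k] [Ring H] [HopfAlgebra k H]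

/-- `∑ h₁₁ ⊗ h₁₂ ⊗ h₂₁ ⊗ h₂₂ = ∑ h₁ ⊗ h₂₁₁ ⊗ h₂₁₂ ⊗ h₂₂`. -/
lemma comul_four (h : H) :
    TensorProduct.assoc k H H (H ⊗[k] H) (map comul comul (comul (R := k) h)) =
      map .id ((TensorProduct.assoc k H H H).toLinearMap ∘ₗ map comul .id ∘ₗ comul)
        (comul (R := k) h) := by
  suffices h : (TensorProduct.assoc k H H (H ⊗[k] H)).toLinearMap ∘ₗ map comul comul ∘ₗ
      comul (R := k) = map .id ((TensorProduct.assoc k H H H).toLinearMap ∘ₗ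
        map comul .id ∘ₗ comul) ∘ₗ comul (R := k) (A := H) from congr($h _)
  simp only [coassoc_simps]

/-- `Δ(S(h)) = ∑ S(h₂) ⊗ S(h₁)`. -/
lemma comul_antipode (h : H) : comul (R := k) (antipode k h) =
    map (antipode k) (antipode k) (TensorProduct.comm k H H (comul h)) := by
  have e2 := LinearMap.comul_right_inv (R := k) (C := H)
  have e1 : WithConv.toConv (map (antipode k) (antipode k) ∘ₗ
      (TensorProduct.comm k H H).toLinearMap ∘ₗ comul) *
        WithConv.toConv (comul (R := k) (A := H)) = 1 := by
    ext h
    rw [LinearMap.convMul_apply]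
    let Ψ : H ⊗[k] (H ⊗[k] (H ⊗[k] H)) →ₗ[k] H ⊗[k] H :=
      LinearMap.mul' k (H ⊗[k] H) ∘ₗ
        map (map (antipode k) (antipode k) ∘ₗ (TensorProduct.comm k H H).toLinearMap) .id ∘ₗ
        (TensorProduct.assoc k H H (H ⊗[k] H)).symm.toLinearMap
    have h1 : ∀ t : H ⊗[k] H, LinearMap.mul' k (H ⊗[k] H) (map (map (antipode k) (antipode k) ∘ₗ
        (TensorProduct.comm k H H).toLinearMap ∘ₗ comul) comul t) =
          Ψ (TensorProduct.assoc k H H (H ⊗[k] H) (map comul comul t)) := by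
      intro t
      induction t with
      | zero =>
          simp only [LinearMap.map_zero, LinearEquiv.map_zero, tmul_zero, zero_tmul, mul_zero, zero_mul,
            smul_zero, zero_smul, LinearMap.zero_apply]
      | add x y hx hy => simp only [LinearMap.map_add, LinearEquiv.map_add, hx, hy]
      | tmul x y => simp [Ψ]
    rw [h1, comul_four]
    have h2 : ∀ x z d : H, Ψ (x ⊗ₜ (TensorProduct.assoc k H H H (comul z ⊗ₜ d))) =
        counit (R := k) z • (1 ⊗ₜ (antipode k x * d)) := by
      intro x z d
      have : ∀ t : H ⊗[k] H, Ψ (x ⊗ₜ (TensorProduct.assoc k H H H (t ⊗ₜ d))) =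
          (LinearMap.mul' k H ((antipode k).rTensor H t)) ⊗ₜ (antipode k x * d) := by
        intro t
        induction t with
        | zero =>
            simp only [LinearMap.map_zero, LinearEquiv.map_zero, tmul_zero, zero_tmul, mul_zero, zero_mul,
              smul_zero, zero_smul, LinearMap.zero_apply]
        | add x y hx hy => simp only [LinearMap.map_add, LinearEquiv.map_add, hx, hy, tmul_add, add_tmul]
        | tmul x y => simp [Ψ]
      rw [this, mul_antipode_rTensor_comul_apply, Algebra.algebraMap_eq_smul_one, smul_tmul']
    have h3 : ∀ x y : H,
        Ψ (x ⊗ₜ (TensorProduct.assoc k H H H (map comul .id (comul (R := k) y)))) =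
          1 ⊗ₜ (antipode k x * y) := by
      intro x y
      have : ∀ t : H ⊗[k] H, Ψ (x ⊗ₜ (TensorProduct.assoc k H H H (map comul .id t))) =
          1 ⊗ₜ (antipode k x * TensorProduct.lid k H (counit.rTensor H t)) := by
        intro t
        induction t with
        | zero =>
            simp only [LinearMap.map_zero, LinearEquiv.map_zero, tmul_zero, zero_tmul, mul_zero, zero_mul,
              smul_zero, zero_smul, LinearMap.zero_apply]
        | add x y hx hy => simp only [LinearMap.map_add, LinearEquiv.map_add, hx, hy, tmul_add, mul_add]
        | tmul z d => simp [h2]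
      rw [this]; simp
    have h4 : ∀ t : H ⊗[k] H, Ψ (map .id ((TensorProduct.assoc k H H H).toLinearMap ∘ₗ
        map comul .id ∘ₗ comul) t) = 1 ⊗ₜ (LinearMap.mul' k H ((antipode k).rTensor H t)) := by
      intro t
      induction t with
      | zero =>
          simp only [LinearMap.map_zero, LinearEquiv.map_zero, tmul_zero, zero_tmul, mul_zero, zero_mul,
            smul_zero, zero_smul, LinearMap.zero_apply]
      | add x y hx hy => simp only [LinearMap.map_add, LinearEquiv.map_add, hx, hy, tmul_add]
      | tmul x y => simp [h3]
    rw [h4, mul_antipode_rTensor_comul_apply]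
    simp [Algebra.algebraMap_eq_smul_one, Algebra.TensorProduct.one_def]
  exact congr(($(left_inv_eq_right_inv e1 e2)).ofConv h).symm

/-- `Δ(S⁻¹(h)) = ∑ S⁻¹(h₂) ⊗ S⁻¹(h₁)`. -/
lemma comul_antipodeInv [HasBijectiveAntipode k H] (h : H) : comul (R := k) (antipodeInv k H h) =
    map (antipodeInv k H) (antipodeInv k H) (TensorProduct.comm k H H (comul h)) := by
  obtain ⟨h, rfl⟩ := (HasBijectiveAntipode.bijective (k := k) (H := H)).2 h
  rw [antipodeInv_antipode, comul_antipode]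
  generalize comul (R := k) h = t
  induction t with
  | zero =>
      simp only [LinearMap.map_zero, LinearEquiv.map_zero, tmul_zero, zero_tmul, mul_zero, zero_mul,
        smul_zero, zero_smul, LinearMap.zero_apply]
  | add x y hx hy => simp only [LinearMap.map_add, LinearEquiv.map_add, ← hx, ← hy]
  | tmul x y => simp

end AntipodeComul

section Dual

variable (k H : Type*) [Field k] [Ring H] [HopfAlgebra k H]

/-- The bialgebra `(H^*)^cop`: the linear dual of `H` with the convolution product and the
co-opposite of the coproduct dual to the multiplication of `H`. -/
def DualCop : Type _ := WithConv (H →ₗ[k] k)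

namespace DualCop

noncomputable instance : Ring (DualCop k H) := inferInstanceAs (Ring (WithConv (H →ₗ[k] k)))

noncomputable instance : Algebra k (DualCop k H) :=
  inferInstanceAs (Algebra k (WithConv (H →ₗ[k] k)))

/-- An element of `(H^*)^cop` as a linear form on `H`. -/
noncomputable def toDual : DualCop k H ≃ₗ[k] Module.Dual k H := WithConv.linearEquiv k (H →ₗ[k] k)

variable {k H}

lemma ext_toDual {f g : DualCop k H} (h : ∀ b, toDual k H f b = toDual k H g b) : f = g :=
  (toDual k H).injective (LinearMap.ext h)

/-- `⟨f g, b⟩ = ∑ ⟨f, b₁⟩ ⟨g, b₂⟩`. -/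
lemma toDual_mul_apply (f g : DualCop k H) (b : H) : toDual k H (f * g) b =
    LinearMap.mul' k k (map (toDual k H f) (toDual k H g) (comul b)) := rfl

@[simp] lemma toDual_one_apply (b : H) : toDual k H (1 : DualCop k H) b = counit (R := k) b := rfl

/-- `⟨h ⇀ f, b⟩ = ⟨f, b h⟩`. -/
noncomputable def hitLeft : H →ₗ[k] DualCop k H →ₗ[k] DualCop k H :=
  LinearMap.mk₂ k (fun h f => (toDual k H).symm (toDual k H f ∘ₗ LinearMap.mulRight k h))
    (fun _ _ _ => ext_toDual fun _ => by simp [mul_add])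
    (fun _ _ _ => ext_toDual fun _ => by simp)
    (fun _ _ _ => ext_toDual fun _ => by simp)
    (fun _ _ _ => ext_toDual fun _ => by simp)

/-- `⟨f ↼ h, b⟩ = ⟨f, h b⟩`. -/
noncomputable def hitRight : H →ₗ[k] DualCop k H →ₗ[k] DualCop k H :=
  LinearMap.mk₂ k (fun h f => (toDual k H).symm (toDual k H f ∘ₗ LinearMap.mulLeft k h))
    (fun _ _ _ => ext_toDual fun _ => by simp [add_mul])
    (fun _ _ _ => ext_toDual fun _ => by simp)
    (fun _ _ _ => ext_toDual fun _ => by simp)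
    (fun _ _ _ => ext_toDual fun _ => by simp)

@[simp] lemma toDual_hitLeft (h b : H) (f : DualCop k H) :
    toDual k H (hitLeft h f) b = toDual k H f (b * h) := by simp [hitLeft]

@[simp] lemma toDual_hitRight (h b : H) (f : DualCop k H) :
    toDual k H (hitRight h f) b = toDual k H f (h * b) := by simp [hitRight]

variable [Module.Finite k H]

instance : Module.Finite k (DualCop k H) := Module.Finite.equiv (toDual k H).symm

/-- Identification of `H^* ⊗ M` with `Hom(H, M)`. -/
noncomputable def evalHom (M : Type*) [AddCommGroup M] [Module k M] :
    DualCop k H ⊗[k] M ≃ₗ[k] H →ₗ[k] M :=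
  LinearEquiv.rTensor M (toDual k H) ≪≫ₗ dualTensorHomEquiv k H M

variable {M : Type*} [AddCommGroup M] [Module k M]

@[simp] lemma evalHom_tmul (f : DualCop k H) (m : M) (b : H) :
    evalHom M (f ⊗ₜ[k] m) b = toDual k H f b • m := by
  simp [evalHom]

lemma ext_evalHom {x y : DualCop k H ⊗[k] M} (h : ∀ b, evalHom M x b = evalHom M y b) : x = y :=
  (evalHom M).injective (LinearMap.ext h)

/-- The coproduct is determined by `⟨Δ(f), b ⊗ c⟩ = ⟨f, c b⟩`. -/
noncomputable instance : CoalgebraStruct k (DualCop k H) where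
  comul := (LinearEquiv.rTensor (DualCop k H) (toDual k H) ≪≫ₗ
      LinearEquiv.lTensor (Module.Dual k H) (toDual k H) ≪≫ₗ
      TensorProduct.dualDistribEquiv k H H).symm.toLinearMap ∘ₗ
    (LinearMap.mul' k H ∘ₗ (TensorProduct.comm k H H).toLinearMap).dualMap ∘ₗ
      (toDual k H).toLinearMap
  counit := LinearMap.applyₗ 1 ∘ₗ (toDual k H).toLinearMap

lemma counit_eq (f : DualCop k H) : counit (R := k) f = toDual k H f 1 := rfl

lemma toDual_evalHom_comul (f : DualCop k H) (b c : H) :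
    toDual k H (evalHom _ (comul (R := k) f) b) c = toDual k H f (c * b) := by
  let e := LinearEquiv.rTensor (DualCop k H) (toDual k H) ≪≫ₗ
      LinearEquiv.lTensor (Module.Dual k H) (toDual k H) ≪≫ₗ TensorProduct.dualDistribEquiv k H H
  have h1 : ∀ t : DualCop k H ⊗[k] DualCop k H,
      toDual k H (evalHom _ t b) c = e t (b ⊗ₜ c) := by
    intro t
    induction t with
    | zero =>
        simp only [LinearMap.map_zero, LinearEquiv.map_zero, tmul_zero, zero_tmul, mul_zero, zero_mul,
          smul_zero, zero_smul, LinearMap.zero_apply]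
    | add x y hx hy => simp only [LinearMap.map_add, LinearEquiv.map_add, LinearMap.add_apply, hx, hy]
    | tmul f m => simp [e, TensorProduct.dualDistribEquiv, TensorProduct.dualDistribEquivOfBasis]
  rw [h1]
  exact congr($(e.apply_symm_apply ((LinearMap.mul' k H ∘ₗ
    (TensorProduct.comm k H H).toLinearMap).dualMap (toDual k H f))) (b ⊗ₜ c))

noncomputable instance : Coalgebra k (DualCop k H) where
  coassoc := by
    ext f
    apply ext_evalHom fun b => ext_evalHom fun c => ext_toDual fun d => ?_
    have h1 : ∀ t : DualCop k H ⊗[k] DualCop k H, toDual k H (evalHom _ (evalHom _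
        (TensorProduct.assoc k _ _ _ (comul.rTensor (DualCop k H) t)) b) c) d =
          toDual k H (evalHom _ t (c * b)) d := by
      intro t
      induction t with
      | zero =>
          simp only [LinearMap.map_zero, LinearEquiv.map_zero, tmul_zero, zero_tmul, mul_zero, zero_mul,
            smul_zero, zero_smul, LinearMap.zero_apply]
      | add x y hx hy => simp only [LinearMap.map_add, LinearEquiv.map_add, LinearMap.add_apply, hx, hy]
      | tmul f m =>
        have h2 : ∀ t : DualCop k H ⊗[k] DualCop k H, toDual k H (evalHom _ (evalHom _
            (TensorProduct.assoc k _ _ _ (t ⊗ₜ[k] m)) b) c) d =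
              toDual k H (evalHom _ t b) c * toDual k H m d := by
          intro t
          induction t with
          | zero =>
              simp only [LinearMap.map_zero, LinearEquiv.map_zero, tmul_zero, zero_tmul, mul_zero, zero_mul,
                smul_zero, zero_smul, LinearMap.zero_apply]
          | add x y hx hy => simp only [LinearMap.map_add, LinearEquiv.map_add, LinearMap.add_apply, hx, hy, add_tmul, add_mul]
          | tmul f m => simp [mul_assoc]
        simp [h2, toDual_evalHom_comul]
    have h3 : ∀ t : DualCop k H ⊗[k] DualCop k H, toDual k H (evalHom _ (evalHom _
        (comul.lTensor (DualCop k H) t) b) c) d = toDual k H (evalHom _ t b) (d * c) := by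
      intro t
      induction t with
      | zero =>
          simp only [LinearMap.map_zero, LinearEquiv.map_zero, tmul_zero, zero_tmul, mul_zero, zero_mul,
            smul_zero, zero_smul, LinearMap.zero_apply]
      | add x y hx hy => simp only [LinearMap.map_add, LinearEquiv.map_add, LinearMap.add_apply, hx, hy]
      | tmul f m => simp [toDual_evalHom_comul]
    simp [h1, h3, toDual_evalHom_comul, mul_assoc]
  rTensor_counit_comp_comul := by
    ext f
    apply (TensorProduct.lid k _).injective
    refine ext_toDual fun d => ?_
    have h1 : ∀ t : DualCop k H ⊗[k] DualCop k H,
        TensorProduct.lid k _ (counit.rTensor (DualCop k H) t) = evalHom _ t 1 := by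
      intro t
      induction t with
      | zero =>
          simp only [LinearMap.map_zero, LinearEquiv.map_zero, tmul_zero, zero_tmul, mul_zero, zero_mul,
            smul_zero, zero_smul, LinearMap.zero_apply]
      | add x y hx hy => simp only [LinearMap.map_add, LinearEquiv.map_add, LinearMap.add_apply, hx, hy]
      | tmul f m => simp [counit_eq]
    simp [h1, toDual_evalHom_comul]
  lTensor_counit_comp_comul := by
    ext f
    apply ext_evalHom fun b => ?_
    have h3 : ∀ t : DualCop k H ⊗[k] DualCop k H,
        evalHom _ (counit.lTensor (DualCop k H) t) b = toDual k H (evalHom _ t b) 1 := by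
      intro t
      induction t with
      | zero =>
          simp only [LinearMap.map_zero, LinearEquiv.map_zero, tmul_zero, zero_tmul, mul_zero, zero_mul,
            smul_zero, zero_smul, LinearMap.zero_apply]
      | add x y hx hy => simp only [LinearMap.map_add, LinearEquiv.map_add, LinearMap.add_apply, hx, hy]
      | tmul f m => simp [counit_eq]
    simp [h3, toDual_evalHom_comul]

end DualCop

end Dual

section Double

variable (k H : Type*) [Field k] [Ring H] [HopfAlgebra k H] [Module.Finite k H]

/-- The underlying space `(H^*)^cop ⊗ H` of the Drinfeld double of `H`. -/
def DrinfeldDouble : Type _ := DualCop k H ⊗[k] H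

namespace DrinfeldDouble

open DualCop

noncomputable instance : AddCommGroup (DrinfeldDouble k H) :=
  inferInstanceAs (AddCommGroup (DualCop k H ⊗[k] H))

noncomputable instance : Module k (DrinfeldDouble k H) :=
  inferInstanceAs (Module k (DualCop k H ⊗[k] H))

/-- As a coalgebra, `D(H)` is the tensor product coalgebra `(H^*)^cop ⊗ H`. -/
noncomputable instance : Coalgebra k (DrinfeldDouble k H) :=
  inferInstanceAs (Coalgebra k (DualCop k H ⊗[k] H))

variable {k H}

/-- The iterated coproduct `h ↦ ∑ h₁ ⊗ (h₂ ⊗ h₃)`. -/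
noncomputable def comul₂ : H →ₐ[k] H ⊗[k] (H ⊗[k] H) :=
  (Algebra.TensorProduct.map (.id k H) (Bialgebra.comulAlgHom k H)).comp
    (Bialgebra.comulAlgHom k H)

variable [HasBijectiveAntipode k H]

/-- The map `x ⊗ (y ⊗ z) ↦ (x ⇀ f ↼ S⁻¹(z)) ⊗ y`. -/
noncomputable def twist (f : DualCop k H) : H ⊗[k] (H ⊗[k] H) →ₗ[k] DualCop k H ⊗[k] H :=
  map (lift (LinearMap.mk₂ k (fun x z => hitRight (antipodeInv k H z) (hitLeft x f))
      (by simp) (by simp) (by simp) (by simp))) .id ∘ₗ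
    (TensorProduct.assoc k H H H).symm.toLinearMap ∘ₗ
      LinearMap.lTensor H (TensorProduct.comm k H H).toLinearMap

lemma twist_tmul (f : DualCop k H) (x y z : H) : twist f (x ⊗ₜ (y ⊗ₜ z)) =
    hitRight (antipodeInv k H z) (hitLeft x f) ⊗ₜ y := by
  simp [twist]

lemma twist_add (f g : DualCop k H) : twist (f + g) = twist f + twist g := by
  ext x y z
  simp [twist_tmul, add_tmul]

lemma twist_smul (r : k) (f : DualCop k H) : twist (r • f) = r • twist f := by
  ext x y z
  simp [twist_tmul, smul_tmul']

/-- The product `(g ⊗ h)(f ⊗ l) = ∑ g (h₁ ⇀ f ↼ S⁻¹(h₃)) ⊗ h₂ l`. -/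
noncomputable def mulMap :
    DualCop k H ⊗[k] H →ₗ[k] DualCop k H ⊗[k] H →ₗ[k] DualCop k H ⊗[k] H :=
  lift (LinearMap.mk₂ k (fun g h => lift (LinearMap.mk₂ k
    (fun f l => map (LinearMap.mulLeft k g) (LinearMap.mulRight k l) (twist f (comul₂ h)))
    (by simp [twist_add]) (by simp [twist_smul])
    (fun f l l' => by
      have h : LinearMap.mulRight k (l + l') = LinearMap.mulRight k l + LinearMap.mulRight k l' :=
        map_add (LinearMap.mul k H).flip l l'
      simp [h, map_add_right])
    (fun r f l => by
      have h : LinearMap.mulRight k (r • l) = r • LinearMap.mulRight k l :=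
        map_smul (LinearMap.mul k H).flip r l
      simp [h, map_smul_right])))
    (fun g g' h => by
      have h : LinearMap.mulLeft k (g + g') = LinearMap.mulLeft k g + LinearMap.mulLeft k g' :=
        map_add (LinearMap.mul k (DualCop k H)) g g'
      ext f l : 3
      simp [h, map_add_left])
    (fun r g h => by
      have h : LinearMap.mulLeft k (r • g) = r • LinearMap.mulLeft k g :=
        map_smul (LinearMap.mul k (DualCop k H)) r g
      ext f l : 3
      simp [h, map_smul_left])
    (fun g h h' => by ext f l : 3; simp)
    (fun r g h => by ext f l : 3; simp))

lemma mulMap_tmul (f g : DualCop k H) (h l : H) : mulMap (g ⊗ₜ[k] h) (f ⊗ₜ[k] l) =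
    map (LinearMap.mulLeft k g) (LinearMap.mulRight k l) (twist f (comul₂ h)) := by
  simp [mulMap]

/-- `(x ⊗ (y ⊗ z)) ⊗ b ↦ y E(S⁻¹(z) b x)`. -/
noncomputable def actHom (E : H →ₗ[k] H) : (H ⊗[k] (H ⊗[k] H)) ⊗[k] H →ₗ[k] H :=
  LinearMap.mul' k H ∘ₗ map .id (E ∘ₗ LinearMap.mul' k H ∘ₗ
      map (LinearMap.mul' k H ∘ₗ map (antipodeInv k H) .id) .id) ∘ₗ
    LinearMap.lTensor H (TensorProduct.assoc k H H H).symm.toLinearMap ∘ₗ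
    (TensorProduct.assoc k H H (H ⊗[k] H)).toLinearMap ∘ₗ
    LinearMap.lTensor (H ⊗[k] H) (TensorProduct.comm k H H).toLinearMap ∘ₗ
    (TensorProduct.assoc k (H ⊗[k] H) H H).toLinearMap ∘ₗ
    LinearMap.rTensor H ((TensorProduct.comm k H (H ⊗[k] H)).toLinearMap)

@[simp] lemma actHom_tmul (E : H →ₗ[k] H) (b x y z : H) :
    actHom E ((x ⊗ₜ (y ⊗ₜ z)) ⊗ₜ b) = y * E (antipodeInv k H z * b * x) := by simp [actHom]

lemma actHom_add (E F : H →ₗ[k] H) : actHom (E + F) = actHom E + actHom F := by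
  ext
  simp [mul_add]

/-- The product of `D(H)` after identification with `Hom(H, H)`. -/
noncomputable def convHom (F E : H →ₗ[k] H) : H →ₗ[k] H :=
  actHom E ∘ₗ map (comul₂.toLinearMap ∘ₗ F) .id ∘ₗ comul

lemma convHom_apply (F E : H →ₗ[k] H) (b : H) : convHom F E b =
    actHom E (map (comul₂.toLinearMap ∘ₗ F) .id (comul b)) := rfl

lemma evalHom_mulMap (X Y : DualCop k H ⊗[k] H) :
    evalHom H (mulMap X Y) = convHom (evalHom H X) (evalHom H Y) := by
  ext b
  rw [convHom_apply]
  induction X with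
  | zero => simp
  | add x y hx hy =>
    simp only [LinearMap.map_add, LinearEquiv.map_add, LinearMap.add_apply, hx, hy, LinearMap.comp_add, map_add_left]
  | tmul g h =>
    induction Y with
    | zero => simp [actHom]
    | add x y hx hy =>
      simp only [LinearMap.map_add, LinearEquiv.map_add, LinearMap.add_apply, hx, hy, actHom_add]
    | tmul f l =>
      rw [mulMap_tmul]
      have h1 : comul₂.toLinearMap ∘ₗ evalHom H (g ⊗ₜ[k] h) =
          (LinearMap.toSpanSingleton k _ (comul₂ (k := k) h)) ∘ₗ toDual k H g := by
        ext b
        simp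
      rw [h1]
      generalize comul₂ (k := k) h = t
      induction t with
      | zero => simp
      | add x y hx hy =>
        simp only [LinearMap.map_add, LinearEquiv.map_add, LinearMap.add_apply, hx, hy, LinearMap.toSpanSingleton_add,
          LinearMap.add_comp, map_add_left]
      | tmul x u =>
        induction u with
        | zero => simp
        | add x y hx hy =>
          simp only [LinearMap.map_add, LinearEquiv.map_add, LinearMap.add_apply, hx, hy, LinearMap.toSpanSingleton_add,
            LinearMap.add_comp, map_add_left, tmul_add]
        | tmul y z =>
          simp only [twist_tmul, map_tmul, LinearMap.mulLeft_apply, LinearMap.mulRight_apply,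
            evalHom_tmul, toDual_mul_apply]
          generalize comul (R := k) b = t
          induction t with
          | zero =>
              simp only [LinearMap.map_zero, LinearEquiv.map_zero, tmul_zero, zero_tmul, mul_zero, zero_mul,
                smul_zero, zero_smul, LinearMap.zero_apply]
          | add x y hx hy => simp only [LinearMap.map_add, LinearEquiv.map_add, hx, hy, add_smul]
          | tmul b c => simp [mul_smul, ← smul_tmul']

lemma comul_five (h : H) :
    (TensorProduct.assoc k H H (H ⊗[k] (H ⊗[k] H))) (map comul (map .id comul)
      (comul₂ (k := k) h)) =
    map .id ((map .id (TensorProduct.assoc k H H H).toLinearMap) ∘ₗ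
      (TensorProduct.assoc k H (H ⊗[k] H) H).toLinearMap ∘ₗ map comul₂.toLinearMap .id)
      (comul₂ (k := k) h) := by
  have : (TensorProduct.assoc k H H (H ⊗[k] (H ⊗[k] H))).toLinearMap ∘ₗ (map comul (map .id comul))
      ∘ₗ (map .id comul ∘ₗ comul)  =
    map .id ((map .id (TensorProduct.assoc k H H H).toLinearMap) ∘ₗ
      (TensorProduct.assoc k H (H ⊗[k] H) H).toLinearMap ∘ₗ map (map .id comul ∘ₗ comul) .id)
       ∘ₗ (map .id comul ∘ₗ comul (R := k) (A := H)) := by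
    simp only [coassoc_simps]
  exact congr($this h)

lemma actHom_mul (D : H →ₗ[k] H) (p q r c : H) (v : H ⊗[k] (H ⊗[k] H)) :
    actHom D (((p ⊗ₜ (q ⊗ₜ r)) * v) ⊗ₜ c) =
      q * actHom D (v ⊗ₜ (antipodeInv k H r * c * p)) := by
  induction v with
  | zero =>
      simp only [LinearMap.map_zero, LinearEquiv.map_zero, tmul_zero, zero_tmul, mul_zero, zero_mul,
        smul_zero, zero_smul, LinearMap.zero_apply]
  | add x y hx hy => simp only [mul_add, add_tmul, map_add, hx, hy]
  | tmul x u =>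
    induction u with
    | zero =>
        simp only [LinearMap.map_zero, LinearEquiv.map_zero, tmul_zero, zero_tmul, mul_zero, zero_mul,
          smul_zero, zero_smul, LinearMap.zero_apply]
    | add x y hx hy => simp only [mul_add, add_tmul, tmul_add, map_add, hx, hy]
    | tmul y z => simp [mul_assoc, antipodeInv_mul]

lemma actHom_convHom (E D : H →ₗ[k] H) (h c : H) :
    actHom (convHom E D) (comul₂ h ⊗ₜ c) = actHom D (map (comul₂.toLinearMap ∘ₗ actHom E) .id
      ((TensorProduct.assoc k _ _ _).symm (comul₂ h ⊗ₜ comul c))) := by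
  let m (c : H) : H ⊗[k] H →ₗ[k] H := LinearMap.mul' k H ∘ₗ
    map (LinearMap.mulRight k c ∘ₗ antipodeInv k H) .id ∘ₗ (TensorProduct.comm k H H).toLinearMap
  let Θ (c d : H) : H ⊗[k] (H ⊗[k] (H ⊗[k] (H ⊗[k] H))) →ₗ[k] H :=
    LinearMap.mul' k H ∘ₗ
    map .id (actHom D ∘ₗ map (comul₂.toLinearMap ∘ₗ E ∘ₗ m c) (m d) ∘ₗ
      (TensorProduct.assoc k _ _ _).symm.toLinearMap ∘ₗ
      LinearMap.lTensor H ((TensorProduct.comm k _ _).toLinearMap ∘ₗ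
        (TensorProduct.assoc k _ _ _).symm.toLinearMap)) ∘ₗ
    (TensorProduct.leftComm k _ _ _).toLinearMap ∘ₗ
    LinearMap.lTensor H (TensorProduct.leftComm k _ _ _).toLinearMap
  have hΘ : ∀ c d x y z u v : H, Θ c d (x ⊗ₜ (y ⊗ₜ (z ⊗ₜ (u ⊗ₜ v)))) =
      z * actHom D (comul₂ (E (antipodeInv k H v * c * x)) ⊗ₜ (antipodeInv k H u * d * y)) := by
    intros
    simp [Θ, m]
  have h1 : ∀ (t : H ⊗[k] (H ⊗[k] H)) (c d : H), actHom D (map (comul₂.toLinearMap ∘ₗ actHom E) .id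
      ((TensorProduct.assoc k _ _ _).symm (t ⊗ₜ (c ⊗ₜ d)))) = Θ c d (map .id
        ((map .id (TensorProduct.assoc k H H H).toLinearMap) ∘ₗ
          (TensorProduct.assoc k H (H ⊗[k] H) H).toLinearMap ∘ₗ map comul₂.toLinearMap .id) t) := by
    intro t c d
    induction t with
    | zero =>
        simp only [LinearMap.map_zero, LinearEquiv.map_zero, tmul_zero, zero_tmul, mul_zero, zero_mul,
          smul_zero, zero_smul, LinearMap.zero_apply]
    | add x y hx hy => simp only [LinearMap.map_add, LinearEquiv.map_add, add_tmul, hx, hy]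
    | tmul x u =>
      induction u with
      | zero =>
          simp only [LinearMap.map_zero, LinearEquiv.map_zero, tmul_zero, zero_tmul, mul_zero, zero_mul,
            smul_zero, zero_smul, LinearMap.zero_apply]
      | add x y hx hy => simp only [LinearMap.map_add, LinearEquiv.map_add, add_tmul, tmul_add, hx, hy]
      | tmul y z =>
        simp only [assoc_symm_tmul, map_tmul, LinearMap.comp_apply, actHom_tmul, LinearMap.id_apply,
          AlgHom.toLinearMap_apply, map_mul, LinearEquiv.coe_coe]
        generalize comul₂ (k := k) y = u
        induction u with
        | zero =>
            simp only [LinearMap.map_zero, LinearEquiv.map_zero, tmul_zero, zero_tmul, mul_zero, zero_mul,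
              smul_zero, zero_smul, LinearMap.zero_apply]
        | add x y hx hy => simp only [LinearMap.map_add, LinearEquiv.map_add, add_tmul, tmul_add, add_mul, hx, hy]
        | tmul p u =>
          induction u with
          | zero =>
              simp only [LinearMap.map_zero, LinearEquiv.map_zero, tmul_zero, zero_tmul, mul_zero, zero_mul,
                smul_zero, zero_smul, LinearMap.zero_apply]
          | add x y hx hy => simp only [LinearMap.map_add, LinearEquiv.map_add, add_tmul, tmul_add, add_mul, hx, hy]
          | tmul q r => simp [actHom_mul, hΘ]
  have h2 : ∀ t : H ⊗[k] (H ⊗[k] H), actHom (convHom E D) (t ⊗ₜ c) =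
      ∑ i ∈ (ℛ k c).index, Θ ((ℛ k c).left i) ((ℛ k c).right i)
        ((TensorProduct.assoc k H H (H ⊗[k] (H ⊗[k] H))) (map comul (map .id comul) t)) := by
    intro t
    induction t with
    | zero => simp
    | add x y hx hy => simp only [LinearMap.map_add, LinearEquiv.map_add, add_tmul, hx, hy, Finset.sum_add_distrib]
    | tmul x u =>
      induction u with
      | zero => simp
      | add x y hx hy => simp only [LinearMap.map_add, LinearEquiv.map_add, add_tmul, tmul_add, hx, hy, Finset.sum_add_distrib]
      | tmul y z =>
        rw [actHom_tmul, convHom_apply, Bialgebra.comul_mul, Bialgebra.comul_mul,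
          comul_antipodeInv, ← (ℛ k c).eq]
        simp only [map_tmul, LinearMap.id_apply, Finset.mul_sum, Finset.sum_mul, map_sum]
        refine Finset.sum_congr rfl fun i _ => ?_
        generalize (ℛ k c).left i = c, (ℛ k c).right i = d, comul (R := k) x = x,
          comul (R := k) z = z
        induction x with
        | zero =>
            simp only [LinearMap.map_zero, LinearEquiv.map_zero, tmul_zero, zero_tmul, mul_zero, zero_mul,
              smul_zero, zero_smul, LinearMap.zero_apply]
        | add x y hx hy => simp only [LinearMap.map_add, LinearEquiv.map_add, add_tmul, mul_add, hx, hy]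
        | tmul a b =>
          induction z with
          | zero =>
              simp only [LinearMap.map_zero, LinearEquiv.map_zero, tmul_zero, zero_tmul, mul_zero, zero_mul,
                smul_zero, zero_smul, LinearMap.zero_apply]
          | add x y hx hy => simp only [LinearMap.map_add, LinearEquiv.map_add, tmul_add, mul_add, add_mul, hx, hy]
          | tmul d e => simp [hΘ]
  rw [h2, comul_five]
  simp only [← h1]
  rw [← map_sum, ← map_sum, ← map_sum, ← tmul_sum, (ℛ k c).eq]

lemma convHom_assoc (F E D : H →ₗ[k] H) :
    convHom (convHom F E) D = convHom F (convHom E D) := by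
  ext b
  have h1 : ∀ t : H ⊗[k] H, actHom (convHom E D) (map (comul₂.toLinearMap ∘ₗ F) .id t) =
      actHom D (map (comul₂.toLinearMap ∘ₗ actHom E ∘ₗ map (comul₂.toLinearMap ∘ₗ F) .id) .id
        ((TensorProduct.assoc k _ _ _).symm (map .id comul t))) := by
    intro t
    induction t with
    | zero =>
        simp only [LinearMap.map_zero, LinearEquiv.map_zero, tmul_zero, zero_tmul, mul_zero, zero_mul,
          smul_zero, zero_smul, LinearMap.zero_apply]
    | add x y hx hy => simp only [LinearMap.map_add, LinearEquiv.map_add, hx, hy]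
    | tmul x y =>
      rw [map_tmul, LinearMap.id_apply, LinearMap.comp_apply, AlgHom.toLinearMap_apply,
        actHom_convHom, map_tmul]
      generalize comul (R := k) y = t
      induction t with
      | zero =>
          simp only [LinearMap.map_zero, LinearEquiv.map_zero, tmul_zero, zero_tmul, mul_zero, zero_mul,
            smul_zero, zero_smul, LinearMap.zero_apply]
      | add x y hx hy => simp only [LinearMap.map_add, LinearEquiv.map_add, tmul_add, hx, hy]
      | tmul u v => simp
  have h2 : (TensorProduct.assoc k H H H).symm (map .id comul (comul b)) =
      map comul .id (comul (R := k) b) := coassoc_symm_apply b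
  rw [convHom_apply F, h1, h2, convHom_apply (convHom F E), map_map]
  rfl

end DrinfeldDouble
end Double

section Double

variable {k H : Type*} [Field k] [Ring H] [HopfAlgebra k H] [Module.Finite k H]
  [HasBijectiveAntipode k H]

namespace DrinfeldDouble

open DualCop

/-! ### The algebra structure -/

variable (k H) in
/-- Identification of `D(H)` with `Hom(H, H)`. -/
noncomputable def toHom : DrinfeldDouble k H ≃ₗ[k] H →ₗ[k] H := evalHom (k := k) (H := H) H

noncomputable instance : Mul (DrinfeldDouble k H) := ⟨fun x y => mulMap x y⟩

noncomputable instance : One (DrinfeldDouble k H) := ⟨(1 : DualCop k H) ⊗ₜ[k] (1 : H)⟩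

lemma toHom_mul (x y : DrinfeldDouble k H) :
    toHom k H (x * y) = convHom (toHom k H x) (toHom k H y) := evalHom_mulMap x y

lemma toHom_one_apply (b : H) :
    toHom k H 1 b = counit (R := k) b • 1 := evalHom_tmul _ _ _

lemma convHom_one_left (E : H →ₗ[k] H) : convHom (toHom k H 1) E = E := by
  ext b
  have h1 : ∀ t : H ⊗[k] H, actHom E (map (comul₂.toLinearMap ∘ₗ toHom k H 1) .id t) =
      E (TensorProduct.lid k H (counit.rTensor H t)) := by
    intro t
    induction t with
    | zero =>
        simp only [LinearMap.map_zero, LinearEquiv.map_zero, tmul_zero, zero_tmul, mul_zero, zero_mul,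
          smul_zero, zero_smul, LinearMap.zero_apply]
    | add x y hx hy => simp only [LinearMap.map_add, LinearEquiv.map_add, hx, hy]
    | tmul x y =>
      simp [toHom_one_apply, ← smul_tmul', Algebra.TensorProduct.one_def]
  rw [convHom_apply, h1]
  simp

lemma convHom_one_right (F : H →ₗ[k] H) : convHom F (toHom k H 1) = F := by
  ext b
  have h1 : ∀ h b : H, actHom (toHom k H 1) (comul₂ h ⊗ₜ b) = counit (R := k) b • h := by
    intro h b
    have h2 : ∀ t : H ⊗[k] (H ⊗[k] H), actHom (toHom k H 1) (t ⊗ₜ b) = counit (R := k) b •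
        TensorProduct.lid k H (map counit ((TensorProduct.rid k H).toLinearMap ∘ₗ
          map .id counit) t) := by
      intro t
      induction t with
      | zero =>
          simp only [LinearMap.map_zero, LinearEquiv.map_zero, tmul_zero, zero_tmul, mul_zero, zero_mul,
            smul_zero, zero_smul, LinearMap.zero_apply]
      | add x y hx hy => simp only [LinearMap.map_add, LinearEquiv.map_add, hx, hy, add_tmul, smul_add]
      | tmul x u =>
        induction u with
        | zero =>
            simp only [LinearMap.map_zero, LinearEquiv.map_zero, tmul_zero, zero_tmul, mul_zero, zero_mul,
              smul_zero, zero_smul, LinearMap.zero_apply]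
        | add x y hx hy => simp only [LinearMap.map_add, LinearEquiv.map_add, hx, hy, add_tmul, smul_add, tmul_add]
        | tmul y z =>
          simp [toHom_one_apply, smul_smul]
          ring_nf
    rw [h2]
    have h3 : ∀ h : H, map .id counit (comul (R := k) h) = h ⊗ₜ (1 : k) :=
      fun h => lTensor_counit_comul h
    have h4 : ∀ t : H ⊗[k] H, map counit ((TensorProduct.rid k H).toLinearMap ∘ₗ map .id counit)
        (map .id comul t) = counit.rTensor H t := by
      intro t
      induction t with
      | zero =>
          simp only [LinearMap.map_zero, LinearEquiv.map_zero, tmul_zero, zero_tmul, mul_zero, zero_mul,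
            smul_zero, zero_smul, LinearMap.zero_apply]
      | add x y hx hy => simp only [LinearMap.map_add, LinearEquiv.map_add, hx, hy]
      | tmul x y => simp [h3]
    have h5 : comul₂ (k := k) h = map .id comul (comul h) := rfl
    rw [h5, h4]
    simp
  have h2 : ∀ t : H ⊗[k] H, actHom (toHom k H 1) (map (comul₂.toLinearMap ∘ₗ F) .id t) =
      F (TensorProduct.rid k H (counit.lTensor H t)) := by
    intro t
    induction t with
    | zero =>
        simp only [LinearMap.map_zero, LinearEquiv.map_zero, tmul_zero, zero_tmul, mul_zero, zero_mul,
          smul_zero, zero_smul, LinearMap.zero_apply]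
    | add x y hx hy => simp only [LinearMap.map_add, LinearEquiv.map_add, hx, hy]
    | tmul x y => simp [h1]
  rw [convHom_apply, h2]
  simp

noncomputable instance : Ring (DrinfeldDouble k H) :=
  { (inferInstance : AddCommGroup (DrinfeldDouble k H)) with
    left_distrib := fun x y z => map_add (mulMap (k := k) (H := H) x) y z
    right_distrib := fun x y z => congr($(map_add (mulMap (k := k) (H := H)) x y) z)
    zero_mul := fun x => congr($(map_zero (mulMap (k := k) (H := H))) x)
    mul_zero := fun x => map_zero (mulMap (k := k) (H := H) x)
    mul_assoc := fun x y z => (toHom k H).injective (by simp only [toHom_mul, convHom_assoc])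
    one_mul := fun x => (toHom k H).injective (by rw [toHom_mul, convHom_one_left])
    mul_one := fun x => (toHom k H).injective (by rw [toHom_mul, convHom_one_right]) }

noncomputable instance : Algebra k (DrinfeldDouble k H) :=
  Algebra.ofModule
    (fun r x y => congr($(map_smul (mulMap (k := k) (H := H)) r x) y))
    (fun r x y => map_smul (mulMap (k := k) (H := H) x) r y)

end DrinfeldDouble
end Double

section Double

variable {k H : Type*} [Field k] [Ring H] [HopfAlgebra k H] [Module.Finite k H]
  [HasBijectiveAntipode k H]

namespace DrinfeldDouble

open DualCop

/-! ### The bialgebra structure -/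

instance : HasBijectiveAntipode k (H ⊗[k] H) where
  bijective := by
    have h := HasBijectiveAntipode.bijective (k := k) (H := H)
    exact (TensorProduct.congr (LinearEquiv.ofBijective _ h)
      (LinearEquiv.ofBijective _ h)).bijective

lemma antipodeInv_tmul (x y : H) : antipodeInv k (H ⊗[k] H) (x ⊗ₜ y) =
    antipodeInv k H x ⊗ₜ antipodeInv k H y := by
  apply (HasBijectiveAntipode.bijective (k := k) (H := H ⊗[k] H)).1
  rw [antipode_antipodeInv]
  exact congr($((antipode_antipodeInv (k := k) x).symm) ⊗ₜ[k]
    $((antipode_antipodeInv (k := k) y).symm))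

/-- `(x ⊗ (y ⊗ z)) ⊗ (x' ⊗ (y' ⊗ z')) ↦ (x ⊗ x') ⊗ ((y ⊗ y') ⊗ (z ⊗ z'))`. -/
noncomputable def shuffle : (H ⊗[k] (H ⊗[k] H)) ⊗[k] (H ⊗[k] (H ⊗[k] H)) ≃ₗ[k]
    (H ⊗[k] H) ⊗[k] ((H ⊗[k] H) ⊗[k] (H ⊗[k] H)) :=
  tensorTensorTensorComm k _ _ _ _ ≪≫ₗ
    LinearEquiv.lTensor (H ⊗[k] H) (tensorTensorTensorComm k _ _ _ _)

@[simp] lemma shuffle_tmul (x y z x' y' z' : H) :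
    shuffle (k := k) ((x ⊗ₜ (y ⊗ₜ z)) ⊗ₜ (x' ⊗ₜ (y' ⊗ₜ z'))) =
      (x ⊗ₜ x') ⊗ₜ ((y ⊗ₜ y') ⊗ₜ (z ⊗ₜ z')) := rfl

lemma comul₂_tmul (x y : H) :
    comul₂ (k := k) (x ⊗ₜ[k] y) = shuffle (comul₂ x ⊗ₜ comul₂ y) := by
  have h1 : ∀ h : H, comul₂ (k := k) h = map .id comul (comul h) := fun _ => rfl
  have h2 : comul₂ (k := k) (x ⊗ₜ[k] y) = map .id comul (comul (x ⊗ₜ[k] y)) := rfl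
  rw [h1, h1, h2, comul_tmul]
  generalize comul (R := k) x = t, comul (R := k) y = u
  induction t with
  | zero =>
      simp only [LinearMap.map_zero, LinearEquiv.map_zero, tmul_zero, zero_tmul, mul_zero, zero_mul,
        smul_zero, zero_smul, LinearMap.zero_apply]
  | add x y hx hy => simp only [LinearMap.map_add, LinearEquiv.map_add, add_tmul, hx, hy]
  | tmul x x' =>
    induction u with
    | zero =>
        simp only [LinearMap.map_zero, LinearEquiv.map_zero, tmul_zero, zero_tmul, mul_zero, zero_mul,
          smul_zero, zero_smul, LinearMap.zero_apply]
    | add x y hx hy => simp only [LinearMap.map_add, LinearEquiv.map_add, tmul_add, hx, hy]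
    | tmul y y' =>
      simp only [AlgebraTensorModule.tensorTensorTensorComm_tmul, map_tmul, LinearMap.id_apply,
        comul_tmul]
      generalize comul (R := k) x' = t, comul (R := k) y' = u
      induction t with
      | zero =>
          simp only [LinearMap.map_zero, LinearEquiv.map_zero, tmul_zero, zero_tmul, mul_zero, zero_mul,
            smul_zero, zero_smul, LinearMap.zero_apply]
      | add x y hx hy => simp only [LinearMap.map_add, LinearEquiv.map_add, add_tmul, tmul_add, hx, hy]
      | tmul x x' =>
        induction u with
        | zero =>
            simp only [LinearMap.map_zero, LinearEquiv.map_zero, tmul_zero, zero_tmul, mul_zero, zero_mul,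
              smul_zero, zero_smul, LinearMap.zero_apply]
        | add x y hx hy => simp only [LinearMap.map_add, LinearEquiv.map_add, tmul_add, hx, hy]
        | tmul y y' => simp

lemma actHom_map (E E' : H →ₗ[k] H) (t u : H ⊗[k] (H ⊗[k] H)) (b c : H) :
    actHom (map E E') (shuffle (t ⊗ₜ u) ⊗ₜ (b ⊗ₜ c)) =
      actHom E (t ⊗ₜ b) ⊗ₜ actHom E' (u ⊗ₜ c) := by
  induction t with
  | zero =>
      simp only [LinearMap.map_zero, LinearEquiv.map_zero, tmul_zero, zero_tmul, mul_zero, zero_mul,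
        smul_zero, zero_smul, LinearMap.zero_apply]
  | add x y hx hy => simp only [LinearMap.map_add, LinearEquiv.map_add, add_tmul, hx, hy]
  | tmul x t =>
    induction t with
    | zero =>
        simp only [LinearMap.map_zero, LinearEquiv.map_zero, tmul_zero, zero_tmul, mul_zero, zero_mul,
          smul_zero, zero_smul, LinearMap.zero_apply]
    | add x y hx hy => simp only [LinearMap.map_add, LinearEquiv.map_add, add_tmul, tmul_add, hx, hy]
    | tmul y z =>
      induction u with
      | zero =>
          simp only [LinearMap.map_zero, LinearEquiv.map_zero, tmul_zero, zero_tmul, mul_zero, zero_mul,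
            smul_zero, zero_smul, LinearMap.zero_apply]
      | add x y hx hy => simp only [LinearMap.map_add, LinearEquiv.map_add, add_tmul, tmul_add, hx, hy]
      | tmul x' t =>
        induction t with
        | zero =>
            simp only [LinearMap.map_zero, LinearEquiv.map_zero, tmul_zero, zero_tmul, mul_zero, zero_mul,
              smul_zero, zero_smul, LinearMap.zero_apply]
        | add x y hx hy => simp only [LinearMap.map_add, LinearEquiv.map_add, add_tmul, tmul_add, hx, hy]
        | tmul y z => simp [antipodeInv_tmul]

lemma convHom_map (F F' E E' : H →ₗ[k] H) :
    convHom (map F F') (map E E') = map (convHom F E) (convHom F' E') := by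
  ext b c
  simp only [AlgebraTensorModule.curry_apply, curry_apply, LinearMap.restrictScalars_self,
    map_tmul, convHom_apply, comul_tmul]
  generalize comul (R := k) b = t, comul (R := k) c = u
  induction t with
  | zero =>
      simp only [LinearMap.map_zero, LinearEquiv.map_zero, tmul_zero, zero_tmul, mul_zero, zero_mul,
        smul_zero, zero_smul, LinearMap.zero_apply]
  | add x y hx hy => simp only [LinearMap.map_add, LinearEquiv.map_add, add_tmul, hx, hy]
  | tmul x x' =>
    induction u with
    | zero =>
        simp only [LinearMap.map_zero, LinearEquiv.map_zero, tmul_zero, zero_tmul, mul_zero, zero_mul,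
          smul_zero, zero_smul, LinearMap.zero_apply]
    | add x y hx hy => simp only [LinearMap.map_add, LinearEquiv.map_add, tmul_add, hx, hy]
    | tmul y y' => simp [comul₂_tmul, actHom_map]

variable (k H) in
/-- Identification of `D(H) ⊗ D(H)` with `Hom(H ⊗ H, H ⊗ H)`. -/
noncomputable def toHom₂ : DrinfeldDouble k H ⊗[k] DrinfeldDouble k H ≃ₗ[k]
    H ⊗[k] H →ₗ[k] H ⊗[k] H :=
  TensorProduct.congr (toHom k H) (toHom k H) ≪≫ₗ homTensorHomEquiv k H H H H

@[simp] lemma toHom₂_tmul (x y : DrinfeldDouble k H) :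
    toHom₂ k H (x ⊗ₜ y) = map (toHom k H x) (toHom k H y) := by
  ext
  simp [toHom₂]

lemma toHom₂_mul (x y : DrinfeldDouble k H ⊗[k] DrinfeldDouble k H) :
    toHom₂ k H (x * y) = convHom (toHom₂ k H x) (toHom₂ k H y) := by
  induction x with
  | zero => simp [convHom]
  | add x x' hx hx' =>
    simp only [map_add, add_mul, hx, hx', convHom, LinearMap.comp_add, map_add_left, LinearMap.add_comp]
  | tmul x x' =>
    induction y with
    | zero => simp [convHom, actHom]
    | add x y hx hy =>
      simp only [LinearMap.map_add, LinearEquiv.map_add, mul_add, hx, hy, convHom, actHom_add, LinearMap.add_comp]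
    | tmul y y' => simp [toHom_mul, convHom_map]

lemma toHom₂_comul_apply (x : DrinfeldDouble k H) (b c : H) :
    toHom₂ k H (comul x) (b ⊗ₜ c) = comul (toHom k H x (c * b)) := by
  let T : (DualCop k H ⊗[k] H) ⊗[k] (DualCop k H ⊗[k] H) ≃ₗ[k] H ⊗[k] H →ₗ[k] H ⊗[k] H :=
    TensorProduct.congr (evalHom H) (evalHom H) ≪≫ₗ homTensorHomEquiv k H H H H
  have h0 : ∀ x : DualCop k H ⊗[k] H, T (comul x) (b ⊗ₜ c) = comul (evalHom H x (c * b)) := by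
    intro x
    induction x with
    | zero =>
        simp only [LinearMap.map_zero, LinearEquiv.map_zero, tmul_zero, zero_tmul, mul_zero, zero_mul,
          smul_zero, zero_smul, LinearMap.zero_apply]
    | add x y hx hy => simp only [LinearMap.map_add, LinearEquiv.map_add, LinearMap.add_apply, hx, hy]
    | tmul f h =>
      rw [comul_tmul, evalHom_tmul, map_smul, ← toDual_evalHom_comul]
      generalize comul (R := k) f = t, comul (R := k) h = u
      induction t with
      | zero =>
          simp only [LinearMap.map_zero, LinearEquiv.map_zero, tmul_zero, zero_tmul, mul_zero, zero_mul,
            smul_zero, zero_smul, LinearMap.zero_apply]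
      | add x y hx hy => simp only [LinearMap.map_add, LinearEquiv.map_add, add_tmul, LinearMap.add_apply, hx, hy, add_smul]
      | tmul f f' =>
        induction u with
        | zero =>
            simp only [LinearMap.map_zero, LinearEquiv.map_zero, tmul_zero, zero_tmul, mul_zero, zero_mul,
              smul_zero, zero_smul, LinearMap.zero_apply]
        | add x y hx hy => simp only [LinearMap.map_add, LinearEquiv.map_add, tmul_add, LinearMap.add_apply, hx, hy, smul_add]
        | tmul h h' => simp [T, smul_tmul', smul_smul, mul_comm]
  exact h0 x

end DrinfeldDouble
end Double

section Double

variable {k H : Type*} [Field k] [Ring H] [HopfAlgebra k H] [Module.Finite k H]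
  [HasBijectiveAntipode k H]

namespace DrinfeldDouble

open DualCop

lemma comul_six (h : H) :
    (map .id (map .id (TensorProduct.assoc k H H (H ⊗[k] H)).symm.toLinearMap) ∘ₗ
      map .id (TensorProduct.assoc k H H (H ⊗[k] (H ⊗[k] H))).toLinearMap ∘ₗ
        (TensorProduct.assoc k H (H ⊗[k] H) (H ⊗[k] (H ⊗[k] H))).toLinearMap)
        (map comul₂.toLinearMap comul₂.toLinearMap (comul (R := k) h)) =
    map .id (map .id (map comul comul ∘ₗ comul)) (comul₂ (k := k) h) := by
  have : (map .id (map .id (TensorProduct.assoc k H H (H ⊗[k] H)).symm.toLinearMap) ∘ₗ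
      map .id (TensorProduct.assoc k H H (H ⊗[k] (H ⊗[k] H))).toLinearMap ∘ₗ
        (TensorProduct.assoc k H (H ⊗[k] H) (H ⊗[k] (H ⊗[k] H))).toLinearMap) ∘ₗ
        map (map .id comul ∘ₗ comul) (map .id comul ∘ₗ comul) ∘ₗ comul (R := k) (A := H) =
    map .id (map .id (map comul comul ∘ₗ comul)) ∘ₗ (map .id comul ∘ₗ comul) := by
    simp only [coassoc_simps]
  exact congr($this h)

lemma comul₂_comul (t : H ⊗[k] H) :
    comul₂ (k := k) t = shuffle (map comul₂.toLinearMap comul₂.toLinearMap t) := by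
  induction t with
  | zero => simp
  | add x y hx hy => simp only [map_add, hx, hy]
  | tmul x y => simp [comul₂_tmul]

lemma actHom_comul (E : H →ₗ[k] H) (h b c : H) :
    actHom (comul ∘ₗ E ∘ₗ LinearMap.mul' k H ∘ₗ (TensorProduct.comm k H H).toLinearMap)
      (comul₂ (comul (R := k) h) ⊗ₜ (b ⊗ₜ c)) = comul (actHom E (comul₂ h ⊗ₜ (c * b))) := by
  let K := comul (R := k) ∘ₗ E ∘ₗ LinearMap.mul' k H ∘ₗ (TensorProduct.comm k H H).toLinearMap
  let R : (H ⊗[k] (H ⊗[k] H)) ⊗[k] (H ⊗[k] (H ⊗[k] H)) ≃ₗ[k]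
      H ⊗[k] (H ⊗[k] ((H ⊗[k] H) ⊗[k] (H ⊗[k] H))) :=
    TensorProduct.assoc k H (H ⊗[k] H) (H ⊗[k] (H ⊗[k] H)) ≪≫ₗ
      LinearEquiv.lTensor H (TensorProduct.assoc k H H (H ⊗[k] (H ⊗[k] H)) ≪≫ₗ
        LinearEquiv.lTensor H (TensorProduct.assoc k H H (H ⊗[k] H)).symm)
  let Ψ : H ⊗[k] (H ⊗[k] ((H ⊗[k] H) ⊗[k] (H ⊗[k] H))) →ₗ[k] H ⊗[k] H :=
    (actHom K ∘ₗ (TensorProduct.mk k _ _).flip (b ⊗ₜ c)) ∘ₗ shuffle.toLinearMap ∘ₗ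
      R.symm.toLinearMap
  have hΨ : ∀ x y z x' y' z' : H, Ψ (x ⊗ₜ (y ⊗ₜ ((z ⊗ₜ x') ⊗ₜ (y' ⊗ₜ z')))) = (y ⊗ₜ y') *
      comul (E ((antipodeInv k H z' * c * x') * (antipodeInv k H z * b * x))) := by
    intros
    simp [Ψ, R, K, antipodeInv_tmul]
  have hR : ∀ t, (map .id (map .id (TensorProduct.assoc k H H (H ⊗[k] H)).symm.toLinearMap) ∘ₗ
      map .id (TensorProduct.assoc k H H (H ⊗[k] (H ⊗[k] H))).toLinearMap ∘ₗ
        (TensorProduct.assoc k H (H ⊗[k] H) (H ⊗[k] (H ⊗[k] H))).toLinearMap) t = R t := by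
    intro t
    simp only [← LinearEquiv.coe_coe]
    congr 1
    ext
    rfl
  let Φ (x : H) : H ⊗[k] (H ⊗[k] H) →ₗ[k] H ⊗[k] H :=
    LinearMap.mul' k (H ⊗[k] H) ∘ₗ map .id (comul ∘ₗ E ∘ₗ LinearMap.mulRight k x ∘ₗ
      LinearMap.mulRight k (c * b) ∘ₗ antipodeInv k H) ∘ₗ
        (TensorProduct.assoc k H H H).symm.toLinearMap
  have hΦ : ∀ x y y' z' : H, Φ x (y ⊗ₜ (y' ⊗ₜ z')) = (y ⊗ₜ y') *
      comul (E (antipodeInv k H z' * (c * b) * x)) := by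
    intros
    simp [Φ, mul_assoc]
  have hA : ∀ (x y w : H) (s : H ⊗[k] H), Ψ (x ⊗ₜ (y ⊗ₜ (comul w ⊗ₜ s))) =
      counit (R := k) w • Φ x (y ⊗ₜ s) := by
    intro x y w s
    induction s with
    | zero =>
        simp only [LinearMap.map_zero, LinearEquiv.map_zero, tmul_zero, zero_tmul, mul_zero, zero_mul,
          smul_zero, zero_smul, LinearMap.zero_apply]
    | add x y hx hy => simp only [tmul_add, map_add, hx, hy, smul_add]
    | tmul y' z' =>
      have h1 : ∀ t : H ⊗[k] H, Ψ (x ⊗ₜ (y ⊗ₜ (t ⊗ₜ (y' ⊗ₜ z')))) = (y ⊗ₜ y') *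
          comul (E (antipodeInv k H z' * c * (LinearMap.mul' k H
            (map .id (antipodeInv k H) (TensorProduct.comm k H H t))) * b * x)) := by
        intro t
        induction t with
        | zero =>
            simp only [LinearMap.map_zero, LinearEquiv.map_zero, tmul_zero, zero_tmul, mul_zero, zero_mul,
              smul_zero, zero_smul, LinearMap.zero_apply]
        | add x y hx hy => simp only [add_tmul, tmul_add, map_add, hx, hy, mul_add, add_mul]
        | tmul z x' => simp [hΨ, mul_assoc]
      rw [h1, mul_antipodeInv_cop, hΦ]
      simp [Algebra.algebraMap_eq_smul_one, mul_assoc]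
  have hB : ∀ x y w : H, Ψ (x ⊗ₜ (y ⊗ₜ map comul comul (comul w))) = Φ x (y ⊗ₜ comul w) := by
    intro x y w
    have h1 : ∀ t : H ⊗[k] H, Ψ (x ⊗ₜ (y ⊗ₜ map comul comul t)) =
        Φ x (y ⊗ₜ comul (TensorProduct.lid k H (counit.rTensor H t))) := by
      intro t
      induction t with
      | zero =>
          simp only [LinearMap.map_zero, LinearEquiv.map_zero, tmul_zero, zero_tmul, mul_zero, zero_mul,
            smul_zero, zero_smul, LinearMap.zero_apply]
      | add x y hx hy => simp only [tmul_add, map_add, hx, hy]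
      | tmul w v => simp [hA]
    rw [h1]
    simp
  have hC : ∀ x u : H, Φ x (comul.lTensor H (comul u)) =
      comul (actHom E ((x ⊗ₜ comul u) ⊗ₜ (c * b))) := by
    intro x u
    rw [← coassoc_apply]
    generalize comul (R := k) u = t
    induction t with
    | zero =>
        simp only [LinearMap.map_zero, LinearEquiv.map_zero, tmul_zero, zero_tmul, mul_zero, zero_mul,
          smul_zero, zero_smul, LinearMap.zero_apply]
    | add x y hx hy => simp only [tmul_add, add_tmul, map_add, hx, hy]
    | tmul y z =>
      rw [actHom_tmul, Bialgebra.comul_mul, LinearMap.rTensor_tmul]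
      generalize comul (R := k) y = t
      induction t with
      | zero =>
          simp only [LinearMap.map_zero, LinearEquiv.map_zero, tmul_zero, zero_tmul, mul_zero, zero_mul,
            smul_zero, zero_smul, LinearMap.zero_apply]
      | add x y hx hy => simp only [add_tmul, map_add, hx, hy, add_mul]
      | tmul y y' => simp [hΦ]
  have hD : ∀ x u : H, Ψ (x ⊗ₜ map .id (map comul comul ∘ₗ comul) (comul u)) =
      Φ x (comul.lTensor H (comul u)) := by
    intro x u
    generalize comul (R := k) u = t
    induction t with
    | zero =>
        simp only [LinearMap.map_zero, LinearEquiv.map_zero, tmul_zero, zero_tmul, mul_zero, zero_mul,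
          smul_zero, zero_smul, LinearMap.zero_apply]
    | add x y hx hy => simp only [tmul_add, map_add, hx, hy]
    | tmul y w => simp [hB]
  have hF : ∀ t : H ⊗[k] H, Ψ (map .id (map .id (map comul comul ∘ₗ comul)) (map .id comul t)) =
      comul (actHom E ((map .id comul t) ⊗ₜ (c * b))) := by
    intro t
    induction t with
    | zero =>
        simp only [LinearMap.map_zero, LinearEquiv.map_zero, tmul_zero, zero_tmul, mul_zero, zero_mul,
          smul_zero, zero_smul, LinearMap.zero_apply]
    | add x y hx hy => simp only [add_tmul, map_add, hx, hy]
    | tmul x u => rw [map_tmul, map_tmul, LinearMap.id_apply, LinearMap.id_apply, hD, hC]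
  have h6 := comul_six (k := k) h
  rw [hR] at h6
  calc _ = Ψ (R (map comul₂.toLinearMap comul₂.toLinearMap (comul (R := k) h))) := by
        simp only [Ψ, LinearMap.comp_apply, LinearEquiv.coe_coe, LinearEquiv.symm_apply_apply,
          comul₂_comul]
        rfl
    _ = _ := by
        rw [h6]
        exact hF (comul h)

lemma comul_mul' (x y : DrinfeldDouble k H) :
    comul (R := k) (x * y) = comul (R := k) x * comul (R := k) y := by
  have h0 : ∀ x : DrinfeldDouble k H, toHom₂ k H (comul x) = comul ∘ₗ toHom k H x ∘ₗ
      LinearMap.mul' k H ∘ₗ (TensorProduct.comm k H H).toLinearMap := by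
    intro x
    ext b c
    simp [toHom₂_comul_apply]
  apply (toHom₂ k H).injective
  rw [toHom₂_mul]
  ext b c
  have h1 := toHom₂_comul_apply (x * y) b c
  rw [toHom_mul, convHom_apply, Bialgebra.comul_mul] at h1
  simp only [AlgebraTensorModule.curry_apply, curry_apply, LinearMap.restrictScalars_self]
  rw [h1, convHom_apply, comul_tmul, h0, h0]
  generalize comul (R := k) b = t, comul (R := k) c = u
  induction t with
  | zero =>
      simp only [LinearMap.map_zero, LinearEquiv.map_zero, tmul_zero, zero_tmul, mul_zero, zero_mul,
        smul_zero, zero_smul, LinearMap.zero_apply]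
  | add x y hx hy => simp only [LinearMap.map_add, LinearEquiv.map_add, add_tmul, mul_add, hx, hy]
  | tmul b b' =>
    induction u with
    | zero =>
        simp only [LinearMap.map_zero, LinearEquiv.map_zero, tmul_zero, zero_tmul, mul_zero, zero_mul,
          smul_zero, zero_smul, LinearMap.zero_apply]
    | add x y hx hy => simp only [LinearMap.map_add, LinearEquiv.map_add, tmul_add, add_mul, hx, hy]
    | tmul c c' => simp [← actHom_comul]

lemma comul_one' : comul (R := k) (1 : DrinfeldDouble k H) = 1 := by
  apply (toHom₂ k H).injective
  ext b c
  have h1 : (1 : DrinfeldDouble k H ⊗[k] DrinfeldDouble k H) = 1 ⊗ₜ 1 := rfl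
  simp only [AlgebraTensorModule.curry_apply, curry_apply, LinearMap.restrictScalars_self]
  rw [toHom₂_comul_apply, h1, toHom₂_tmul, map_tmul]
  simp [toHom_one_apply, Algebra.TensorProduct.one_def, smul_tmul', smul_smul]

lemma counit_eq (x : DrinfeldDouble k H) : counit (R := k) x = counit (toHom k H x 1) := by
  have h0 : ∀ x : DualCop k H ⊗[k] H,
      counit (R := k) (A := DualCop k H ⊗[k] H) x = counit (evalHom H x 1) := by
    intro x
    induction x with
    | zero =>
        simp only [LinearMap.map_zero, LinearEquiv.map_zero, tmul_zero, zero_tmul, mul_zero, zero_mul,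
          smul_zero, zero_smul, LinearMap.zero_apply]
    | add x y hx hy => simp only [LinearMap.map_add, LinearEquiv.map_add, LinearMap.add_apply, hx, hy]
    | tmul f h => simp [DualCop.counit_eq, mul_comm]
  exact h0 x

lemma counit_mul' (x y : DrinfeldDouble k H) :
    counit (R := k) (x * y) = counit (R := k) x * counit (R := k) y := by
  simp only [counit_eq, toHom_mul, convHom_apply, Bialgebra.comul_one,
    Algebra.TensorProduct.one_def, map_tmul, LinearMap.comp_apply, AlgHom.toLinearMap_apply,
    LinearMap.id_apply]
  generalize toHom k H x 1 = h, toHom k H y = E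
  have h1 : ∀ x u : H, counit (R := k) (actHom E ((x ⊗ₜ comul (R := k) u) ⊗ₜ 1)) =
      counit (R := k) (E (antipodeInv k H u * x)) := by
    intro x u
    have h2 : ∀ t : H ⊗[k] H, counit (R := k) (actHom E ((x ⊗ₜ t) ⊗ₜ 1)) =
        counit (R := k) (E (antipodeInv k H (TensorProduct.lid k H (counit.rTensor H t)) * x)) := by
      intro t
      induction t with
      | zero =>
          simp only [LinearMap.map_zero, LinearEquiv.map_zero, tmul_zero, zero_tmul, mul_zero, zero_mul,
            smul_zero, zero_smul, LinearMap.zero_apply]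
      | add x y hx hy => simp only [tmul_add, add_tmul, map_add, hx, hy, add_mul]
      | tmul y z => simp
    rw [h2]
    simp
  have h3 : ∀ t : H ⊗[k] H, counit (R := k) (actHom E (map .id comul t ⊗ₜ 1)) =
      counit (R := k) (E (LinearMap.mul' k H (map (antipodeInv k H) .id
        (TensorProduct.comm k H H t)))) := by
    intro t
    induction t with
    | zero =>
        simp only [LinearMap.map_zero, LinearEquiv.map_zero, tmul_zero, zero_tmul, mul_zero, zero_mul,
          smul_zero, zero_smul, LinearMap.zero_apply]
    | add x y hx hy => simp only [add_tmul, map_add, hx, hy]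
    | tmul y z => simp [h1]
  refine (h3 (comul h)).trans ?_
  rw [antipodeInv_mul_cop]
  simp [Algebra.algebraMap_eq_smul_one]

noncomputable instance : Bialgebra k (DrinfeldDouble k H) :=
  Bialgebra.mk' k (DrinfeldDouble k H)
    (by simp [counit_eq, toHom_one_apply]) (counit_mul' _ _) comul_one' (comul_mul' _ _)

end DrinfeldDouble
end Double

section Double

variable {k H : Type*} [Field k] [Ring H] [HopfAlgebra k H] [Module.Finite k H]
  [HasBijectiveAntipode k H]

namespace DrinfeldDouble

open DualCop

/-! ### The antipode -/

lemma mulMap_one_right (f g : DualCop k H) (l : H) :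
    mulMap (g ⊗ₜ[k] (1 : H)) (f ⊗ₜ[k] l) = (g * f) ⊗ₜ[k] l := by
  have h : hitRight (1 : H) (hitLeft (1 : H) f) = f := DualCop.ext_toDual fun b => by simp
  simp [mulMap_tmul, Algebra.TensorProduct.one_def, twist_tmul, h]

lemma mulMap_one_left (h l : H) :
    mulMap ((1 : DualCop k H) ⊗ₜ[k] h) ((1 : DualCop k H) ⊗ₜ[k] l) =
      (1 : DualCop k H) ⊗ₜ[k] (h * l) := by
  have h1 : ∀ x u : H, twist (1 : DualCop k H) (x ⊗ₜ comul u) =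
      (1 : DualCop k H) ⊗ₜ (counit (R := k) x • u) := by
    intro x u
    have h2 : ∀ t : H ⊗[k] H, twist (1 : DualCop k H) (x ⊗ₜ t) =
        (1 : DualCop k H) ⊗ₜ (counit (R := k) x • TensorProduct.rid k H (counit.lTensor H t)) := by
      intro t
      induction t with
      | zero =>
          simp only [LinearMap.map_zero, LinearEquiv.map_zero, tmul_zero, zero_tmul, mul_zero, zero_mul,
            smul_zero, zero_smul, LinearMap.zero_apply]
      | add x y hx hy => simp only [tmul_add, map_add, hx, hy, smul_add]
      | tmul y z =>
        have h3 : hitRight (antipodeInv k H z) (hitLeft x (1 : DualCop k H)) =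
            (counit (R := k) x * counit (R := k) z) • 1 :=
          DualCop.ext_toDual fun b => by simp; ring
        simp [twist_tmul, h3, smul_smul, smul_tmul]
    rw [h2]
    simp
  have h4 : ∀ t : H ⊗[k] H, twist (1 : DualCop k H) (map .id comul t) =
      (1 : DualCop k H) ⊗ₜ (TensorProduct.lid k H (counit.rTensor H t)) := by
    intro t
    induction t with
    | zero =>
        simp only [LinearMap.map_zero, LinearEquiv.map_zero, tmul_zero, zero_tmul, mul_zero, zero_mul,
          smul_zero, zero_smul, LinearMap.zero_apply]
    | add x y hx hy => simp only [tmul_add, map_add, hx, hy]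
    | tmul y z => simp [h1]
  have h5 : twist (1 : DualCop k H) (comul₂ h) = 1 ⊗ₜ h := (h4 (comul h)).trans (by simp)
  simp [mulMap_tmul, h5]

/-- The inclusion of `(H^*)^cop` in `D(H)`. -/
noncomputable def inclDual : DualCop k H →ₐ[k] DrinfeldDouble k H :=
  AlgHom.ofLinearMap ((TensorProduct.mk k (DualCop k H) H).flip 1) rfl
    fun f g => (mulMap_one_right g f 1).symm

/-- The inclusion of `H` in `D(H)`. -/
noncomputable def incl : H →ₐ[k] DrinfeldDouble k H :=
  AlgHom.ofLinearMap (TensorProduct.mk k (DualCop k H) H 1) rfl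
    fun h l => (mulMap_one_left h l).symm

lemma inclDual_mul_incl (f : DualCop k H) (h : H) :
    (inclDual f * incl h : DrinfeldDouble k H) = f ⊗ₜ[k] h :=
  (mulMap_one_right 1 f h).trans (by rw [mul_one])

/-- `f ↦ f ∘ S⁻¹`. -/
noncomputable def dualAntipode : DualCop k H →ₗ[k] DualCop k H :=
  (toDual k H).symm.toLinearMap ∘ₗ (antipodeInv k H).dualMap ∘ₗ (toDual k H).toLinearMap

@[simp] lemma toDual_dualAntipode (f : DualCop k H) (b : H) :
    toDual k H (dualAntipode f) b = toDual k H f (antipodeInv k H b) := by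
  simp [dualAntipode]

lemma dualAntipode_mul (f : DualCop k H) :
    LinearMap.mul' k _ (map dualAntipode .id (comul f)) = counit (R := k) f • 1 := by
  refine DualCop.ext_toDual fun b => ?_
  have h1 : ∀ t : DualCop k H ⊗[k] DualCop k H,
      toDual k H (LinearMap.mul' k _ (map dualAntipode .id t)) b = ∑ i ∈ (ℛ k b).index,
        toDual k H (evalHom _ t (antipodeInv k H ((ℛ k b).left i))) ((ℛ k b).right i) := by
    intro t
    induction t with
    | zero => simp
    | add x y hx hy => simp only [LinearMap.map_add, LinearEquiv.map_add, LinearMap.add_apply, hx, hy, Finset.sum_add_distrib]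
    | tmul f g => simp [toDual_mul_apply, ← (ℛ k b).eq]
  have h2 := mul_antipodeInv_cop (k := k) b
  rw [← (ℛ k b).eq] at h2
  simp only [map_sum, comm_tmul, map_tmul, LinearMap.id_apply, LinearMap.mul'_apply] at h2
  rw [h1]
  simp only [toDual_evalHom_comul]
  rw [← map_sum, h2]
  simp [Algebra.algebraMap_eq_smul_one, DualCop.counit_eq, mul_comm]

lemma mul_dualAntipode (f : DualCop k H) :
    LinearMap.mul' k _ (map .id dualAntipode (comul f)) = counit (R := k) f • 1 := by
  refine DualCop.ext_toDual fun b => ?_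
  have h1 : ∀ t : DualCop k H ⊗[k] DualCop k H,
      toDual k H (LinearMap.mul' k _ (map .id dualAntipode t)) b = ∑ i ∈ (ℛ k b).index,
        toDual k H (evalHom _ t ((ℛ k b).left i)) (antipodeInv k H ((ℛ k b).right i)) := by
    intro t
    induction t with
    | zero => simp
    | add x y hx hy => simp only [LinearMap.map_add, LinearEquiv.map_add, LinearMap.add_apply, hx, hy, Finset.sum_add_distrib]
    | tmul f g => simp [toDual_mul_apply, ← (ℛ k b).eq]
  have h2 := antipodeInv_mul_cop (k := k) b
  rw [← (ℛ k b).eq] at h2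
  simp only [map_sum, comm_tmul, map_tmul, LinearMap.id_apply, LinearMap.mul'_apply] at h2
  rw [h1]
  simp only [toDual_evalHom_comul]
  rw [← map_sum, h2]
  simp [Algebra.algebraMap_eq_smul_one, DualCop.counit_eq, mul_comm]

/-- The antipode `f ⊗ h ↦ (ε ⊗ S(h)) ((f ∘ S⁻¹) ⊗ 1)`. -/
noncomputable def antipodeMap : DualCop k H ⊗[k] H →ₗ[k] DrinfeldDouble k H :=
  LinearMap.mul' k (DrinfeldDouble k H) ∘ₗ map (incl.toLinearMap ∘ₗ antipode k)
    (inclDual.toLinearMap ∘ₗ dualAntipode) ∘ₗ (TensorProduct.comm k (DualCop k H) H).toLinearMap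

/-- `D(H)` is a Hopf algebra. -/
noncomputable instance : HopfAlgebra k (DrinfeldDouble k H) where
  antipode := antipodeMap
  mul_antipode_rTensor_comul := by
    let j : DualCop k H ⊗[k] H →ₗ[k] DrinfeldDouble k H :=
      (LinearMap.id : DrinfeldDouble k H →ₗ[k] DrinfeldDouble k H)
    have hj : ∀ (f : DualCop k H) (h : H), j (f ⊗ₜ h) = inclDual f * incl h :=
      fun f h => (inclDual_mul_incl f h).symm
    have h0 : ∀ x : DualCop k H ⊗[k] H, LinearMap.mul' k (DrinfeldDouble k H)
        (map antipodeMap j (comul x)) = algebraMap k _ (counit x) := by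
      intro x
      induction x with
      | zero => simp
      | add x y hx hy => simp only [map_add, hx, hy]
      | tmul f h =>
        rw [comul_tmul]
        have h1 : ∀ (t : DualCop k H ⊗[k] DualCop k H) (u : H ⊗[k] H),
            LinearMap.mul' k (DrinfeldDouble k H) (map antipodeMap j
              (AlgebraTensorModule.tensorTensorTensorComm k k k k _ _ _ _ (t ⊗ₜ u))) =
            LinearMap.mul' k (DrinfeldDouble k H) (map (LinearMap.mulRight k
              (inclDual (LinearMap.mul' k _ (map dualAntipode .id t))) ∘ₗ
                incl.toLinearMap ∘ₗ antipode k) incl.toLinearMap u) := by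
          intro t u
          induction u with
          | zero =>
              simp only [LinearMap.map_zero, LinearEquiv.map_zero, tmul_zero, zero_tmul, mul_zero, zero_mul,
                smul_zero, zero_smul, LinearMap.zero_apply]
          | add x y hx hy => simp only [tmul_add, map_add, hx, hy]
          | tmul h h' =>
            induction t with
            | zero => simp
            | add x y hx hy =>
              simp only [add_tmul, map_add, hx, hy, map_tmul, LinearMap.comp_apply,
                LinearMap.mulRight_apply, LinearMap.mul'_apply, mul_add, add_mul]
            | tmul f f' => simp [antipodeMap, hj, mul_assoc]
        have h2 : ∀ u : H ⊗[k] H, LinearMap.mul' k (DrinfeldDouble k H) (map (LinearMap.mulRight k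
              (inclDual (counit (R := k) f • 1)) ∘ₗ
                incl.toLinearMap ∘ₗ antipode k) incl.toLinearMap u) =
            counit (R := k) f • incl (LinearMap.mul' k H ((antipode k).rTensor H u)) := by
          intro u
          induction u with
          | zero => simp
          | add x y hx hy => simp only [map_add, hx, hy, smul_add]
          | tmul h h' => simp
        rw [h1, dualAntipode_mul, h2]
        simp [Algebra.algebraMap_eq_smul_one, smul_smul, mul_comm]
    exact LinearMap.ext h0
  mul_antipode_lTensor_comul := by
    let j : DualCop k H ⊗[k] H →ₗ[k] DrinfeldDouble k H :=
      (LinearMap.id : DrinfeldDouble k H →ₗ[k] DrinfeldDouble k H)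
    have hj : ∀ (f : DualCop k H) (h : H), j (f ⊗ₜ h) = inclDual f * incl h :=
      fun f h => (inclDual_mul_incl f h).symm
    have h0 : ∀ x : DualCop k H ⊗[k] H, LinearMap.mul' k (DrinfeldDouble k H)
        (map j antipodeMap (comul x)) = algebraMap k _ (counit x) := by
      intro x
      induction x with
      | zero => simp
      | add x y hx hy => simp only [map_add, hx, hy]
      | tmul f h =>
        rw [comul_tmul]
        have h1 : ∀ (t : DualCop k H ⊗[k] DualCop k H) (u : H ⊗[k] H),
            LinearMap.mul' k (DrinfeldDouble k H) (map j antipodeMap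
              (AlgebraTensorModule.tensorTensorTensorComm k k k k _ _ _ _ (t ⊗ₜ u))) =
            LinearMap.mul' k (DrinfeldDouble k H) (map (LinearMap.mulRight k
              (incl (LinearMap.mul' k _ ((antipode k).lTensor H u))) ∘ₗ
                inclDual.toLinearMap) (inclDual.toLinearMap ∘ₗ dualAntipode) t) := by
          intro t u
          induction t with
          | zero =>
              simp only [LinearMap.map_zero, LinearEquiv.map_zero, tmul_zero, zero_tmul, mul_zero, zero_mul,
                smul_zero, zero_smul, LinearMap.zero_apply]
          | add x y hx hy => simp only [add_tmul, map_add, hx, hy]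
          | tmul f f' =>
            induction u with
            | zero => simp
            | add x y hx hy =>
              simp only [tmul_add, map_add, hx, hy, map_tmul, LinearMap.comp_apply,
                LinearMap.mulRight_apply, LinearMap.mul'_apply, mul_add, add_mul]
            | tmul h h' => simp [antipodeMap, hj, mul_assoc]
        have h2 : ∀ t : DualCop k H ⊗[k] DualCop k H, LinearMap.mul' k (DrinfeldDouble k H)
            (map (LinearMap.mulRight k (incl (algebraMap k H (counit h))) ∘ₗ
                inclDual.toLinearMap) (inclDual.toLinearMap ∘ₗ dualAntipode) t) =
            counit (R := k) h • inclDual (LinearMap.mul' k _ (map .id dualAntipode t)) := by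
          intro t
          induction t with
          | zero => simp
          | add x y hx hy => simp only [map_add, hx, hy, smul_add]
          | tmul f f' => simp [Algebra.algebraMap_eq_smul_one]
        rw [h1, mul_antipode_lTensor_comul_apply, h2, mul_dualAntipode]
        simp [Algebra.algebraMap_eq_smul_one, smul_smul]
    exact LinearMap.ext h0

end DrinfeldDouble
end Double

section QBinomial

variable {k : Type*} [Field k]

/-- The `q`-binomial coefficients, defined by the `q`-Pascal rule. -/
def qChoose (q : k) : ℕ → ℕ → k
  | _, 0 => 1
  | 0, _ + 1 => 0
  | n + 1, i + 1 => qChoose q n i + q ^ (i + 1) * qChoose q n (i + 1)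

@[simp] lemma qChoose_zero_right (q : k) (n : ℕ) : qChoose q n 0 = 1 := by cases n <;> rfl

@[simp] lemma qChoose_zero_succ (q : k) (i : ℕ) : qChoose q 0 (i + 1) = 0 := rfl

lemma qChoose_succ_succ (q : k) (n i : ℕ) : qChoose q (n + 1) (i + 1) =
    qChoose q n i + q ^ (i + 1) * qChoose q n (i + 1) := rfl

lemma qChoose_eq_zero (q : k) (n i : ℕ) (h : n < i) : qChoose q n i = 0 := by
  induction n generalizing i with
  | zero => obtain ⟨i, rfl⟩ := Nat.exists_eq_succ_of_ne_zero h.ne'; rfl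
  | succ n ih =>
    obtain ⟨i, rfl⟩ := Nat.exists_eq_succ_of_ne_zero (Nat.ne_of_gt (Nat.zero_lt_of_lt h))
    rw [Nat.succ_eq_add_one, qChoose_succ_succ, ih i (by omega), ih (i + 1) (by omega)]
    simp

lemma qChoose_self (q : k) (n : ℕ) : qChoose q n n = 1 := by
  induction n with
  | zero => rfl
  | succ n ih => rw [qChoose_succ_succ, ih, qChoose_eq_zero q n (n + 1) (by omega)]; simp

lemma qChoose_rec (q : k) (n i : ℕ) :
    q ^ i * (1 - q ^ (i + 1)) * qChoose q n (i + 1) = (q ^ i - q ^ n) * qChoose q n i := by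
  induction n generalizing i with
  | zero => cases i <;> simp
  | succ n ih =>
    cases i with
    | zero =>
      have := ih 0
      rw [qChoose_succ_succ]
      simp only [pow_zero, zero_add, qChoose_zero_right] at this ⊢
      linear_combination q * this
    | succ j =>
      have h1 := ih j
      have h2 := ih (j + 1)
      rw [qChoose_succ_succ, qChoose_succ_succ]
      linear_combination q ^ (j + 2) * h2 + q * h1

lemma qChoose_eq_zero_of_isPrimitiveRoot {q : k} {l : ℕ} (hq : IsPrimitiveRoot q l) (i : ℕ)
    (hi : i + 1 < l) : qChoose q l (i + 1) = 0 := by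
  have hq0 : q ≠ 0 := hq.ne_zero (by omega)
  have h1 : q ^ i * (1 - q ^ (i + 1)) ≠ 0 :=
    mul_ne_zero (pow_ne_zero _ hq0)
      (sub_ne_zero.mpr (hq.pow_ne_one_of_pos_of_lt (by omega) hi).symm)
  have h2 := qChoose_rec q l i
  have h3 : (q ^ i - q ^ l) * qChoose q l i = 0 := by
    induction i with
    | zero => simp [hq.pow_eq_one]
    | succ i ih =>
      have hi' : i + 1 < l := by omega
      have h1' : q ^ i * (1 - q ^ (i + 1)) ≠ 0 :=
        mul_ne_zero (pow_ne_zero _ hq0)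
          (sub_ne_zero.mpr (hq.pow_ne_one_of_pos_of_lt (by omega) hi').symm)
      have h3' := ih hi' h1' (qChoose_rec q l i)
      have h2' := qChoose_rec q l i
      rw [h3'] at h2'
      rw [(mul_eq_zero.mp h2').resolve_left h1', mul_zero]
  rw [h3] at h2
  exact (mul_eq_zero.mp h2).resolve_left h1

variable {A : Type*} [Ring A] [Algebra k A]

lemma qCommute_pow {q : k} {x y : A} (h : y * x = q • (x * y)) (n : ℕ) :
    y * x ^ n = q ^ n • (x ^ n * y) := by
  induction n with
  | zero => simp
  | succ n ih =>
    rw [pow_succ, ← mul_assoc, ih, smul_mul_assoc, mul_assoc, h, mul_smul_comm, smul_smul,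
      mul_assoc, pow_succ]

lemma qCommute_add_pow {q : k} {x y : A} (h : y * x = q • (x * y)) (n : ℕ) :
    (x + y) ^ n = ∑ p ∈ Finset.HasAntidiagonal.antidiagonal n, qChoose q n p.1 • (x ^ p.1 * y ^ p.2) := by
  induction n with
  | zero => simp
  | succ n ih =>
    rw [pow_succ', ih, add_mul, Finset.mul_sum, Finset.mul_sum]
    have h1 : ∀ p : ℕ × ℕ, x * (qChoose q n p.1 • (x ^ p.1 * y ^ p.2)) =
        qChoose q n p.1 • (x ^ (p.1 + 1) * y ^ p.2) := by
      intro p; rw [mul_smul_comm, pow_succ', mul_assoc]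
    have h2 : ∀ p : ℕ × ℕ, y * (qChoose q n p.1 • (x ^ p.1 * y ^ p.2)) =
        (q ^ p.1 * qChoose q n p.1) • (x ^ p.1 * y ^ (p.2 + 1)) := by
      intro p
      rw [mul_smul_comm, ← mul_assoc, qCommute_pow h, smul_mul_assoc, smul_smul, mul_assoc,
        ← pow_succ', mul_comm]
    simp only [h1, h2]
    have h3 := Finset.Nat.sum_antidiagonal_succ (n := n)
      (f := fun p => (q ^ p.1 * qChoose q n p.1) • (x ^ p.1 * y ^ p.2))
    have h4 := Finset.Nat.sum_antidiagonal_succ' (n := n)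
      (f := fun p => (q ^ p.1 * qChoose q n p.1) • (x ^ p.1 * y ^ p.2))
    rw [h3] at h4
    simp only [qChoose_eq_zero q n (n + 1) (by omega), mul_zero, zero_smul, zero_add] at h4
    rw [← h4, Finset.Nat.sum_antidiagonal_succ]
    simp only [qChoose_succ_succ, add_smul, Finset.sum_add_distrib, qChoose_zero_right, pow_zero,
      one_mul, mul_one]
    abel

/-- If `y x = q x y` with `q` a primitive `l`-th root of unity, then `(x + y)^l = x^l + y^l`. -/
lemma add_pow_of_qCommute {q : k} {l : ℕ} (hq : IsPrimitiveRoot q l) (hl : 0 < l) {x y : A}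
    (h : y * x = q • (x * y)) : (x + y) ^ l = x ^ l + y ^ l := by
  rw [qCommute_add_pow h]
  obtain ⟨m, rfl⟩ := Nat.exists_eq_succ_of_ne_zero hl.ne'
  rw [Finset.Nat.sum_antidiagonal_succ, Finset.sum_eq_single_of_mem (m, 0) (by simp)]
  · simp [qChoose_self, add_comm]
  · rintro ⟨i, j⟩ hp hne
    rw [Finset.HasAntidiagonal.mem_antidiagonal] at hp
    have : i < m := by
      rcases Nat.lt_or_ge i m with h | h
      · exact h
      · exact absurd (Prod.ext (by simp at hp ⊢; omega) (by simp at hp ⊢; omega)) hne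
    rw [qChoose_eq_zero_of_isPrimitiveRoot hq i (by omega), zero_smul]

lemma mul_pow_of_qCommute {q : k} {x y : A} (h : y * x = q • (x * y)) (n : ℕ) :
    ∃ c : k, (x * y) ^ n = c • (x ^ n * y ^ n) := by
  induction n with
  | zero => exact ⟨1, by simp⟩
  | succ n ih =>
    obtain ⟨c, hc⟩ := ih
    refine ⟨c * q ^ n, ?_⟩
    rw [pow_succ', hc, mul_smul_comm, mul_assoc, ← mul_assoc y, qCommute_pow h, smul_mul_assoc,
      mul_smul_comm, smul_smul, mul_assoc, ← pow_succ', ← mul_assoc, ← pow_succ']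

end QBinomial

section HopfOfGenerators

variable {k B : Type*} [Field k] [Ring B] [Bialgebra k B]

/-- The linear map underlying an algebra map to the opposite algebra. -/
noncomputable def unopHom (S : B →ₐ[k] Bᵐᵒᵖ) : B →ₗ[k] B :=
  (MulOpposite.opLinearEquiv k).symm.toLinearMap ∘ₗ S.toLinearMap

@[simp] lemma unopHom_apply (S : B →ₐ[k] Bᵐᵒᵖ) (b : B) : unopHom S b = (S b).unop := rfl

lemma antipode_rTensor_of_adjoin (S : B →ₐ[k] Bᵐᵒᵖ) {s : Set B} (hs : Algebra.adjoin k s = ⊤)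
    (h : ∀ b ∈ s, LinearMap.mul' k B ((unopHom S).rTensor B (comul b)) =
      algebraMap k B (counit b)) (b : B) :
    LinearMap.mul' k B ((unopHom S).rTensor B (comul b)) = algebraMap k B (counit b) := by
  have hb : b ∈ Algebra.adjoin k s := hs ▸ Algebra.mem_top
  induction hb using Algebra.adjoin_induction with
  | mem b hb => exact h b hb
  | algebraMap r => simp [Algebra.algebraMap_eq_smul_one, Algebra.TensorProduct.one_def]
  | add b c _ _ hb hc => simp only [map_add, hb, hc]
  | mul b c _ _ hb hc =>
    have h1 : ∀ t u : B ⊗[k] B, LinearMap.mul' k B ((unopHom S).rTensor B t) =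
        algebraMap k B (counit b) → LinearMap.mul' k B ((unopHom S).rTensor B (t * u)) =
          counit (R := k) b • LinearMap.mul' k B ((unopHom S).rTensor B u) := by
      intro t u ht
      induction u with
      | zero =>
          simp only [LinearMap.map_zero, LinearEquiv.map_zero, tmul_zero, zero_tmul, mul_zero, zero_mul,
            smul_zero, zero_smul, LinearMap.zero_apply]
      | add x y hx hy => simp only [mul_add, map_add, hx, hy, smul_add]
      | tmul x y =>
        have h2 : ∀ t : B ⊗[k] B, LinearMap.mul' k B ((unopHom S).rTensor B (t * (x ⊗ₜ y))) =
            (S x).unop * LinearMap.mul' k B ((unopHom S).rTensor B t) * y := by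
          intro t
          induction t with
          | zero =>
              simp only [LinearMap.map_zero, LinearEquiv.map_zero, tmul_zero, zero_tmul, mul_zero, zero_mul,
                smul_zero, zero_smul, LinearMap.zero_apply]
          | add x y hx hy => simp only [add_mul, mul_add, map_add, hx, hy]
          | tmul z w => simp [mul_assoc]
        rw [h2, ht]
        simp [Algebra.algebraMap_eq_smul_one]
    rw [Bialgebra.comul_mul, h1 _ _ hb, hc]
    simp [Algebra.smul_def]

lemma antipode_lTensor_of_adjoin (S : B →ₐ[k] Bᵐᵒᵖ) {s : Set B} (hs : Algebra.adjoin k s = ⊤)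
    (h : ∀ b ∈ s, LinearMap.mul' k B ((unopHom S).lTensor B (comul b)) =
      algebraMap k B (counit b)) (b : B) :
    LinearMap.mul' k B ((unopHom S).lTensor B (comul b)) = algebraMap k B (counit b) := by
  have hb : b ∈ Algebra.adjoin k s := hs ▸ Algebra.mem_top
  induction hb using Algebra.adjoin_induction with
  | mem b hb => exact h b hb
  | algebraMap r => simp [Algebra.algebraMap_eq_smul_one, Algebra.TensorProduct.one_def]
  | add b c _ _ hb hc => simp only [map_add, hb, hc]
  | mul b c _ _ hb hc =>
    have h1 : ∀ t u : B ⊗[k] B, LinearMap.mul' k B ((unopHom S).lTensor B u) =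
        algebraMap k B (counit c) → LinearMap.mul' k B ((unopHom S).lTensor B (t * u)) =
          counit (R := k) c • LinearMap.mul' k B ((unopHom S).lTensor B t) := by
      intro t u hu
      induction t with
      | zero =>
          simp only [LinearMap.map_zero, LinearEquiv.map_zero, tmul_zero, zero_tmul, mul_zero, zero_mul,
            smul_zero, zero_smul, LinearMap.zero_apply]
      | add x y hx hy => simp only [add_mul, map_add, hx, hy, smul_add]
      | tmul x y =>
        have h2 : ∀ u : B ⊗[k] B, LinearMap.mul' k B ((unopHom S).lTensor B ((x ⊗ₜ y) * u)) =
            x * LinearMap.mul' k B ((unopHom S).lTensor B u) * (S y).unop := by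
          intro t
          induction t with
          | zero =>
              simp only [LinearMap.map_zero, LinearEquiv.map_zero, tmul_zero, zero_tmul, mul_zero, zero_mul,
                smul_zero, zero_smul, LinearMap.zero_apply]
          | add x y hx hy => simp only [add_mul, mul_add, map_add, hx, hy]
          | tmul z w => simp [mul_assoc]
        rw [h2, hu]
        simp [Algebra.algebraMap_eq_smul_one]
    rw [Bialgebra.comul_mul, h1 _ _ hc, hb]
    rw [Bialgebra.counit_mul, mul_comm, map_mul, Algebra.smul_def]

/-- A bialgebra is a Hopf algebra as soon as an algebra map to the opposite algebra satisfies the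
antipode identities on algebra generators. -/
noncomputable abbrev HopfAlgebra.ofGenerators (S : B →ₐ[k] Bᵐᵒᵖ) (s : Set B)
    (hs : Algebra.adjoin k s = ⊤)
    (h₁ : ∀ b ∈ s, LinearMap.mul' k B ((unopHom S).rTensor B (comul b)) =
      algebraMap k B (counit b))
    (h₂ : ∀ b ∈ s, LinearMap.mul' k B ((unopHom S).lTensor B (comul b)) =
      algebraMap k B (counit b)) : HopfAlgebra k B where
  antipode := unopHom S
  mul_antipode_rTensor_comul := LinearMap.ext (antipode_rTensor_of_adjoin S hs h₁)
  mul_antipode_lTensor_comul := LinearMap.ext (antipode_lTensor_of_adjoin S hs h₂)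

end HopfOfGenerators

section CentralQuotient

variable (k A : Type*) [Field k] [Ring A] [HopfAlgebra k A]

/-- The set `G_C(A)` of central group-like elements. -/
def centralGroupLikes : Set A := {g | IsGroupLikeElem k g ∧ g ∈ Set.center A}

/-- The augmentation ideal `(k G_C(A))⁺ = k G_C(A) ∩ ker ε` of the span of `G_C(A)`. -/
noncomputable def centralAugmentation : Submodule k A :=
  Submodule.span k (centralGroupLikes k A) ⊓ LinearMap.ker (counit (R := k) (A := A))

/-- The ideal `A (k G_C(A))⁺`. -/
noncomputable def centralIdeal : Ideal A := Ideal.span (centralAugmentation k A : Set A)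

variable {k A}

lemma centralAugmentation_commute {x : A} (hx : x ∈ centralAugmentation k A) (b : A) :
    x * b = b * x := by
  have : Submodule.span k (centralGroupLikes k A) ≤ Subalgebra.toSubmodule (Subalgebra.center k A) :=
    Submodule.span_le.mpr fun g hg => hg.2
  exact (((Subalgebra.mem_center_iff (R := k)).mp (this hx.1)) b).symm

instance : (centralIdeal k A).IsTwoSided where
  mul_mem_of_left b h := by
    induction h using Submodule.span_induction with
    | mem x hx =>
      rw [centralAugmentation_commute hx]
      exact Ideal.mul_mem_left _ _ (Ideal.subset_span hx)
    | zero => simp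
    | add x y _ _ hx hy => rw [add_mul]; exact add_mem hx hy
    | smul r x _ hx => rw [smul_eq_mul, mul_assoc]; exact Ideal.mul_mem_left _ _ hx

lemma sub_one_mem_centralIdeal {g : A} (hg : g ∈ centralGroupLikes k A) :
    g - 1 ∈ centralIdeal k A := by
  refine Ideal.subset_span ⟨sub_mem (Submodule.subset_span hg)
    (Submodule.subset_span ⟨.one, Set.one_mem_center⟩), ?_⟩
  simp [hg.1.counit_eq_one]

lemma mk_eq_one {g : A} (hg : g ∈ centralGroupLikes k A) :
    Ideal.Quotient.mk (centralIdeal k A) g = 1 := by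
  rw [← map_one (Ideal.Quotient.mk (centralIdeal k A)), Ideal.Quotient.eq]
  exact sub_one_mem_centralIdeal hg

instance : (centralIdeal k A).IsHopfIdeal k where
  counit_eq_zero x hx := by
    change x ∈ centralIdeal k A at hx
    induction hx using Submodule.span_induction with
    | mem x hx => exact hx.2
    | zero =>
        simp only [LinearMap.map_zero, LinearEquiv.map_zero, tmul_zero, zero_tmul, mul_zero, zero_mul,
          smul_zero, zero_smul, LinearMap.zero_apply]
    | add x y _ _ hx hy => rw [map_add, hx, hy, add_zero]
    | smul r x _ hx => simp [hx]
  map_mkQ_comul_eq_zero x hx := by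
    let f : A →ₐ[k] (A ⧸ centralIdeal k A) ⊗[k] (A ⧸ centralIdeal k A) :=
      (Algebra.TensorProduct.map (Ideal.Quotient.mkₐ k (centralIdeal k A))
        (Ideal.Quotient.mkₐ k (centralIdeal k A))).comp (Bialgebra.comulAlgHom k A)
    change f x = 0
    change x ∈ centralIdeal k A at hx
    induction hx using Submodule.span_induction with
    | mem x hx =>
      have h1 : Set.EqOn f.toLinearMap (LinearMap.toSpanSingleton k _ 1 ∘ₗ counit)
          (Submodule.span k (centralGroupLikes k A)) := by
        refine LinearMap.eqOn_span fun g hg => ?_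
        have h2 := mk_eq_one hg
        simp [f, hg.1.counit_eq_one, hg.1.comul_eq_tmul_self, h2, Algebra.TensorProduct.one_def]
      have h3 := h1 hx.1
      have h4 : counit (R := k) x = 0 := hx.2
      simpa [h4] using h3
    | zero => simp
    | add x y _ _ hx hy => rw [map_add, hx, hy, add_zero]
    | smul r x _ hx => rw [smul_eq_mul, map_mul, hx, mul_zero]
  antipode_mem x hx := by
    induction hx using Submodule.span_induction with
    | mem x hx =>
      have h1 : Set.EqOn ((Ideal.Quotient.mkₐ k (centralIdeal k A)).toLinearMap ∘ₗ antipode k)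
          (LinearMap.toSpanSingleton k _ 1 ∘ₗ counit)
          (Submodule.span k (centralGroupLikes k A)) := by
        refine LinearMap.eqOn_span fun g hg => ?_
        have h2 := mk_eq_one hg
        have h3 : Ideal.Quotient.mk (centralIdeal k A) (antipode k g) = 1 := by
          rw [← mul_one (Ideal.Quotient.mk (centralIdeal k A) (antipode k g)), ← h2, ← map_mul,
            hg.1.antipode_mul_cancel, h2, map_one]
        simp [hg.1.counit_eq_one, h3]
      have h3 := h1 hx.1
      have h4 : counit (R := k) x = 0 := hx.2
      rw [← Ideal.Quotient.eq_zero_iff_mem]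
      simpa [h4] using h3
    | zero => simp
    | add x y _ _ hx hy => rw [map_add]; exact add_mem hx hy
    | smul r x _ hx =>
      rw [smul_eq_mul, antipode_mul_antidistrib]
      exact Ideal.IsTwoSided.mul_mem_of_left _ hx

variable (k A)

/-- The Hopf algebra `A / A (k G_C(A))⁺`. -/
abbrev CentralQuotient : Type _ := A ⧸ centralIdeal k A

end CentralQuotient

section Presentation

variable {k X B : Type*} [Field k] [Ring B] [Algebra k B]

/-- The class of a generator in the algebra presented by generators `X` and relations `r`. -/
noncomputable def presGen (r : FreeAlgebra k X → FreeAlgebra k X → Prop) (i : X) : RingQuot r :=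
  RingQuot.mkAlgHom k r (FreeAlgebra.ι k i)

/-- The algebra map out of a presented algebra given by images of the generators. -/
noncomputable def presLift (r : FreeAlgebra k X → FreeAlgebra k X → Prop) (f : X → B)
    (h : ∀ ⦃u v⦄, r u v → FreeAlgebra.lift k f u = FreeAlgebra.lift k f v) : RingQuot r →ₐ[k] B :=
  RingQuot.liftAlgHom k ⟨FreeAlgebra.lift k f, h⟩

@[simp] lemma presLift_presGen (r : FreeAlgebra k X → FreeAlgebra k X → Prop) (f : X → B) (h)
    (i : X) : presLift r f h (presGen r i) = f i := by
  simp [presLift, presGen]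

lemma pres_hom_ext {r : FreeAlgebra k X → FreeAlgebra k X → Prop} {f g : RingQuot r →ₐ[k] B}
    (h : ∀ i, f (presGen r i) = g (presGen r i)) : f = g := by
  apply RingQuot.ringQuot_ext'
  ext i
  exact h i

lemma adjoin_presGen (r : FreeAlgebra k X → FreeAlgebra k X → Prop) :
    Algebra.adjoin k (Set.range (presGen r)) = ⊤ := by
  have h1 : Set.range (presGen r) = RingQuot.mkAlgHom k r '' Set.range (FreeAlgebra.ι k) := by
    rw [← Set.range_comp]; rfl
  rw [h1, Algebra.adjoin_image, FreeAlgebra.adjoin_range_ι, Algebra.map_top,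
    AlgHom.range_eq_top]
  exact RingQuot.mkAlgHom_surjective k r

end Presentation

section RankOne

variable {k : Type*} [Field k] {G : Type*} [CommGroup G]

/-- The generators of `H_𝒟`: the elements of `G` and `x`. -/
inductive HDGen (G : Type*)
  | grp (g : G) : HDGen G
  | x : HDGen G

/-- The defining relations of `H_𝒟`, for the data `𝒟 = (G, χ, a)`: the multiplication of `G`,
`x^ℓ = 0` for `ℓ = |χ(a)|`, and `x g = χ(g) g x`. -/
inductive HDRel (χ : G →* kˣ) (a : G) :
    FreeAlgebra k (HDGen G) → FreeAlgebra k (HDGen G) → Prop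
  | one : HDRel χ a (FreeAlgebra.ι k (.grp 1)) 1
  | mul (g h : G) : HDRel χ a (FreeAlgebra.ι k (.grp g) * FreeAlgebra.ι k (.grp h))
      (FreeAlgebra.ι k (.grp (g * h)))
  | pow : HDRel χ a (FreeAlgebra.ι k .x ^ orderOf (χ a)) 0
  | comm (g : G) : HDRel χ a (FreeAlgebra.ι k .x * FreeAlgebra.ι k (.grp g))
      ((χ g : k) • (FreeAlgebra.ι k (.grp g) * FreeAlgebra.ι k .x))

/-- The pointed Hopf algebra `H_𝒟` of rank one attached to the data `𝒟 = (G, χ, a)`. -/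
def HD (χ : G →* kˣ) (a : G) : Type _ := RingQuot (HDRel χ a)

namespace HD

variable (χ : G →* kˣ) (a : G)

noncomputable instance : Ring (HD χ a) := inferInstanceAs (Ring (RingQuot (HDRel χ a)))

noncomputable instance : Algebra k (HD χ a) := inferInstanceAs (Algebra k (RingQuot (HDRel χ a)))

/-- The element of `H_𝒟` given by an element of `G`. -/
noncomputable def grp (g : G) : HD χ a := presGen (HDRel χ a) (.grp g)

/-- The generator `x` of `H_𝒟`. -/
noncomputable def x : HD χ a := presGen (HDRel χ a) .x

@[simp] lemma grp_one : grp χ a 1 = 1 :=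
  (RingQuot.mkAlgHom_rel k (HDRel.one (χ := χ) (a := a))).trans (map_one _)

lemma grp_mul (g h : G) : grp χ a g * grp χ a h = grp χ a (g * h) :=
  (map_mul _ _ _).symm.trans (RingQuot.mkAlgHom_rel k (HDRel.mul (χ := χ) (a := a) g h))

lemma x_pow : x χ a ^ orderOf (χ a) = 0 :=
  ((map_pow _ _ _).symm.trans (RingQuot.mkAlgHom_rel k (HDRel.pow (χ := χ) (a := a)))).trans
    (map_zero _)

lemma x_mul_grp (g : G) : x χ a * grp χ a g = (χ g : k) • (grp χ a g * x χ a) :=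
  ((map_mul _ _ _).symm.trans (RingQuot.mkAlgHom_rel k (HDRel.comm (χ := χ) (a := a) g))).trans
    ((map_smul _ _ _).trans (congrArg _ (map_mul _ _ _)))

@[simp] lemma grp_mul_inv (g : G) : grp χ a g * grp χ a g⁻¹ = 1 := by simp [grp_mul]

@[simp] lemma grp_inv_mul (g : G) : grp χ a g⁻¹ * grp χ a g = 1 := by simp [grp_mul]

variable {χ a} {B : Type*} [Ring B] [Algebra k B]

/-- The universal property of `H_𝒟`. -/
noncomputable def lift (f : G →* B) (y : B) (h : y ^ orderOf (χ a) = 0)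
    (h' : ∀ g, y * f g = (χ g : k) • (f g * y)) : HD χ a →ₐ[k] B :=
  presLift (HDRel χ a) (fun i => match i with | .grp g => f g | .x => y) (by
    rintro _ _ (_ | ⟨b, c⟩ | _ | b) <;> simp [h, h'])

@[simp] lemma lift_grp (f : G →* B) (y : B) (h : y ^ orderOf (χ a) = 0) (h') (g : G) :
    lift f y h h' (grp χ a g) = f g := presLift_presGen _ _ _ _

@[simp] lemma lift_x (f : G →* B) (y : B) (h : y ^ orderOf (χ a) = 0) (h') :
    lift f y h h' (x χ a) = y := presLift_presGen _ _ _ _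

lemma hom_ext {f g : HD χ a →ₐ[k] B} (h : ∀ b, f (grp χ a b) = g (grp χ a b))
    (h' : f (x χ a) = g (x χ a)) : f = g :=
  pres_hom_ext fun i => match i with | .grp b => h b | .x => h'

lemma adjoin_eq_top : Algebra.adjoin k (insert (x χ a) (Set.range (grp χ a))) = ⊤ := by
  refine top_unique ((adjoin_presGen (HDRel χ a)).ge.trans (Algebra.adjoin_mono ?_))
  rintro _ ⟨_ | _, rfl⟩
  · exact Set.mem_insert_of_mem _ ⟨_, rfl⟩
  · exact Set.mem_insert _ _

variable (χ a)

/-- The elements of `G` as a monoid map. -/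
noncomputable def grpHom : G →* HD χ a where
  toFun := grp χ a
  map_one' := grp_one χ a
  map_mul' g h := (grp_mul χ a g h).symm

@[simp] lemma grpHom_apply (g : G) : grpHom χ a g = grp χ a g := rfl

lemma isPrimitiveRoot : IsPrimitiveRoot (χ a : k) (orderOf (χ a)) :=
  IsPrimitiveRoot.coe_units_iff.mpr (IsPrimitiveRoot.orderOf (χ a))

variable [Finite G]

lemma order_pos : 0 < orderOf (χ a) :=
  orderOf_pos_iff.mpr (χ.isOfFinOrder (isOfFinOrder_of_finite a))

/-- The coproduct: `Δ(g) = g ⊗ g` and `Δ(x) = x ⊗ a + 1 ⊗ x`. -/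
noncomputable def comulHom : HD χ a →ₐ[k] HD χ a ⊗[k] HD χ a :=
  lift
    { toFun := fun g => grp χ a g ⊗ₜ grp χ a g
      map_one' := by simp [Algebra.TensorProduct.one_def]
      map_mul' := fun g h => by simp [grp_mul] }
    (x χ a ⊗ₜ grp χ a a + 1 ⊗ₜ x χ a)
    (by
      rw [add_pow_of_qCommute (isPrimitiveRoot χ a) (order_pos χ a)]
      · simp [x_pow]
      · simp [x_mul_grp])
    (fun g => by
      simp [add_mul, mul_add, x_mul_grp, grp_mul, mul_comm, smul_tmul'])

/-- The counit: `ε(g) = 1` and `ε(x) = 0`. -/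
noncomputable def counitHom : HD χ a →ₐ[k] k :=
  lift 1 0 (zero_pow (order_pos χ a).ne') (by simp)

@[simp] lemma comulHom_grp (g : G) : comulHom χ a (grp χ a g) = grp χ a g ⊗ₜ grp χ a g :=
  lift_grp _ _ _ _ _

@[simp] lemma comulHom_x : comulHom χ a (x χ a) = x χ a ⊗ₜ grp χ a a + 1 ⊗ₜ x χ a :=
  lift_x _ _ _ _

@[simp] lemma counitHom_grp (g : G) : counitHom χ a (grp χ a g) = 1 := lift_grp _ _ _ _ _

@[simp] lemma counitHom_x : counitHom χ a (x χ a) = 0 := lift_x _ _ _ _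

noncomputable instance : Bialgebra k (HD χ a) :=
  Bialgebra.ofAlgHom (comulHom χ a) (counitHom χ a)
    (hom_ext (by simp) (by
      simp [tmul_add, add_tmul, Algebra.TensorProduct.one_def, add_assoc]))
    (hom_ext (by simp) (by simp))
    (hom_ext (by simp) (by simp))

@[simp] lemma comul_grp (g : G) : comul (R := k) (grp χ a g) = grp χ a g ⊗ₜ grp χ a g :=
  comulHom_grp χ a g

@[simp] lemma comul_x : comul (R := k) (x χ a) = x χ a ⊗ₜ grp χ a a + 1 ⊗ₜ x χ a :=
  comulHom_x χ a

@[simp] lemma counit_grp (g : G) : counit (R := k) (grp χ a g) = 1 := counitHom_grp χ a g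

@[simp] lemma counit_x : counit (R := k) (x χ a) = 0 := counitHom_x χ a

/-- The antipode: `S(g) = g⁻¹` and `S(x) = - x a⁻¹`. -/
noncomputable def antipodeHom : HD χ a →ₐ[k] (HD χ a)ᵐᵒᵖ :=
  lift
    { toFun := fun g => .op (grp χ a g⁻¹)
      map_one' := by simp
      map_mul' := fun g h => by rw [← MulOpposite.op_mul, grp_mul, mul_inv_rev] }
    (.op (-(x χ a * grp χ a a⁻¹)))
    (by
      rw [← MulOpposite.op_pow, neg_pow]
      obtain ⟨c, hc⟩ := mul_pow_of_qCommute (q := ((χ a : kˣ) : k)) (x := x χ a)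
        (y := grp χ a a⁻¹) (by simp [x_mul_grp, smul_smul]) (orderOf (χ a))
      simp [hc, x_pow])
    (fun g => by
      change MulOpposite.op (-(x χ a * grp χ a a⁻¹)) * MulOpposite.op (grp χ a g⁻¹) =
        (χ g : k) • (MulOpposite.op (grp χ a g⁻¹) * MulOpposite.op (-(x χ a * grp χ a a⁻¹)))
      rw [← MulOpposite.op_mul, ← MulOpposite.op_mul, ← MulOpposite.op_smul, mul_neg, neg_mul,
        mul_assoc, grp_mul, x_mul_grp, x_mul_grp, mul_smul_comm, ← mul_assoc, grp_mul]
      simp only [map_mul, map_inv, Units.val_mul, Units.val_inv_eq_inv_val, MulOpposite.op_neg,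
        MulOpposite.op_smul, smul_neg, smul_smul, mul_comm a⁻¹ g⁻¹]
      rw [mul_inv_cancel_left₀ (Units.ne_zero _)])

@[simp] lemma antipodeHom_grp (g : G) : antipodeHom χ a (grp χ a g) = .op (grp χ a g⁻¹) :=
  lift_grp _ _ _ _ _

@[simp] lemma antipodeHom_x : antipodeHom χ a (x χ a) = .op (-(x χ a * grp χ a a⁻¹)) :=
  lift_x _ _ _ _

noncomputable instance : HopfAlgebra k (HD χ a) :=
  HopfAlgebra.ofGenerators (antipodeHom χ a) _ adjoin_eq_top
    (by rintro _ (rfl | ⟨g, rfl⟩) <;> simp [mul_assoc])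
    (by rintro _ (rfl | ⟨g, rfl⟩) <;> simp)

@[simp] lemma antipode_grp (g : G) : antipode k (grp χ a g) = grp χ a g⁻¹ :=
  congrArg MulOpposite.unop (antipodeHom_grp χ a g)

@[simp] lemma antipode_x : antipode k (x χ a) = -(x χ a * grp χ a a⁻¹) :=
  congrArg MulOpposite.unop (antipodeHom_x χ a)

lemma antipode_antipode (b : HD χ a) :
    antipode k (antipode k b) = grp χ a a * b * grp χ a a⁻¹ := by
  have hb : b ∈ Algebra.adjoin k (insert (x χ a) (Set.range (grp χ a))) :=
    adjoin_eq_top (χ := χ) (a := a) ▸ Algebra.mem_top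
  induction hb using Algebra.adjoin_induction with
  | mem b hb =>
    rcases hb with rfl | ⟨g, rfl⟩
    · simp [antipode_mul_antidistrib, mul_assoc]
    · simp [grp_mul]
  | algebraMap r => simp [Algebra.algebraMap_eq_smul_one]
  | add b c _ _ hb hc => simp only [map_add, hb, hc, mul_add, add_mul]
  | mul b c _ _ hb hc =>
    rw [antipode_mul_antidistrib, antipode_mul_antidistrib, hb, hc]
    have := grp_inv_mul χ a a
    calc grp χ a a * b * grp χ a a⁻¹ * (grp χ a a * c * grp χ a a⁻¹)
        = grp χ a a * b * (grp χ a a⁻¹ * grp χ a a) * c * grp χ a a⁻¹ := by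
          simp only [mul_assoc]
      _ = _ := by rw [this]; simp only [mul_assoc, mul_one]

instance : HasBijectiveAntipode k (HD χ a) := by
  have h : Function.Bijective ((antipode k : HD χ a →ₗ[k] HD χ a) ∘ antipode k) := by
    have h1 : ∀ b : HD χ a, grp χ a a⁻¹ * (grp χ a a * b * grp χ a a⁻¹) * grp χ a a = b := by
      intro b
      calc _ = (grp χ a a⁻¹ * grp χ a a) * b * (grp χ a a⁻¹ * grp χ a a) := by
            simp only [mul_assoc]
        _ = b := by simp
    have h2 : ∀ b : HD χ a, grp χ a a * (grp χ a a⁻¹ * b * grp χ a a) * grp χ a a⁻¹ = b := by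
      intro b
      calc _ = (grp χ a a * grp χ a a⁻¹) * b * (grp χ a a * grp χ a a⁻¹) := by
            simp only [mul_assoc]
        _ = b := by simp
    refine Function.bijective_iff_has_inverse.mpr
      ⟨fun b => grp χ a a⁻¹ * b * grp χ a a, fun b => ?_, fun b => ?_⟩
    · simp only [Function.comp_apply, antipode_antipode, h1]
    · simp only [Function.comp_apply, antipode_antipode, h2]
  exact ⟨⟨.of_comp h.1, .of_comp h.2⟩⟩

instance : Module.Finite k (HD χ a) := by
  let s : Set (HD χ a) := Set.range fun p : G × Fin (orderOf (χ a)) => grp χ a p.1 * x χ a ^ p.2.1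
  have h1 : ∀ (g : G) (i : ℕ), grp χ a g * x χ a ^ i ∈ Submodule.span k s := by
    intro g i
    by_cases hi : i < orderOf (χ a)
    · exact Submodule.subset_span ⟨(g, ⟨i, hi⟩), rfl⟩
    · rw [pow_eq_zero_of_le (not_lt.mp hi) (x_pow χ a), mul_zero]
      exact zero_mem _
  have h2 : ∀ b c : HD χ a, c ∈ Submodule.span k s → b * c ∈ Submodule.span k s := by
    intro b
    have hb : b ∈ Algebra.adjoin k (insert (x χ a) (Set.range (grp χ a))) :=
      adjoin_eq_top (χ := χ) (a := a) ▸ Algebra.mem_top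
    induction hb using Algebra.adjoin_induction with
    | mem b hb =>
      intro c hc
      have h3 : Submodule.span k s ≤ (Submodule.span k s).comap (LinearMap.mulLeft k b) := by
        refine Submodule.span_le.mpr ?_
        rintro _ ⟨⟨g, i⟩, rfl⟩
        rcases hb with rfl | ⟨h, rfl⟩
        · simp only [SetLike.mem_coe, Submodule.mem_comap, LinearMap.mulLeft_apply, ← mul_assoc,
            x_mul_grp, smul_mul_assoc]
          rw [mul_assoc, ← pow_succ']
          exact Submodule.smul_mem _ _ (h1 _ _)
        · simp only [SetLike.mem_coe, Submodule.mem_comap, LinearMap.mulLeft_apply, ← mul_assoc,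
            grp_mul]
          exact h1 _ _
      exact h3 hc
    | algebraMap r =>
      intro c hc
      rw [← Algebra.smul_def]
      exact Submodule.smul_mem _ _ hc
    | add b c _ _ hb hc => intro d hd; rw [add_mul]; exact add_mem (hb d hd) (hc d hd)
    | mul b c _ _ hb hc => intro d hd; rw [mul_assoc]; exact hb _ (hc d hd)
  refine ⟨(Submodule.fg_def).mpr ⟨s, Set.finite_range _, top_unique fun b _ => ?_⟩⟩
  rw [← mul_one b]
  refine h2 b 1 ?_
  have := h1 1 0
  simpa using this

end HD

end RankOne

section SmallQuantumGroup

variable {k : Type*} [Field k]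

/-- The generators `e`, `f`, `ω`, `ω⁻¹` of `𝔲_θ(𝔰𝔩₂)`. -/
inductive USL2Gen
  | e : USL2Gen
  | f : USL2Gen
  | w : USL2Gen
  | winv : USL2Gen

/-- The defining relations of `𝔲_θ(𝔰𝔩₂)`, for `θ` of order `ℓ`. -/
inductive USL2Rel (θ : k) (ℓ : ℕ) : FreeAlgebra k USL2Gen → FreeAlgebra k USL2Gen → Prop
  | w_mul_winv : USL2Rel θ ℓ (FreeAlgebra.ι k .w * FreeAlgebra.ι k .winv) 1
  | winv_mul_w : USL2Rel θ ℓ (FreeAlgebra.ι k .winv * FreeAlgebra.ι k .w) 1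
  | e_pow : USL2Rel θ ℓ (FreeAlgebra.ι k .e ^ ℓ) 0
  | f_pow : USL2Rel θ ℓ (FreeAlgebra.ι k .f ^ ℓ) 0
  | w_pow : USL2Rel θ ℓ (FreeAlgebra.ι k .w ^ ℓ) 1
  | w_e : USL2Rel θ ℓ (FreeAlgebra.ι k .w * FreeAlgebra.ι k .e)
      (θ ^ 2 • (FreeAlgebra.ι k .e * FreeAlgebra.ι k .w))
  | w_f : USL2Rel θ ℓ (FreeAlgebra.ι k .w * FreeAlgebra.ι k .f)
      ((θ ^ 2)⁻¹ • (FreeAlgebra.ι k .f * FreeAlgebra.ι k .w))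
  | e_f : USL2Rel θ ℓ
      (FreeAlgebra.ι k .e * FreeAlgebra.ι k .f - FreeAlgebra.ι k .f * FreeAlgebra.ι k .e)
      ((θ - θ⁻¹)⁻¹ • (FreeAlgebra.ι k .w - FreeAlgebra.ι k .winv))

/-- The one-parameter small quantum group `𝔲_θ(𝔰𝔩₂)`, for `θ` a primitive `ℓ`-th root of unity with
`ℓ` odd. -/
def USL2 (θ : k) {ℓ : ℕ} (_ : IsPrimitiveRoot θ ℓ) (_ : Odd ℓ) : Type _ := RingQuot (USL2Rel θ ℓ)

namespace USL2

variable {θ : k} {ℓ : ℕ} (hθ : IsPrimitiveRoot θ ℓ) (hℓ : Odd ℓ)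

noncomputable instance : Ring (USL2 θ hθ hℓ) := inferInstanceAs (Ring (RingQuot (USL2Rel θ ℓ)))

noncomputable instance : Algebra k (USL2 θ hθ hℓ) :=
  inferInstanceAs (Algebra k (RingQuot (USL2Rel θ ℓ)))

/-- The generator `e`. -/
noncomputable def e : USL2 θ hθ hℓ := presGen (USL2Rel θ ℓ) .e

/-- The generator `f`. -/
noncomputable def f : USL2 θ hθ hℓ := presGen (USL2Rel θ ℓ) .f

/-- The generator `ω`. -/
noncomputable def w : USL2 θ hθ hℓ := presGen (USL2Rel θ ℓ) .w

/-- The generator `ω⁻¹`. -/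
noncomputable def winv : USL2 θ hθ hℓ := presGen (USL2Rel θ ℓ) .winv

@[simp] lemma w_mul_winv : w hθ hℓ * winv hθ hℓ = 1 :=
  ((map_mul _ _ _).symm.trans (RingQuot.mkAlgHom_rel k USL2Rel.w_mul_winv)).trans (map_one _)

@[simp] lemma winv_mul_w : winv hθ hℓ * w hθ hℓ = 1 :=
  ((map_mul _ _ _).symm.trans (RingQuot.mkAlgHom_rel k USL2Rel.winv_mul_w)).trans (map_one _)

@[simp] lemma e_pow : e hθ hℓ ^ ℓ = 0 :=
  ((map_pow _ _ _).symm.trans (RingQuot.mkAlgHom_rel k USL2Rel.e_pow)).trans (map_zero _)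

@[simp] lemma f_pow : f hθ hℓ ^ ℓ = 0 :=
  ((map_pow _ _ _).symm.trans (RingQuot.mkAlgHom_rel k USL2Rel.f_pow)).trans (map_zero _)

@[simp] lemma w_pow : w hθ hℓ ^ ℓ = 1 :=
  ((map_pow _ _ _).symm.trans (RingQuot.mkAlgHom_rel k USL2Rel.w_pow)).trans (map_one _)

lemma w_e : w hθ hℓ * e hθ hℓ = θ ^ 2 • (e hθ hℓ * w hθ hℓ) :=
  ((map_mul _ _ _).symm.trans (RingQuot.mkAlgHom_rel k USL2Rel.w_e)).trans
    ((map_smul _ _ _).trans (congrArg _ (map_mul _ _ _)))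

lemma w_f : w hθ hℓ * f hθ hℓ = (θ ^ 2)⁻¹ • (f hθ hℓ * w hθ hℓ) :=
  ((map_mul _ _ _).symm.trans (RingQuot.mkAlgHom_rel k USL2Rel.w_f)).trans
    ((map_smul _ _ _).trans (congrArg _ (map_mul _ _ _)))

lemma e_f : e hθ hℓ * f hθ hℓ - f hθ hℓ * e hθ hℓ =
    (θ - θ⁻¹)⁻¹ • (w hθ hℓ - winv hθ hℓ) := by
  have := RingQuot.mkAlgHom_rel k (USL2Rel.e_f (θ := θ) (ℓ := ℓ))
  simp only [map_sub, map_mul, map_smul] at this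
  exact this

lemma ne_zero {θ : k} {ℓ : ℕ} (hθ : IsPrimitiveRoot θ ℓ) (hℓ : Odd ℓ) : θ ^ 2 ≠ 0 := pow_ne_zero 2 (hθ.ne_zero hℓ.pos.ne')

lemma isPrimitiveRoot_sq {θ : k} {ℓ : ℕ} (hθ : IsPrimitiveRoot θ ℓ) (hℓ : Odd ℓ) :
    IsPrimitiveRoot (θ ^ 2) ℓ :=
  hθ.pow_of_coprime 2 (Nat.coprime_two_left.mpr hℓ)

lemma f_w : f hθ hℓ * w hθ hℓ = θ ^ 2 • (w hθ hℓ * f hθ hℓ) := by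
  rw [w_f, smul_smul, mul_inv_cancel₀ (ne_zero hθ hℓ), one_smul]

lemma e_winv : e hθ hℓ * winv hθ hℓ = θ ^ 2 • (winv hθ hℓ * e hθ hℓ) := by
  calc _ = winv hθ hℓ * (w hθ hℓ * e hθ hℓ) * winv hθ hℓ := by
        rw [← mul_assoc, winv_mul_w, one_mul]
    _ = _ := by rw [w_e, mul_smul_comm, smul_mul_assoc, mul_assoc, mul_assoc, w_mul_winv, mul_one]

lemma winv_f : winv hθ hℓ * f hθ hℓ = θ ^ 2 • (f hθ hℓ * winv hθ hℓ) := by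
  calc _ = winv hθ hℓ * (f hθ hℓ * w hθ hℓ) * winv hθ hℓ := by
        rw [mul_assoc, mul_assoc, w_mul_winv, mul_one]
    _ = _ := by rw [f_w, mul_smul_comm, smul_mul_assoc, ← mul_assoc, winv_mul_w, one_mul]

lemma winv_e : winv hθ hℓ * e hθ hℓ = (θ ^ 2)⁻¹ • (e hθ hℓ * winv hθ hℓ) := by
  rw [e_winv, smul_smul, inv_mul_cancel₀ (ne_zero hθ hℓ), one_smul]

lemma f_winv : f hθ hℓ * winv hθ hℓ = (θ ^ 2)⁻¹ • (winv hθ hℓ * f hθ hℓ) := by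
  rw [winv_f, smul_smul, inv_mul_cancel₀ (ne_zero hθ hℓ), one_smul]

lemma winv_pow : winv hθ hℓ ^ ℓ = 1 := by
  have h : Commute (w hθ hℓ) (winv hθ hℓ) := (w_mul_winv hθ hℓ).trans (winv_mul_w hθ hℓ).symm
  rw [← one_mul (winv hθ hℓ ^ ℓ), ← w_pow hθ hℓ, ← h.mul_pow, w_mul_winv, one_pow, w_pow]

variable {hθ hℓ} {B : Type*} [Ring B] [Algebra k B]

/-- The universal property of `𝔲_θ(𝔰𝔩₂)`. -/
noncomputable def lift (E F W W' : B) (h₁ : W * W' = 1) (h₂ : W' * W = 1) (h₃ : E ^ ℓ = 0)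
    (h₄ : F ^ ℓ = 0) (h₅ : W ^ ℓ = 1) (h₆ : W * E = θ ^ 2 • (E * W))
    (h₇ : W * F = (θ ^ 2)⁻¹ • (F * W)) (h₈ : E * F - F * E = (θ - θ⁻¹)⁻¹ • (W - W')) :
    USL2 θ hθ hℓ →ₐ[k] B :=
  presLift (USL2Rel θ ℓ)
    (fun i => match i with | .e => E | .f => F | .w => W | .winv => W') (by
    rintro _ _ (_ | _ | _ | _ | _ | _ | _ | _) <;>
      simp only [map_mul, map_one, map_zero, map_pow, map_smul, map_sub, FreeAlgebra.lift_ι_apply,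
        h₁, h₂, h₃, h₄, h₅, h₆, h₇, h₈])

variable {E F W W' : B} {h₁ : W * W' = 1} {h₂ : W' * W = 1} {h₃ : E ^ ℓ = 0} {h₄ : F ^ ℓ = 0}
  {h₅ : W ^ ℓ = 1} {h₆ : W * E = θ ^ 2 • (E * W)} {h₇ : W * F = (θ ^ 2)⁻¹ • (F * W)}
  {h₈ : E * F - F * E = (θ - θ⁻¹)⁻¹ • (W - W')}

lemma lift_e : lift E F W W' h₁ h₂ h₃ h₄ h₅ h₆ h₇ h₈ (e hθ hℓ) = E := presLift_presGen _ _ _ _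

lemma lift_f : lift E F W W' h₁ h₂ h₃ h₄ h₅ h₆ h₇ h₈ (f hθ hℓ) = F := presLift_presGen _ _ _ _

lemma lift_w : lift E F W W' h₁ h₂ h₃ h₄ h₅ h₆ h₇ h₈ (w hθ hℓ) = W := presLift_presGen _ _ _ _

lemma lift_winv : lift E F W W' h₁ h₂ h₃ h₄ h₅ h₆ h₇ h₈ (winv hθ hℓ) = W' :=
  presLift_presGen _ _ _ _

lemma hom_ext {φ ψ : USL2 θ hθ hℓ →ₐ[k] B} (he : φ (e hθ hℓ) = ψ (e hθ hℓ))
    (hf : φ (f hθ hℓ) = ψ (f hθ hℓ)) (hw : φ (w hθ hℓ) = ψ (w hθ hℓ))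
    (hv : φ (winv hθ hℓ) = ψ (winv hθ hℓ)) : φ = ψ :=
  pres_hom_ext fun i => match i with | .e => he | .f => hf | .w => hw | .winv => hv

lemma adjoin_eq_top : Algebra.adjoin k {e hθ hℓ, f hθ hℓ, w hθ hℓ, winv hθ hℓ} = ⊤ := by
  refine top_unique ((adjoin_presGen (USL2Rel θ ℓ)).ge.trans (Algebra.adjoin_mono ?_))
  rintro _ ⟨_ | _ | _ | _, rfl⟩
  · exact Or.inl rfl
  · exact Or.inr (Or.inl rfl)
  · exact Or.inr (Or.inr (Or.inl rfl))
  · exact Or.inr (Or.inr (Or.inr rfl))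

variable (hθ hℓ)

/-- The coproduct: `Δ(e) = e ⊗ 1 + ω ⊗ e`, `Δ(f) = 1 ⊗ f + f ⊗ ω⁻¹` and `Δ(ω) = ω ⊗ ω`. -/
noncomputable def comulHom : USL2 θ hθ hℓ →ₐ[k] USL2 θ hθ hℓ ⊗[k] USL2 θ hθ hℓ :=
  lift (e hθ hℓ ⊗ₜ 1 + w hθ hℓ ⊗ₜ e hθ hℓ) (1 ⊗ₜ f hθ hℓ + f hθ hℓ ⊗ₜ winv hθ hℓ)
    (w hθ hℓ ⊗ₜ w hθ hℓ) (winv hθ hℓ ⊗ₜ winv hθ hℓ)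
    (by simp [Algebra.TensorProduct.one_def])
    (by simp [Algebra.TensorProduct.one_def])
    (by
      rw [add_pow_of_qCommute (isPrimitiveRoot_sq hθ hℓ) hℓ.pos]
      · simp
      · simp [w_e, smul_tmul'])
    (by
      rw [add_pow_of_qCommute (isPrimitiveRoot_sq hθ hℓ) hℓ.pos]
      · simp
      · simp [winv_f])
    (by simp [Algebra.TensorProduct.one_def])
    (by simp [mul_add, add_mul, w_e, smul_tmul'])
    (by simp [mul_add, add_mul, w_f, smul_tmul'])
    (by
      have h := e_f hθ hℓ
      have h1 : e hθ hℓ * f hθ hℓ = f hθ hℓ * e hθ hℓ +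
        (θ - θ⁻¹)⁻¹ • (w hθ hℓ - winv hθ hℓ) := by rw [← h]; abel
      have h2 : (w hθ hℓ * f hθ hℓ) ⊗ₜ[k] (e hθ hℓ * winv hθ hℓ) =
          (f hθ hℓ * w hθ hℓ) ⊗ₜ[k] (winv hθ hℓ * e hθ hℓ) := by
        rw [w_f, e_winv, smul_tmul_smul, inv_mul_cancel₀ (ne_zero hθ hℓ), one_smul]
      simp only [mul_add, add_mul, Algebra.TensorProduct.tmul_mul_tmul, mul_one, one_mul, h2, h1,
        tmul_add, add_tmul, tmul_sub, sub_tmul, tmul_smul, smul_tmul', smul_sub]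
      abel)

/-- The counit: `ε(e) = ε(f) = 0` and `ε(ω) = 1`. -/
noncomputable def counitHom : USL2 θ hθ hℓ →ₐ[k] k :=
  lift 0 0 1 1 (by simp) (by simp) (zero_pow hℓ.pos.ne') (zero_pow hℓ.pos.ne') (by simp)
    (by simp) (by simp) (by simp)

@[simp] lemma comulHom_e : comulHom hθ hℓ (e hθ hℓ) = e hθ hℓ ⊗ₜ 1 + w hθ hℓ ⊗ₜ e hθ hℓ := lift_e

@[simp] lemma comulHom_f : comulHom hθ hℓ (f hθ hℓ) = 1 ⊗ₜ f hθ hℓ + f hθ hℓ ⊗ₜ winv hθ hℓ :=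
  lift_f

@[simp] lemma comulHom_w : comulHom hθ hℓ (w hθ hℓ) = w hθ hℓ ⊗ₜ w hθ hℓ := lift_w

@[simp] lemma comulHom_winv : comulHom hθ hℓ (winv hθ hℓ) = winv hθ hℓ ⊗ₜ winv hθ hℓ := lift_winv

@[simp] lemma counitHom_e : counitHom hθ hℓ (e hθ hℓ) = 0 := lift_e

@[simp] lemma counitHom_f : counitHom hθ hℓ (f hθ hℓ) = 0 := lift_f

@[simp] lemma counitHom_w : counitHom hθ hℓ (w hθ hℓ) = 1 := lift_w

@[simp] lemma counitHom_winv : counitHom hθ hℓ (winv hθ hℓ) = 1 := lift_winv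

noncomputable instance : Bialgebra k (USL2 θ hθ hℓ) :=
  Bialgebra.ofAlgHom (comulHom hθ hℓ) (counitHom hθ hℓ)
    (hom_ext
      (by simp [tmul_add, add_tmul, Algebra.TensorProduct.one_def, add_assoc])
      (by simp [tmul_add, add_tmul, Algebra.TensorProduct.one_def, add_assoc])
      (by simp) (by simp))
    (hom_ext (by simp) (by simp) (by simp) (by simp))
    (hom_ext (by simp) (by simp) (by simp) (by simp))

@[simp] lemma comul_e : comul (R := k) (e hθ hℓ) = e hθ hℓ ⊗ₜ 1 + w hθ hℓ ⊗ₜ e hθ hℓ :=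
  comulHom_e hθ hℓ

@[simp] lemma comul_f : comul (R := k) (f hθ hℓ) = 1 ⊗ₜ f hθ hℓ + f hθ hℓ ⊗ₜ winv hθ hℓ :=
  comulHom_f hθ hℓ

@[simp] lemma comul_w : comul (R := k) (w hθ hℓ) = w hθ hℓ ⊗ₜ w hθ hℓ := comulHom_w hθ hℓ

@[simp] lemma comul_winv : comul (R := k) (winv hθ hℓ) = winv hθ hℓ ⊗ₜ winv hθ hℓ :=
  comulHom_winv hθ hℓ

@[simp] lemma counit_e : counit (R := k) (e hθ hℓ) = 0 := counitHom_e hθ hℓ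

@[simp] lemma counit_f : counit (R := k) (f hθ hℓ) = 0 := counitHom_f hθ hℓ

@[simp] lemma counit_w : counit (R := k) (w hθ hℓ) = 1 := counitHom_w hθ hℓ

@[simp] lemma counit_winv : counit (R := k) (winv hθ hℓ) = 1 := counitHom_winv hθ hℓ

/-- The antipode: `S(e) = - ω⁻¹ e`, `S(f) = - f ω` and `S(ω) = ω⁻¹`. -/
noncomputable def antipodeHom : USL2 θ hθ hℓ →ₐ[k] (USL2 θ hθ hℓ)ᵐᵒᵖ :=
  lift (.op (-(winv hθ hℓ * e hθ hℓ))) (.op (-(f hθ hℓ * w hθ hℓ))) (.op (winv hθ hℓ))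
    (.op (w hθ hℓ))
    (by rw [← MulOpposite.op_mul, w_mul_winv, MulOpposite.op_one])
    (by rw [← MulOpposite.op_mul, winv_mul_w, MulOpposite.op_one])
    (by
      rw [← MulOpposite.op_pow, neg_pow]
      obtain ⟨c, hc⟩ := mul_pow_of_qCommute (e_winv hθ hℓ) ℓ
      simp [hc])
    (by
      rw [← MulOpposite.op_pow, neg_pow]
      obtain ⟨c, hc⟩ := mul_pow_of_qCommute (w_f hθ hℓ) ℓ
      simp [hc])
    (by rw [← MulOpposite.op_pow, winv_pow, MulOpposite.op_one])
    (by
      rw [← MulOpposite.op_mul, ← MulOpposite.op_mul, ← MulOpposite.op_smul, neg_mul, mul_neg,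
        mul_assoc, e_winv, mul_smul_comm, smul_neg])
    (by
      rw [← MulOpposite.op_mul, ← MulOpposite.op_mul, ← MulOpposite.op_smul, neg_mul, mul_neg,
        mul_assoc, w_mul_winv, mul_one, ← mul_assoc, winv_f, smul_mul_assoc, mul_assoc, winv_mul_w,
        mul_one, smul_neg, smul_smul, inv_mul_cancel₀ (ne_zero hθ hℓ), one_smul])
    (by
      rw [← MulOpposite.op_mul, ← MulOpposite.op_mul, ← MulOpposite.op_sub, ← MulOpposite.op_sub,
        ← MulOpposite.op_smul]
      congr 1
      have h1 : f hθ hℓ * w hθ hℓ * (winv hθ hℓ * e hθ hℓ) = f hθ hℓ * e hθ hℓ := by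
        rw [mul_assoc, ← mul_assoc (w hθ hℓ), w_mul_winv, one_mul]
      have h2 : winv hθ hℓ * e hθ hℓ * (f hθ hℓ * w hθ hℓ) = e hθ hℓ * f hθ hℓ := by
        rw [winv_e, smul_mul_assoc, mul_assoc, ← mul_assoc (winv hθ hℓ), winv_f, smul_mul_assoc,
          mul_assoc, winv_mul_w, mul_one, mul_smul_comm, smul_smul,
          inv_mul_cancel₀ (ne_zero hθ hℓ), one_smul]
      rw [neg_mul_neg, neg_mul_neg, h1, h2, ← neg_sub, e_f, ← smul_neg, neg_sub])

@[simp] lemma antipodeHom_e : antipodeHom hθ hℓ (e hθ hℓ) = .op (-(winv hθ hℓ * e hθ hℓ)) := lift_e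

@[simp] lemma antipodeHom_f : antipodeHom hθ hℓ (f hθ hℓ) = .op (-(f hθ hℓ * w hθ hℓ)) := lift_f

@[simp] lemma antipodeHom_w : antipodeHom hθ hℓ (w hθ hℓ) = .op (winv hθ hℓ) := lift_w

@[simp] lemma antipodeHom_winv : antipodeHom hθ hℓ (winv hθ hℓ) = .op (w hθ hℓ) := lift_winv

noncomputable instance : HopfAlgebra k (USL2 θ hθ hℓ) :=
  HopfAlgebra.ofGenerators (antipodeHom hθ hℓ) _ adjoin_eq_top
    (by rintro _ (rfl | rfl | rfl | rfl) <;> simp [mul_assoc])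
    (by rintro _ (rfl | rfl | rfl | rfl) <;> simp [← mul_assoc])

end USL2

end SmallQuantumGroup

/-! The double of `H_𝒟` is generated by four kinds of elements: the group elements `g`, the
generator `x`, the characters `ψ` of `G` (extended by zero on `x`), and one form `ξ` dual to `x`. Up
to scalars, `g` and `ψ` commute with everything; the only true commutator is `x ξ - ξ x = κ (a -
χ)`, where `κ = 1` unless `ℓ = 1`. This is already the shape of the relation for `e f - f e`, except
that two unrelated group-like elements, `a` and `χ`, occur in it.

The central quotient removes this discrepancy. Conjugation of `x` and of `ξ` by `ψ g` involves only
the ratio of `ψ(a)` and `χ(g)`, so `ψ g` is central when `ψ(a) = χ(g)`, and in the quotient `ψ`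
becomes `g⁻¹`. In particular `χ` becomes `a⁻¹`, and `ω ↦ a⁻¹`, `f ↦ x`, `e ↦ (θ - θ⁻¹)⁻¹ ξ` respects
all relations and coproducts because `χ(a)⁻¹ = θ²`. This is `HD.compare`, a map of bialgebras and
hence of Hopf algebras.

Surjectivity (`HD.compare_surjective`) uses the three equal orders: all values `χ(g)` and `ψ(a)` are
`ℓ`-th roots of unity, hence powers of the primitive root `χ(a)`, so every `g` and every `ψ` becomes
a power of `a` in the quotient. That the double is generated as described rests on
`HD.span_psi_mul_xi_pow`, which is Fourier inversion on `G`.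

Injectivity (`HD.compare_injective`) avoids any dimension count. The monomials `eⁱ ωᵐ fʲ` with
exponents below `ℓ` span the small quantum group, and it suffices to separate their images by linear
functionals on the double that kill the central ideal. Such functionals are given by `HD.pairing`.
They vanish on the ideal (`HD.pairing_eq_zero`) because a central group-like element has the form `ψ
d` with `d` group-like and `χ(d) = ψ(a)` when `ℓ ≠ 1`. They isolate `i` and `j`, and the remaining
dependence on `m` is a Vandermonde system in the distinct powers of `χ(a)⁻¹`. -/

namespace HD

variable {k : Type*} [Field k] {G : Type*} [CommGroup G] (χ : G →* kˣ) (a : G)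

/-! ### Monomials spanning `H_𝒟` -/

/-- Induction on the algebra generators of `H_𝒟`. -/
lemma induction_on {p : HD χ a → Prop} (hg : ∀ g, p (grp χ a g)) (hx : p (x χ a))
    (hr : ∀ r : k, p (algebraMap k _ r)) (hadd : ∀ b c, p b → p c → p (b + c))
    (hmul : ∀ b c, p b → p c → p (b * c)) (b : HD χ a) : p b := by
  have hb : b ∈ Algebra.adjoin k (insert (x χ a) (Set.range (grp χ a))) :=
    adjoin_eq_top (χ := χ) (a := a) ▸ Algebra.mem_top
  induction hb using Algebra.adjoin_induction with
  | mem b hb =>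
    rcases hb with rfl | ⟨g, rfl⟩
    · exact hx
    · exact hg g
  | algebraMap r => exact hr r
  | add b c _ _ hb hc => exact hadd b c hb hc
  | mul b c _ _ hb hc => exact hmul b c hb hc

/-- The span contains `1` and is stable under left multiplication by the generators, since `x` moves
past `g` at the cost of a scalar. Linear independence is not needed: the monomials serve only to
test equality of linear maps, so `n` may range over all of `ℕ`. -/
lemma span_grp_mul_x_pow :
    Submodule.span k (Set.range fun p : G × ℕ => grp χ a p.1 * x χ a ^ p.2) = ⊤ := by
  set S := Submodule.span k (Set.range fun p : G × ℕ => grp χ a p.1 * x χ a ^ p.2)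
  have h1 : ∀ (g : G) (i : ℕ), grp χ a g * x χ a ^ i ∈ S := fun g i =>
    Submodule.subset_span ⟨(g, i), rfl⟩
  have h2 : ∀ b c : HD χ a, c ∈ S → b * c ∈ S := by
    intro b
    induction b using induction_on with
    | hg h =>
      suffices S ≤ S.comap (LinearMap.mulLeft k (grp χ a h)) from fun c hc => this hc
      refine Submodule.span_le.mpr ?_
      rintro _ ⟨⟨g, i⟩, rfl⟩
      simpa only [SetLike.mem_coe, Submodule.mem_comap, LinearMap.mulLeft_apply, ← mul_assoc,
        grp_mul] using h1 _ _
    | hx =>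
      suffices S ≤ S.comap (LinearMap.mulLeft k (x χ a)) from fun c hc => this hc
      refine Submodule.span_le.mpr ?_
      rintro _ ⟨⟨g, i⟩, rfl⟩
      simp only [SetLike.mem_coe, Submodule.mem_comap, LinearMap.mulLeft_apply, ← mul_assoc,
        x_mul_grp, smul_mul_assoc]
      rw [mul_assoc, ← pow_succ']
      exact Submodule.smul_mem _ _ (h1 _ _)
    | hr r => exact fun c hc => by rw [← Algebra.smul_def]; exact Submodule.smul_mem _ _ hc
    | hadd b c hb hc => exact fun d hd => by rw [add_mul]; exact add_mem (hb d hd) (hc d hd)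
    | hmul b c hb hc => exact fun d hd => by rw [mul_assoc]; exact hb _ (hc d hd)
  refine top_unique fun b _ => ?_
  simpa using h2 b 1 (by simpa using h1 1 0)

lemma linearMap_ext {M : Type*} [AddCommMonoid M] [Module k M] {f g : HD χ a →ₗ[k] M}
    (h : ∀ b n, f (grp χ a b * x χ a ^ n) = g (grp χ a b * x χ a ^ n)) : f = g :=
  LinearMap.ext_on_range (span_grp_mul_x_pow χ a) fun p => h p.1 p.2

/-! ### Characters and the skew-primitive form `ξ` -/

variable [Finite G]

/-- The extension by zero of a character of `G` to an algebra map on `H_𝒟`. -/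
noncomputable def char (ψ : G →* kˣ) : HD χ a →ₐ[k] k :=
  lift ((Units.coeHom k).comp ψ) 0 (zero_pow (order_pos χ a).ne') (by simp)

@[simp] lemma char_grp (ψ : G →* kˣ) (g : G) : char χ a ψ (grp χ a g) = ψ g := lift_grp _ _ _ _ _

@[simp] lemma char_x (ψ : G →* kˣ) : char χ a ψ (x χ a) = 0 := lift_x _ _ _ _

@[simp] lemma char_one (b : HD χ a) : char χ a 1 b = counit (R := k) b :=
  congr($(hom_ext (f := char χ a 1) (g := Bialgebra.counitAlgHom k _) (by simp) (by simp)) b)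

/-- An algebra map to `k` is determined by a character of `G`. -/
lemma exists_char (f : HD χ a →ₐ[k] k) : ∃ ψ : G →* kˣ, f = char χ a ψ := by
  refine ⟨((f : HD χ a →* k).comp (grpHom χ a)).toHomUnits, hom_ext (fun b => by simp) ?_⟩
  -- The image of the nilpotent `x` in the field `k` is nilpotent, hence zero.
  have h := congrArg f (x_pow χ a)
  rw [map_pow, map_zero] at h
  rw [char_x]
  exact eq_zero_of_pow_eq_zero h

open Classical in
/-- The value at `x` of the form `ξ`: it is `0` if `x = 0`, that is, if `ℓ = 1`. -/
noncomputable def xiCoeff : k := if orderOf (χ a) = 1 then 0 else 1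

/-- For `ℓ = 1` the only admissible exponent is `0`, and `0 ^ 0 = 1`; this lets the case `ℓ = 1` run
along with the general one. -/
lemma xiCoeff_pow_ne_zero {i : ℕ} (hi : i < orderOf (χ a)) : xiCoeff χ a ^ i ≠ 0 := by
  by_cases h : orderOf (χ a) = 1
  · obtain rfl : i = 0 := by omega
    simp
  · simp [xiCoeff, h]

/-- The representation `g ↦ diag(1, χ(g))`, `x ↦ κ E₁₂` of `H_𝒟` on `k²`. -/
noncomputable def triHom : HD χ a →ₐ[k] Matrix (Fin 2) (Fin 2) k :=
  lift
    { toFun := fun g => !![1, 0; 0, (χ g : k)]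
      map_one' := by simp [Matrix.one_fin_two]
      map_mul' := fun g h => by simp }
    !![0, xiCoeff χ a; 0, 0]
    (by
      have h0 := order_pos χ a
      by_cases h : orderOf (χ a) = 1
      · simp [xiCoeff, h, ← Matrix.ext_iff]
      -- A strictly triangular `2 × 2` matrix already has square zero, so `ℓ ≥ 2` is enough.
      · obtain ⟨n, hn⟩ := Nat.exists_eq_add_of_le (show 2 ≤ orderOf (χ a) by omega)
        have h2 : (!![0, xiCoeff χ a; 0, 0] : Matrix (Fin 2) (Fin 2) k) ^ 2 = 0 := by
          ext i j
          fin_cases i <;> fin_cases j <;> simp [sq]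
        rw [hn, pow_add, h2, zero_mul])
    (fun g => by
      ext i j
      fin_cases i <;> fin_cases j <;> simp [mul_comm])

/-- The representation is upper triangular, so its diagonal entries are algebra maps, determined on
generators. The three claims are proved together because the diagonal entries are multiplicative
only once the lower left entry vanishes. -/
lemma triHom_apply (b : HD χ a) : triHom χ a b 1 0 = 0 ∧ triHom χ a b 0 0 = counit (R := k) b ∧
    triHom χ a b 1 1 = char χ a χ b := by
  induction b using induction_on with
  | hg g => simp [triHom]
  | hx => simp [triHom]
  | hr r => simp [Algebra.algebraMap_eq_smul_one]
  | hadd b c hb hc => simp [hb, hc]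
  | hmul b c hb hc => simp [Matrix.mul_apply, hb, hc]

/-- The linear form `ξ` with `ξ(g x) = κ` and `ξ(g xⁱ) = 0` for `i ≠ 1`. -/
noncomputable def xiForm : HD χ a →ₗ[k] k :=
  Matrix.entryLinearMap k k 0 1 ∘ₗ (triHom χ a).toLinearMap

@[simp] lemma xiForm_grp (g : G) : xiForm χ a (grp χ a g) = 0 := by simp [xiForm, triHom]

@[simp] lemma xiForm_x : xiForm χ a (x χ a) = xiCoeff χ a := by simp [xiForm, triHom]

/-- This is the upper right entry of a product of two upper triangular matrices. It expresses that
`ξ` is skew-primitive in the dual, between `ε` and `χ`. -/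
lemma xiForm_mul (b c : HD χ a) : xiForm χ a (b * c) =
    counit (R := k) b * xiForm χ a c + xiForm χ a b * char χ a χ c := by
  simp [xiForm, Matrix.mul_apply, triHom_apply]

/-- The linear form `ξ` as an element of `(H^*)^cop`. -/
noncomputable def xi : DualCop k (HD χ a) := (DualCop.toDual k _).symm (xiForm χ a)

@[simp] lemma toDual_xi : DualCop.toDual k _ (xi χ a) = xiForm χ a := by simp [xi]

/-- A character of `G` as an element of `(H^*)^cop`. -/
noncomputable def psi (ψ : G →* kˣ) : DualCop k (HD χ a) :=
  (DualCop.toDual k _).symm (char χ a ψ).toLinearMap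

@[simp] lemma toDual_psi (ψ : G →* kˣ) :
    DualCop.toDual k _ (psi χ a ψ) = (char χ a ψ).toLinearMap := by simp [psi]

lemma psi_one : psi χ a 1 = 1 := DualCop.ext_toDual fun b => by simp

/-! ### Multiplication in the dual through operators on `H_𝒟` -/

variable {χ a} in
-- Right multiplication by `f` in the dual is the transpose of `b ↦ ∑ b₁ f(b₂)`. Products in the
-- dual can thus be computed by operators on `H_𝒟`: an algebra endomorphism for `f = ψ`, a skew
-- derivation for `f = ξ`.
lemma toDual_mul_eq_rid (F f : DualCop k (HD χ a)) (b : HD χ a) :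
    DualCop.toDual k _ (F * f) b =
      DualCop.toDual k _ F (TensorProduct.rid k _ ((DualCop.toDual k _ f).lTensor _ (comul b))) := by
  rw [DualCop.toDual_mul_apply]
  induction comul (R := k) b with
  | zero => simp
  | add t u ht hu => simp only [map_add, ht, hu]
  | tmul b c => simp [mul_comm]

/-- The algebra endomorphism `b ↦ ∑ b₁ ψ(b₂)`. -/
noncomputable def translate (ψ : G →* kˣ) : HD χ a →ₐ[k] HD χ a :=
  ((Algebra.TensorProduct.rid k k _).toAlgHom.comp
    (Algebra.TensorProduct.map (.id k _) (char χ a ψ))).comp (Bialgebra.comulAlgHom k _)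

@[simp] lemma translate_grp (ψ : G →* kˣ) (g : G) :
    translate χ a ψ (grp χ a g) = (ψ g : k) • grp χ a g := by simp [translate]

@[simp] lemma translate_x (ψ : G →* kˣ) :
    translate χ a ψ (x χ a) = (ψ a : k) • x χ a := by simp [translate]

lemma toDual_mul_psi (F : DualCop k (HD χ a)) (ψ : G →* kˣ) (b : HD χ a) :
    DualCop.toDual k _ (F * psi χ a ψ) b = DualCop.toDual k _ F (translate χ a ψ b) := by
  rw [toDual_mul_eq_rid, toDual_psi]
  rfl

lemma psi_mul_psi (φ ψ : G →* kˣ) : psi χ a φ * psi χ a ψ = psi χ a (φ * ψ) := by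
  refine DualCop.ext_toDual fun b => ?_
  rw [toDual_mul_psi]
  exact congr($(hom_ext (f := (char χ a φ).comp (translate χ a ψ)) (g := char χ a (φ * ψ))
    (by simp [mul_comm]) (by simp)) b)

/-- The operator `b ↦ ∑ b₁ ξ(b₂)`. -/
noncomputable def derivXi : HD χ a →ₗ[k] HD χ a :=
  (TensorProduct.rid k _).toLinearMap ∘ₗ (xiForm χ a).lTensor _ ∘ₗ comul

lemma toDual_mul_xi (F : DualCop k (HD χ a)) (b : HD χ a) :
    DualCop.toDual k _ (F * xi χ a) b = DualCop.toDual k _ F (derivXi χ a b) := by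
  rw [toDual_mul_eq_rid, toDual_xi]
  rfl

@[simp] lemma derivXi_grp (g : G) : derivXi χ a (grp χ a g) = 0 := by simp [derivXi]

@[simp] lemma derivXi_x : derivXi χ a (x χ a) = xiCoeff χ a • 1 := by simp [derivXi]

/-- The twisted Leibniz rule is the skew-primitivity of `ξ` applied to the second tensor factors of
`Δ(b) Δ(c)`; the twist by `χ` on the right is what produces `q`-integers for `q = χ(a)`. -/
lemma derivXi_mul (b c : HD χ a) : derivXi χ a (b * c) =
    b * derivXi χ a c + derivXi χ a b * translate χ a χ c := by
  have hb := Coalgebra.lTensor_counit_comul (R := k) b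
  -- The identity is bilinear in the two coproducts, so it is checked on arbitrary pure tensors.
  have h : ∀ t u : HD χ a ⊗[k] HD χ a, TensorProduct.rid k _ ((xiForm χ a).lTensor _ (t * u)) =
      TensorProduct.rid k _ (counit.lTensor _ t) * TensorProduct.rid k _ ((xiForm χ a).lTensor _ u) +
      TensorProduct.rid k _ ((xiForm χ a).lTensor _ t) * Algebra.TensorProduct.rid k k _
        (Algebra.TensorProduct.map (.id k _) (char χ a χ) u) := by
    intro t u
    induction t with
    | zero => simp
    | add t t' ht ht' => simp only [add_mul, map_add, ht, ht']; abel
    | tmul b c =>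
      induction u with
      | zero => simp
      | add u u' hu hu' => simp only [mul_add, map_add, hu, hu']; abel
      | tmul d e => simp [xiForm_mul, add_smul, smul_smul, mul_comm]
  have := h (comul b) (comul c)
  rw [← Bialgebra.comul_mul, hb] at this
  simpa [derivXi, translate] using this

/-- The `q`-integer `1 + q + ⋯ + q^{n-1}`, for `q = χ(a)`. -/
noncomputable def qInt (n : ℕ) : k := ∑ i ∈ Finset.range n, (χ a : k) ^ i

/-- The `q`-factorial, for `q = χ(a)`. -/
noncomputable def qFact (n : ℕ) : k := ∏ i ∈ Finset.range n, qInt χ a (i + 1)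

/-- A factor `1 + q + ⋯ + qⁱ` multiplied by `q - 1` gives `q^{i+1} - 1`, which is nonzero because `q
= χ(a)` has order `ℓ > i + 1`. -/
lemma qFact_ne_zero {n : ℕ} (hn : n < orderOf (χ a)) : qFact χ a n ≠ 0 := by
  refine Finset.prod_ne_zero_iff.mpr fun i hi h => ?_
  have h1 : i + 1 < orderOf (χ a) := by rw [Finset.mem_range] at hi; omega
  refine (isPrimitiveRoot χ a).pow_ne_one_of_pos_of_lt i.succ_ne_zero h1 (sub_eq_zero.mp ?_)
  rw [← geom_sum_mul]
  exact mul_eq_zero_of_left h _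

/-- By the Leibniz rule a further factor `x` adds `κ χ(a)ⁿ⁺¹`, the scalar by which `χ` translates
`xⁿ⁺¹`; the sum of these is a `q`-integer. -/
lemma derivXi_x_pow (n : ℕ) : derivXi χ a (x χ a ^ (n + 1)) =
    (xiCoeff χ a * qInt χ a (n + 1)) • x χ a ^ n := by
  induction n with
  | zero => simp [qInt]
  | succ n ih =>
    rw [pow_succ' _ (n + 1), derivXi_mul, ih, derivXi_x, mul_smul_comm, ← pow_succ', map_pow,
      translate_x, smul_pow, smul_one_mul, smul_smul, ← add_smul, ← mul_add, qInt, qInt,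
      Finset.sum_range_succ _ (n + 1)]

lemma derivXi_grp_mul_x_pow (g : G) (n : ℕ) : derivXi χ a (grp χ a g * x χ a ^ (n + 1)) =
    (xiCoeff χ a * qInt χ a (n + 1)) • (grp χ a g * x χ a ^ n) := by
  rw [derivXi_mul, derivXi_x_pow, derivXi_grp, zero_mul, add_zero, mul_smul_comm]

/-- The pairing of the bases of `H^*` and `H`. -/
lemma toDual_psi_mul_xi_pow (ψ : G →* kˣ) (j : ℕ) (g : G) (n : ℕ) :
    DualCop.toDual k _ (psi χ a ψ * xi χ a ^ j) (grp χ a g * x χ a ^ n) =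
      if n = j then xiCoeff χ a ^ j * qFact χ a j * ψ g else 0 := by
  induction j generalizing n with
  | zero => cases n <;> simp [qFact]
  | succ j ih =>
    -- Each factor `ξ` is traded for one application of the skew derivation, which lowers the power
    -- of `x` by one and kills `G`.
    rw [pow_succ, ← mul_assoc, toDual_mul_xi]
    cases n with
    | zero => simp
    | succ n =>
      rw [derivXi_grp_mul_x_pow, map_smul, ih]
      by_cases h : n = j
      · simp [h, qFact, Finset.prod_range_succ]; ring
      · simp [h]

/-- Against `g xⁿ` the form `ξ^ℓ` can be nonzero only for `n = ℓ`, and there `x^ℓ = 0`. -/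
lemma xi_pow_orderOf : xi χ a ^ orderOf (χ a) = 0 := by
  rw [← one_mul (xi χ a ^ _), ← psi_one]
  apply (DualCop.toDual k _).injective
  refine linearMap_ext χ a fun g n => ?_
  by_cases h : n = orderOf (χ a)
  · subst h
    simp [x_pow]
  · rw [toDual_psi_mul_xi_pow, if_neg h]; simp

/-! ### Evaluation of forms at group-like elements -/

lemma toDual_mul_of_isGroupLike {d : HD χ a} (hd : IsGroupLikeElem k d) (f F : DualCop k (HD χ a)) :
    DualCop.toDual k _ (f * F) d = DualCop.toDual k _ f d * DualCop.toDual k _ F d := by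
  simp [DualCop.toDual_mul_apply, hd.comul_eq_tmul_self]

/-- Evaluation at a group-like element is a character of the dual algebra, so it kills the nilpotent
element `ξ`. Together with the next lemma this replaces a classification of the group-like elements
of `H_𝒟`. -/
lemma xiForm_of_isGroupLike {d : HD χ a} (hd : IsGroupLikeElem k d) : xiForm χ a d = 0 := by
  have h : ∀ n, DualCop.toDual k _ (xi χ a ^ n) d = xiForm χ a d ^ n := by
    intro n
    induction n with
    | zero => simp [hd.counit_eq_one]
    | succ n ih => rw [pow_succ, toDual_mul_of_isGroupLike χ a hd, ih, toDual_xi, pow_succ]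
  have h1 := h (orderOf (χ a))
  rw [xi_pow_orderOf, map_zero, LinearMap.zero_apply] at h1
  exact eq_zero_of_pow_eq_zero h1.symm

/-- Since `ξ(d) = 0`, the skew derivation annihilates `d` and therefore commutes with left
multiplication by `d`. All factors `ξ` pass to `b`, and only the algebra map `ψ` sees `d`. -/
lemma toDual_psi_mul_xi_pow_mul {d : HD χ a} (hd : IsGroupLikeElem k d) (ψ : G →* kˣ) (j : ℕ)
    (b : HD χ a) : DualCop.toDual k _ (psi χ a ψ * xi χ a ^ j) (d * b) =
      char χ a ψ d * DualCop.toDual k _ (psi χ a ψ * xi χ a ^ j) b := by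
  induction j generalizing b with
  | zero => simp
  | succ j ih =>
    have hd' : derivXi χ a d = 0 := by
      simp [derivXi, hd.comul_eq_tmul_self, xiForm_of_isGroupLike χ a hd]
    rw [pow_succ, ← mul_assoc, toDual_mul_xi, derivXi_mul, hd', zero_mul, add_zero, ih,
      toDual_mul_xi]

/-! ### Fourier inversion on `G` and a spanning set of the dual -/

/-- Some character `φ` has `φ(g) ≠ 1`, and translating the sum by `φ` multiplies it by `φ(g)`
without changing it. -/
lemma sum_char_eq_zero [Fintype (G →* kˣ)] [HasEnoughRootsOfUnity k (Monoid.exponent G)] {g : G}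
    (hg : g ≠ 1) : ∑ ψ : G →* kˣ, (ψ g : k) = 0 := by
  obtain ⟨φ, hφ⟩ := CommGroup.exists_apply_ne_one_of_hasEnoughRootsOfUnity G k hg
  have h : (φ g : k) * ∑ ψ : G →* kˣ, (ψ g : k) = ∑ ψ : G →* kˣ, (ψ g : k) := by
    rw [Finset.mul_sum]
    exact Fintype.sum_equiv (Equiv.mulLeft φ) _ _ fun ψ => by simp
  have h1 : ((φ g : k) - 1) * ∑ ψ : G →* kˣ, (ψ g : k) = 0 := by rw [sub_mul, h, one_mul, sub_self]
  exact (mul_eq_zero.mp h1).resolve_left (sub_ne_zero.mpr fun h => hφ (Units.ext h))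

/-- In each degree `j` a form restricts to a function on `G`, and such a function is a combination
of characters. The power `ξʲ` selects the degree, up to the scalar `κʲ [j]!`, which is invertible
for `j < ℓ`. -/
lemma span_psi_mul_xi_pow [CharZero k] [HasEnoughRootsOfUnity k (Monoid.exponent G)] :
    Submodule.span k (Set.range fun p : (G →* kˣ) × ℕ => psi χ a p.1 * xi χ a ^ p.2) = ⊤ := by
  classical
  have := Fintype.ofFinite G
  have := Fintype.ofFinite (G →* kˣ)
  have hN : (Fintype.card (G →* kˣ) : k) ≠ 0 := Nat.cast_ne_zero.mpr Fintype.card_ne_zero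
  refine top_unique fun F _ => ?_
  -- The coefficients are those of the inverse Fourier transform of `h ↦ F(h xʲ)`, divided by the
  -- value `κʲ [j]!` of `ξʲ` at `xʲ`.
  have hF : F = ∑ j ∈ Finset.range (orderOf (χ a)), ∑ h : G, ∑ ψ : G →* kˣ,
      ((Fintype.card (G →* kˣ) : k)⁻¹ * (xiCoeff χ a ^ j * qFact χ a j)⁻¹ * (ψ h⁻¹ : kˣ) *
        DualCop.toDual k _ F (grp χ a h * x χ a ^ j)) • (psi χ a ψ * xi χ a ^ j) := by
    apply (DualCop.toDual k _).injective
    refine linearMap_ext χ a fun g n => ?_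
    simp only [map_sum, map_smul, LinearMap.sum_apply, LinearMap.smul_apply,
      toDual_psi_mul_xi_pow, smul_eq_mul, mul_ite, mul_zero]
    by_cases hn : n < orderOf (χ a)
    · rw [Finset.sum_eq_single_of_mem n (Finset.mem_range.mpr hn)
        fun j _ hj => by simp [hj.symm], Finset.sum_eq_single g]
      · have h0 := mul_ne_zero (xiCoeff_pow_ne_zero χ a hn) (qFact_ne_zero χ a hn)
        -- The term `h = g`: the factors `ψ(g⁻¹)` and `ψ(g)` cancel, so every character contributes
        -- the same amount.
        have h1 : ∀ ψ : G →* kˣ, (Fintype.card (G →* kˣ) : k)⁻¹ *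
            (xiCoeff χ a ^ n * qFact χ a n)⁻¹ * (ψ g⁻¹ : kˣ) *
              DualCop.toDual k _ F (grp χ a g * x χ a ^ n) *
                (xiCoeff χ a ^ n * qFact χ a n * (ψ g : k)) =
            (Fintype.card (G →* kˣ) : k)⁻¹ * DualCop.toDual k _ F (grp χ a g * x χ a ^ n) := by
          intro ψ
          have := (ψ g).ne_zero
          rw [map_inv, Units.val_inv_eq_inv_val]
          field_simp
          exact mul_div_cancel_left₀ _ h0
        simp only [if_true, h1, Finset.sum_const, Finset.card_univ, nsmul_eq_mul]
        rw [mul_inv_cancel_left₀ hN]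
      · intro h _ hh
        -- The terms `h ≠ g`: the dependence on `ψ` is collected in `ψ(h⁻¹ g)`, whose sum over all
        -- characters vanishes.
        have h1 : ∀ ψ : G →* kˣ, (Fintype.card (G →* kˣ) : k)⁻¹ *
            (xiCoeff χ a ^ n * qFact χ a n)⁻¹ * (ψ h⁻¹ : kˣ) *
              DualCop.toDual k _ F (grp χ a h * x χ a ^ n) *
                (xiCoeff χ a ^ n * qFact χ a n * (ψ g : k)) =
            ((Fintype.card (G →* kˣ) : k)⁻¹ * (xiCoeff χ a ^ n * qFact χ a n)⁻¹ *
              DualCop.toDual k _ F (grp χ a h * x χ a ^ n) *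
                (xiCoeff χ a ^ n * qFact χ a n)) * (ψ (h⁻¹ * g) : kˣ) := by
          intro ψ
          rw [map_mul ψ, Units.val_mul]
          ring
        simp only [if_true, h1, ← Finset.mul_sum]
        rw [sum_char_eq_zero fun h2 => hh (inv_mul_eq_one.mp h2), mul_zero]
      · simp
    -- For `n ≥ ℓ` the monomial itself is zero, and no degree `j < ℓ` in the sum matches `n`.
    · rw [pow_eq_zero_of_le (not_lt.mp hn) (x_pow χ a), mul_zero, map_zero]
      refine (Finset.sum_eq_zero fun j hj => ?_).symm
      rw [Finset.mem_range] at hj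
      have : n ≠ j := by omega
      simp [this]
  rw [hF]
  exact sum_mem fun j _ => sum_mem fun h _ => sum_mem fun ψ _ =>
    Submodule.smul_mem _ _ (Submodule.subset_span ⟨(ψ, j), rfl⟩)

end HD

/-! ### Products, coproducts and group-like elements in a general double -/

namespace DrinfeldDouble

open DualCop

variable {k H : Type*} [Field k] [Ring H] [HopfAlgebra k H] [Module.Finite k H]
  [HasBijectiveAntipode k H]

/-- The reordering rule of the double. All commutation relations below come from evaluating `twist`
on the iterated coproduct of a generator. -/
lemma incl_mul_inclDual (h : H) (f : DualCop k H) :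
    (incl h * inclDual f : DrinfeldDouble k H) = twist f (comul₂ h) := by
  refine (mulMap_tmul f 1 h 1).trans ?_
  rw [LinearMap.mulLeft_one, LinearMap.mulRight_one, map_id]
  rfl

lemma toHom_inclDual_mul_incl (f : DualCop k H) (h b : H) :
    toHom k H (inclDual f * incl h) b = toDual k H f b • h := by
  rw [inclDual_mul_incl]
  exact evalHom_tmul f h b

lemma comul_incl (h : H) : comul (R := k) (incl h : DrinfeldDouble k H) =
    map incl.toLinearMap incl.toLinearMap (comul (R := k) h) := by
  refine (comul_tmul (R := k) (S := k) (A := DualCop k H) 1 h).trans ?_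
  have h1 : comul (R := k) (1 : DualCop k H) = 1 ⊗ₜ 1 :=
    ext_evalHom fun b => DualCop.ext_toDual fun c => by
      rw [toDual_evalHom_comul]; simp [mul_comm]
  rw [h1]
  induction comul (R := k) h with
  | zero => simp only [tmul_zero, map_zero]; rfl
  | add t u ht hu => simp only [tmul_add, map_add, ht, hu]; rfl
  | tmul b c => rfl

lemma comul_inclDual (f : DualCop k H) : comul (R := k) (inclDual f : DrinfeldDouble k H) =
    map inclDual.toLinearMap inclDual.toLinearMap (comul (R := k) f) := by
  refine (comul_tmul (R := k) (S := k) (A := DualCop k H) f 1).trans ?_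
  rw [Bialgebra.comul_one, Algebra.TensorProduct.one_def]
  induction comul (R := k) f with
  | zero => simp only [zero_tmul, map_zero]; rfl
  | add t u ht hu => simp only [add_tmul, map_add, ht, hu]; rfl
  | tmul b c => rfl

lemma counit_incl (h : H) : counit (R := k) (incl h : DrinfeldDouble k H) = counit h := by
  have h1 := toHom_inclDual_mul_incl (k := k) 1 h 1
  rw [map_one inclDual, one_mul] at h1
  rw [counit_eq, h1]
  simp

lemma counit_inclDual (f : DualCop k H) :
    counit (R := k) (inclDual f : DrinfeldDouble k H) = toDual k H f 1 := by
  have h1 := toHom_inclDual_mul_incl (k := k) f 1 1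
  rw [map_one incl, mul_one] at h1
  rw [counit_eq, h1]
  simp

/-- The double is spanned by products of elements of `(H^*)^cop` and of `H`. -/
lemma induction_on_mul {p : DrinfeldDouble k H → Prop} (h0 : p 0)
    (hadd : ∀ y z, p y → p z → p (y + z)) (hmul : ∀ f h, p (inclDual f * incl h))
    (y : DrinfeldDouble k H) : p y := by
  induction y using TensorProduct.induction_on with
  | zero => exact h0
  | add y z hy hz => exact hadd y z hy hz
  | tmul f h => rw [← inclDual_mul_incl]; exact hmul f h

/-- A group-like element of `D(H)` is the product of a character of `H` and a group-like element
of `H`. -/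
lemma exists_of_isGroupLikeElem {z : DrinfeldDouble k H} (hz : IsGroupLikeElem k z) :
    ∃ (f : H →ₐ[k] k) (d : H), IsGroupLikeElem k d ∧
      z = inclDual ((toDual k H).symm f.toLinearMap) * incl d := by
  set E := toHom k H z with hE
  -- Under the identification of `D(H)` with the endomorphisms of `H`, being group-like means `E(b)
  -- ⊗ E(c) = Δ(E(c b))`; the reversal of `b` and `c` is the co-opposite on the dual side.
  have h1 : ∀ b c, E b ⊗ₜ[k] E c = comul (R := k) (E (c * b)) := fun b c => by
    rw [hE, ← toHom₂_comul_apply, hz.comul_eq_tmul_self, toHom₂_tmul, map_tmul]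
  have h2 : counit (R := k) (E 1) = 1 := by rw [← counit_eq, hz.counit_eq_one]
  have h3 : ∀ b c, counit (R := k) (E b) * counit (R := k) (E c) = counit (R := k) (E (c * b)) := by
    intro b c
    have := congrArg (counit (R := k) (A := H) ∘ₗ (TensorProduct.lid k H).toLinearMap ∘ₗ
      counit.rTensor H) (h1 b c)
    simpa using this
  -- The dual component is `ε ∘ E`; applying `ε ⊗ ε` to the group-like identity shows that it is
  -- multiplicative.
  let f : H →ₐ[k] k := AlgHom.ofLinearMap (counit ∘ₗ E) h2 fun b c => by
    simp [← h3, mul_comm]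
  refine ⟨f, E 1, ⟨h2, by rw [h1, one_mul]⟩, (toHom k H).injective (LinearMap.ext fun b => ?_)⟩
  -- With `c = 1`, applying `ε ⊗ id` gives `E(b) = ε(E(b)) E(1)`, so `E` has rank one and `z` is a
  -- single product.
  have := congrArg ((TensorProduct.lid k H).toLinearMap ∘ₗ counit.rTensor H) (h1 b 1)
  rw [toHom_inclDual_mul_incl]
  change E b = counit (R := k) (E b) • E 1
  simpa using this.symm

end DrinfeldDouble

/-! ### Commutation relations in the double of `H_𝒟` -/

namespace HD

open DrinfeldDouble

variable {k : Type*} [Field k] {G : Type*} [CommGroup G] (χ : G →* kˣ) (a : G) [Finite G]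

@[simp] lemma antipodeInv_grp (g : G) : antipodeInv k (HD χ a) (grp χ a g) = grp χ a g⁻¹ := by
  rw [← antipodeInv_antipode (k := k) (grp χ a g⁻¹), antipode_grp, inv_inv]

@[simp] lemma antipodeInv_x : antipodeInv k (HD χ a) (x χ a) = -(grp χ a a⁻¹ * x χ a) := by
  rw [← antipodeInv_antipode (k := k) (-(grp χ a a⁻¹ * x χ a))]
  simp [antipode_mul_antidistrib, mul_assoc]

lemma comul₂_grp (g : G) :
    comul₂ (k := k) (grp χ a g) = grp χ a g ⊗ₜ (grp χ a g ⊗ₜ grp χ a g) := by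
  simp [comul₂]

lemma comul₂_x : comul₂ (k := k) (x χ a) = x χ a ⊗ₜ (grp χ a a ⊗ₜ grp χ a a) +
    1 ⊗ₜ (x χ a ⊗ₜ grp χ a a) + 1 ⊗ₜ (1 ⊗ₜ x χ a) := by
  simp [comul₂, tmul_add, add_assoc, Algebra.TensorProduct.one_def]

/-- An element of `G` in the double. -/
noncomputable abbrev dGrp (g : G) : DrinfeldDouble k (HD χ a) := incl (grp χ a g)

/-- The generator `x` in the double. -/
noncomputable abbrev dX : DrinfeldDouble k (HD χ a) := incl (x χ a)

/-- A character of `G` in the double. -/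
noncomputable abbrev dPsi (ψ : G →* kˣ) : DrinfeldDouble k (HD χ a) := inclDual (psi χ a ψ)

/-- The form `ξ` in the double. -/
noncomputable abbrev dXi : DrinfeldDouble k (HD χ a) := inclDual (xi χ a)

lemma dGrp_mul_dPsi (g : G) (ψ : G →* kˣ) :
    dGrp χ a g * dPsi χ a ψ = dPsi χ a ψ * dGrp χ a g := by
  rw [incl_mul_inclDual, inclDual_mul_incl, comul₂_grp, twist_tmul]
  congr 1
  exact DualCop.ext_toDual fun b => by simp [mul_comm]

/-- The scalar comes from `ξ(g⁻¹ b g) = χ(g) ξ(b)`, where the factor on the right is seen by `χ` and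
the one on the left only by `ε`. -/
lemma dGrp_mul_dXi (g : G) : dGrp χ a g * dXi χ a = (χ g : k) • (dXi χ a * dGrp χ a g) := by
  rw [incl_mul_inclDual, inclDual_mul_incl, comul₂_grp, twist_tmul]
  refine Eq.trans ?_ (smul_tmul' (χ g : k) (xi χ a) (grp χ a g)).symm
  congr 1
  exact DualCop.ext_toDual fun b => by simp [xiForm_mul, mul_comm]

/-- Of the three terms of the iterated coproduct of `x`, the two with `x` in an outer position
vanish because `ψ` is multiplicative and `ψ(x) = 0`. The middle one leaves `ψ(a⁻¹)`. -/
lemma dX_mul_dPsi (ψ : G →* kˣ) :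
    dX χ a * dPsi χ a ψ = (ψ a : k)⁻¹ • (dPsi χ a ψ * dX χ a) := by
  rw [incl_mul_inclDual, inclDual_mul_incl, comul₂_x, map_add, map_add, twist_tmul, twist_tmul,
    twist_tmul]
  have h1 : DualCop.hitRight (antipodeInv k _ (grp χ a a)) (DualCop.hitLeft (x χ a) (psi χ a ψ)) =
      0 := DualCop.ext_toDual fun b => by simp
  have h2 : DualCop.hitRight (antipodeInv k _ (grp χ a a)) (DualCop.hitLeft 1 (psi χ a ψ)) =
      (ψ a : k)⁻¹ • psi χ a ψ := DualCop.ext_toDual fun b => by simp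
  have h3 : DualCop.hitRight (antipodeInv k _ (x χ a)) (DualCop.hitLeft 1 (psi χ a ψ)) =
      0 := DualCop.ext_toDual fun b => by simp
  rw [h1, h2, h3, zero_tmul, zero_tmul, zero_add, add_zero]
  exact (smul_tmul' (ψ a : k)⁻¹ (psi χ a ψ) (x χ a)).symm

/-- The middle term of the iterated coproduct of `x` reorders the product. The outer terms
contribute `ξ(a⁻¹ b x) = κ ε(b)`, paired with `a`, and `ξ(S⁻¹(x) b) = -κ χ(b)`, paired with `1`.
This is the source of the relation between `e` and `f`. -/
lemma dX_mul_dXi : dX χ a * dXi χ a =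
    dXi χ a * dX χ a + xiCoeff χ a • (dGrp χ a a - dPsi χ a χ) := by
  have h1 : DualCop.hitRight (antipodeInv k _ (grp χ a a)) (DualCop.hitLeft (x χ a) (xi χ a)) =
      xiCoeff χ a • 1 := DualCop.ext_toDual fun b => by simp [xiForm_mul, mul_comm]
  have h2 : DualCop.hitRight (antipodeInv k _ (grp χ a a)) (DualCop.hitLeft 1 (xi χ a)) =
      xi χ a := DualCop.ext_toDual fun b => by simp [xiForm_mul]
  have h3 : DualCop.hitRight (antipodeInv k _ (x χ a)) (DualCop.hitLeft 1 (xi χ a)) =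
      -(xiCoeff χ a • psi χ a χ) := DualCop.ext_toDual fun b => by simp [xiForm_mul]
  rw [incl_mul_inclDual, comul₂_x, map_add, map_add, twist_tmul, twist_tmul,
    twist_tmul, h1, h2, h3]
  have h4 : ∀ (f : DualCop k (HD χ a)) (h : HD χ a),
      f ⊗ₜ[k] h = (inclDual f * incl h : DrinfeldDouble k (HD χ a)) :=
    fun f h => (inclDual_mul_incl f h).symm
  refine (congrArg₂ (· + ·) (congrArg₂ (· + ·) (h4 _ _) (h4 _ _)) (h4 _ _)).trans ?_
  simp only [map_smul, map_neg, map_one, mul_one, smul_one_mul]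
  rw [smul_sub]
  abel

/-- Both sides live in degree one, and translation by `ψ` scales `g x` by `ψ(g) ψ(a)`; the extra
`ψ(a)` is the scalar. -/
lemma xi_mul_psi (ψ : G →* kˣ) :
    xi χ a * psi χ a ψ = (ψ a : k) • (psi χ a ψ * xi χ a) := by
  apply (DualCop.toDual k _).injective
  refine linearMap_ext χ a fun g n => ?_
  have h1 := toDual_psi_mul_xi_pow χ a 1 1 g n
  have h2 := toDual_psi_mul_xi_pow χ a ψ 1 g n
  rw [pow_one] at h1 h2
  rw [psi_one, one_mul] at h1
  rw [map_smul, LinearMap.smul_apply, h2, toDual_mul_psi, map_mul, map_pow, translate_grp,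
    translate_x, smul_pow, smul_mul_smul_comm, map_smul, h1]
  by_cases h : n = 1
  · subst h
    simp
    ring
  · simp [h]

lemma dXi_mul_dPsi (ψ : G →* kˣ) :
    dXi χ a * dPsi χ a ψ = (ψ a : k) • (dPsi χ a ψ * dXi χ a) := by
  rw [← map_mul, xi_mul_psi, map_smul, map_mul]

lemma comul_psi (ψ : G →* kˣ) : comul (R := k) (psi χ a ψ) = psi χ a ψ ⊗ₜ psi χ a ψ :=
  DualCop.ext_evalHom fun b => DualCop.ext_toDual fun c => by
    rw [DualCop.toDual_evalHom_comul]; simp [mul_comm]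

/-- Dual to `xiForm_mul`; the co-opposite convention puts `χ` in the left factor, as `ω` is in
`Δ(e)`. -/
lemma comul_xi : comul (R := k) (xi χ a) = psi χ a χ ⊗ₜ xi χ a + xi χ a ⊗ₜ 1 :=
  DualCop.ext_evalHom fun b => DualCop.ext_toDual fun c => by
    rw [DualCop.toDual_evalHom_comul]; simp [xiForm_mul]; ring

end HD

namespace HD

open DrinfeldDouble

variable {k : Type*} [Field k] {G : Type*} [CommGroup G] (χ : G →* kˣ) (a : G) [Finite G]

lemma dX_mul_dGrp (g : G) : dX χ a * dGrp χ a g = (χ g : k) • (dGrp χ a g * dX χ a) := by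
  rw [← map_mul, x_mul_grp, map_smul, map_mul]

lemma dGrp_mul_dX (g : G) : dGrp χ a g * dX χ a = (χ g : k)⁻¹ • (dX χ a * dGrp χ a g) := by
  rw [dX_mul_dGrp, smul_smul, inv_mul_cancel₀ (Units.ne_zero _), one_smul]

lemma dGrp_mul_dGrp (g h : G) : dGrp χ a g * dGrp χ a h = dGrp χ a (g * h) := by
  rw [← map_mul, grp_mul]

lemma dGrp_one : dGrp χ a 1 = 1 := by rw [dGrp, grp_one, map_one]

lemma dPsi_one : dPsi χ a 1 = 1 := by rw [dPsi, psi_one, map_one]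

lemma isGroupLikeElem_dGrp (g : G) : IsGroupLikeElem k (dGrp χ a g) :=
  ⟨by rw [counit_incl, counit_grp], by rw [comul_incl, comul_grp]; rfl⟩

lemma isGroupLikeElem_dPsi (ψ : G →* kˣ) : IsGroupLikeElem k (dPsi χ a ψ) :=
  ⟨by rw [counit_inclDual]; simp, by rw [comul_inclDual, comul_psi]; rfl⟩

/-! ### Generators of the double and its central group-like elements -/

section Generation

variable [CharZero k] [HasEnoughRootsOfUnity k (Monoid.exponent G)]

/-- The double is spanned by products of the two factors; the dual is spanned by the `ψ ξⁿ`, and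
`H_𝒟` is generated by `G` and `x`. -/
lemma subalgebra_eq_top {S : Subalgebra k (DrinfeldDouble k (HD χ a))}
    (hg : ∀ g, dGrp χ a g ∈ S) (hx : dX χ a ∈ S) (hpsi : ∀ ψ, dPsi χ a ψ ∈ S)
    (hxi : dXi χ a ∈ S) : S = ⊤ := by
  refine top_unique fun y _ => ?_
  induction y using induction_on_mul with
  | h0 => exact zero_mem _
  | hadd y z hy hz => exact add_mem (hy trivial) (hz trivial)
  | hmul f h =>
    refine mul_mem ?_ ?_
    · have hf : f ∈ Submodule.span k
          (Set.range fun p : (G →* kˣ) × ℕ => psi χ a p.1 * xi χ a ^ p.2) := by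
        rw [span_psi_mul_xi_pow]; trivial
      suffices Submodule.span k
          (Set.range fun p : (G →* kˣ) × ℕ => psi χ a p.1 * xi χ a ^ p.2) ≤
          (Subalgebra.toSubmodule S).comap inclDual.toLinearMap from this hf
      refine Submodule.span_le.mpr ?_
      rintro _ ⟨⟨ψ, n⟩, rfl⟩
      simpa using mul_mem (hpsi ψ) (pow_mem hxi n)
    · clear * - hg hx
      induction h using induction_on with
      | hg g => exact hg g
      | hx => exact hx
      | hr r => rw [AlgHom.commutes]; exact S.algebraMap_mem r
      | hadd b c hb hc => rw [map_add]; exact add_mem hb hc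
      | hmul b c hb hc => rw [map_mul]; exact mul_mem hb hc

/-- The element commutes with every group element and character. Against `x` the factors `ψ` and `g`
contribute `ψ(a)⁻¹` and `χ(g)`; against `ξ` the comparison is again between `ψ(a)` and `χ(g)`. The
condition `ψ(a) = χ(g)` cancels both. -/
lemma dPsi_mul_dGrp_mem_centralGroupLikes {ψ : G →* kˣ} {g : G} (h : ψ a = χ g) :
    dPsi χ a ψ * dGrp χ a g ∈ centralGroupLikes k (DrinfeldDouble k (HD χ a)) := by
  refine ⟨(isGroupLikeElem_dPsi χ a ψ).mul (isGroupLikeElem_dGrp χ a g), ?_⟩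
  have h0 : (χ g : k) ≠ 0 := Units.ne_zero _
  -- The centralizer is a subalgebra, so commutation need only be checked on the four kinds of
  -- generators.
  have hS : Subalgebra.centralizer k {dPsi χ a ψ * dGrp χ a g} = ⊤ := by
    refine subalgebra_eq_top χ a (fun b => ?_) ?_ (fun φ => ?_) ?_ <;>
      rw [Subalgebra.mem_centralizer_iff] <;> rintro _ rfl
    · rw [mul_assoc, dGrp_mul_dGrp, ← mul_assoc, dGrp_mul_dPsi, mul_assoc, dGrp_mul_dGrp,
        mul_comm b]
    · rw [mul_assoc, dGrp_mul_dX, mul_smul_comm, ← mul_assoc, ← mul_assoc, dX_mul_dPsi, h,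
        smul_mul_assoc]
    · rw [mul_assoc, dGrp_mul_dPsi, ← mul_assoc, ← mul_assoc, ← map_mul, ← map_mul, psi_mul_psi,
        psi_mul_psi, mul_comm φ]
    · rw [mul_assoc, dGrp_mul_dXi, mul_smul_comm, ← mul_assoc, ← mul_assoc, dXi_mul_dPsi, h,
        smul_mul_assoc]
  refine Semigroup.mem_center_iff.mpr fun y => ?_
  have hy : y ∈ Subalgebra.centralizer k {dPsi χ a ψ * dGrp χ a g} := by rw [hS]; trivial
  exact ((Subalgebra.mem_centralizer_iff k).mp hy _ rfl).symm

/-- The projection of the double onto its central quotient. -/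
noncomputable abbrev proj : DrinfeldDouble k (HD χ a) →ₐ[k]
    CentralQuotient k (DrinfeldDouble k (HD χ a)) :=
  Ideal.Quotient.mkₐ k (centralIdeal k (DrinfeldDouble k (HD χ a)))

/-- The product `ψ g` becomes `1` in the quotient, so the character can be replaced by a group
element. For `ψ = χ` and `g = a` this turns `χ` into `a⁻¹`. -/
lemma proj_dPsi {ψ : G →* kˣ} {g : G} (h : ψ a = χ g) :
    proj χ a (dPsi χ a ψ) = proj χ a (dGrp χ a g⁻¹) := by
  have h1 : proj χ a (dPsi χ a ψ * dGrp χ a g) = 1 :=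
    mk_eq_one (dPsi_mul_dGrp_mem_centralGroupLikes χ a h)
  calc _ = proj χ a (dPsi χ a ψ * dGrp χ a g * dGrp χ a g⁻¹) := by
        rw [mul_assoc, dGrp_mul_dGrp, mul_inv_cancel, dGrp_one, mul_one]
    _ = _ := by rw [map_mul, h1, one_mul]

/-- The case of the trivial character: an element of the kernel of `χ` is itself central in the
double. -/
lemma proj_dGrp_eq {g h : G} (hgh : χ g = χ h) : proj χ a (dGrp χ a g) = proj χ a (dGrp χ a h) := by
  have h1 := proj_dPsi χ a (ψ := 1) (g := g⁻¹ * h) (by simp [hgh])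
  rw [dPsi_one, map_one, mul_inv_rev, inv_inv] at h1
  calc _ = proj χ a (dGrp χ a (h⁻¹ * g)) * proj χ a (dGrp χ a h) := by
        rw [← map_mul, dGrp_mul_dGrp, mul_comm, mul_inv_cancel_left]
    _ = _ := by rw [← h1, one_mul]

end Generation

/-! ### The comparison map from the small quantum group and its surjectivity -/

section Comparison

variable [CharZero k] [HasEnoughRootsOfUnity k (Monoid.exponent G)]
variable {θ : k} {ℓ : ℕ} (hℓ : orderOf (χ a) = ℓ) (hN : orderOf a = ℓ) (hM : orderOf χ = ℓ)
  (hodd : Odd ℓ) (hθ : IsPrimitiveRoot θ ℓ) (hθ2 : θ ^ 2 = ((χ a)⁻¹ : kˣ))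

include hℓ hθ in
-- For `ℓ = 1` one has `θ = 1`, and `0⁻¹ = 0` makes both sides vanish, consistently with `e = 0`;
-- otherwise `κ = 1`.
lemma inv_sub_inv_mul_xiCoeff : (θ - θ⁻¹)⁻¹ * xiCoeff χ a = (θ - θ⁻¹)⁻¹ := by
  by_cases h : orderOf (χ a) = 1
  · obtain rfl : ℓ = 1 := by omega
    obtain rfl : θ = 1 := IsPrimitiveRoot.one_right_iff.mp hθ
    simp
  · simp [xiCoeff, h]

include hodd hθ in
-- If `ℓ ≠ 1`, then `ℓ ≥ 3` because it is odd, so `θ² ≠ 1` and `θ ≠ θ⁻¹`. If `ℓ = 1`, only `i = 0`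
-- occurs and `0 ^ 0 = 1`.
lemma inv_sub_inv_pow_ne_zero {i : ℕ} (hi : i < ℓ) : ((θ - θ⁻¹)⁻¹) ^ i ≠ 0 := by
  by_cases h : ℓ = 1
  · obtain rfl : i = 0 := by omega
    simp
  · have h1 := hodd.pos
    have h2 : 2 < ℓ := by obtain ⟨m, rfl⟩ := hodd; omega
    refine pow_ne_zero _ (inv_ne_zero fun h3 => ?_)
    refine hθ.pow_ne_one_of_pos_of_lt two_ne_zero h2 ?_
    rw [sq]
    nth_rewrite 2 [sub_eq_zero.mp h3]
    exact mul_inv_cancel₀ (hθ.ne_zero h1.ne')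

/-- The algebra map `e ↦ (θ - θ⁻¹)⁻¹ ξ`, `f ↦ x`, `ω ↦ a⁻¹` from the small quantum group to the
central quotient of the double. -/
noncomputable def compare : USL2 θ hθ hodd →ₐ[k] CentralQuotient k (DrinfeldDouble k (HD χ a)) :=
  USL2.lift ((θ - θ⁻¹)⁻¹ • proj χ a (dXi χ a)) (proj χ a (dX χ a)) (proj χ a (dGrp χ a a⁻¹))
    (proj χ a (dGrp χ a a))
    (by rw [← map_mul, dGrp_mul_dGrp, inv_mul_cancel, dGrp_one, map_one])
    (by rw [← map_mul, dGrp_mul_dGrp, mul_inv_cancel, dGrp_one, map_one])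
    (by rw [smul_pow, ← map_pow, ← map_pow, ← hℓ, xi_pow_orderOf, map_zero, map_zero, smul_zero])
    (by rw [← map_pow, ← map_pow, ← hℓ, x_pow, map_zero, map_zero])
    (by rw [← map_pow, ← map_pow, ← grpHom_apply, ← map_pow, inv_pow, ← hN, pow_orderOf_eq_one,
      inv_one, map_one, map_one, map_one])
    (by rw [mul_smul_comm, ← map_mul, dGrp_mul_dXi, map_smul, map_mul, smul_mul_assoc, hθ2,
      map_inv, smul_comm])
    (by rw [← map_mul, dGrp_mul_dX, map_smul, map_mul, hθ2, map_inv])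
    (by
      -- The commutator `ξ x - x ξ` is `-κ (a - χ)`, and `χ` becomes `a⁻¹` in the quotient; this is
      -- `κ (ω - ω⁻¹)`, with `κ` absorbed by the scalar in `e`.
      rw [smul_mul_assoc, mul_smul_comm, ← smul_sub, ← map_mul, ← map_mul, dX_mul_dXi, map_add,
        sub_add_cancel_left, map_smul, map_sub, proj_dPsi χ a rfl, ← smul_neg, neg_sub, smul_smul,
        inv_sub_inv_mul_xiCoeff χ a hℓ hθ])

@[simp] lemma compare_e : compare χ a hℓ hN hodd hθ hθ2 (USL2.e hθ hodd) =
    (θ - θ⁻¹)⁻¹ • proj χ a (dXi χ a) := USL2.lift_e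

@[simp] lemma compare_f : compare χ a hℓ hN hodd hθ hθ2 (USL2.f hθ hodd) = proj χ a (dX χ a) :=
  USL2.lift_f

@[simp] lemma compare_w : compare χ a hℓ hN hodd hθ hθ2 (USL2.w hθ hodd) =
    proj χ a (dGrp χ a a⁻¹) := USL2.lift_w

@[simp] lemma compare_winv : compare χ a hℓ hN hodd hθ hθ2 (USL2.winv hθ hodd) =
    proj χ a (dGrp χ a a) := USL2.lift_winv

lemma comul_proj (y : DrinfeldDouble k (HD χ a)) : comul (R := k) (proj χ a y) =
    map (proj χ a).toLinearMap (proj χ a).toLinearMap (comul (R := k) y) :=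
  Bialgebra.Quotient.comul_mk _ y

lemma counit_proj (y : DrinfeldDouble k (HD χ a)) : counit (R := k) (proj χ a y) =
    counit (R := k) y := Bialgebra.Quotient.counit_mk _ y

lemma comul_proj_dGrp (g : G) : comul (R := k) (proj χ a (dGrp χ a g)) =
    proj χ a (dGrp χ a g) ⊗ₜ proj χ a (dGrp χ a g) := by
  rw [comul_proj, (isGroupLikeElem_dGrp χ a g).comul_eq_tmul_self]; rfl

lemma comul_proj_dX : comul (R := k) (proj χ a (dX χ a)) =
    proj χ a (dX χ a) ⊗ₜ proj χ a (dGrp χ a a) + 1 ⊗ₜ proj χ a (dX χ a) := by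
  rw [comul_proj, comul_incl, comul_x, map_add, map_add]
  simp

/-- Replacing `χ` by `a⁻¹`, the image of `ω`, makes the coproduct of `ξ` agree with that of `e`. -/
lemma comul_proj_dXi : comul (R := k) (proj χ a (dXi χ a)) =
    proj χ a (dGrp χ a a⁻¹) ⊗ₜ proj χ a (dXi χ a) + proj χ a (dXi χ a) ⊗ₜ 1 := by
  rw [comul_proj, comul_inclDual, comul_xi, map_add, map_add, ← proj_dPsi χ a (ψ := χ) rfl]
  simp

/-- The map `compare` as a map of bialgebras. -/
noncomputable def compareBialgHom :
    USL2 θ hθ hodd →ₐc[k] CentralQuotient k (DrinfeldDouble k (HD χ a)) :=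
  .ofAlgHom (compare χ a hℓ hN hodd hθ hθ2)
    (by
      refine USL2.hom_ext ?_ ?_ ?_ ?_ <;>
        simp only [AlgHom.comp_apply, Bialgebra.counitAlgHom_apply, compare_e, compare_f, compare_w,
          compare_winv, map_smul, counit_proj, counit_incl, counit_inclDual, USL2.counit_e,
          USL2.counit_f, USL2.counit_w, USL2.counit_winv, counit_grp, counit_x, toDual_xi]
      -- The counit of `ξ` in the double is `ξ(1)`, which vanishes because `1` is a group element.
      rw [← grp_one χ a, xiForm_grp, smul_zero])
    (by
      refine USL2.hom_ext ?_ ?_ ?_ ?_ <;>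
        simp only [AlgHom.comp_apply, Bialgebra.comulAlgHom_apply, compare_e, compare_f, compare_w,
          compare_winv, map_smul, comul_proj_dGrp, comul_proj_dX, comul_proj_dXi, USL2.comul_e,
          USL2.comul_f, USL2.comul_w, USL2.comul_winv, map_add, Algebra.TensorProduct.map_tmul,
          map_one, tmul_smul, smul_tmul', smul_add, add_comm])

include hM in
-- The range contains the powers of `a`, and these already account for all of `G` and all
-- characters: the quotient sees `g` only through `χ(g)` and `ψ` only through `ψ(a)`.
lemma compare_surjective : Function.Surjective (compare χ a hℓ hN hodd hθ hθ2) := by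
  set R := (compare χ a hℓ hN hodd hθ hθ2).range
  have ha : ∀ n : ℕ, proj χ a (dGrp χ a (a ^ n)) ∈ R := fun n => by
    have h := pow_mem
      (show proj χ a (dGrp χ a a) ∈ R from ⟨_, compare_winv χ a hℓ hN hodd hθ hθ2⟩) n
    rwa [← map_pow, ← map_pow, ← grpHom_apply, ← map_pow] at h
  -- As `χ(a)` is a primitive `ℓ`-th root of unity, its powers exhaust the `ℓ`-th roots of unity.
  have hu : ∀ u : kˣ, u ^ ℓ = 1 → ∃ n : ℕ, χ (a ^ n) = u := by
    intro u hu
    have hz := isPrimitiveRoot χ a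
    rw [hℓ] at hz
    have : NeZero ℓ := ⟨hodd.pos.ne'⟩
    obtain ⟨i, _, hi⟩ := hz.eq_pow_of_pow_eq_one (ξ := (u : k))
      (by rw [← Units.val_pow_eq_pow_val, hu, Units.val_one])
    exact ⟨i, Units.ext (by simpa using hi)⟩
  have hg : ∀ g, proj χ a (dGrp χ a g) ∈ R := fun g => by
    -- The order of `χ` is used here: it makes `χ(g)` an `ℓ`-th root of unity.
    obtain ⟨n, hn⟩ := hu (χ g) (by rw [← hM, ← MonoidHom.pow_apply, pow_orderOf_eq_one]; rfl)
    rw [← proj_dGrp_eq χ a hn]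
    exact ha n
  have hS : R.comap (proj χ a) = ⊤ := by
    refine subalgebra_eq_top χ a hg ⟨_, compare_f χ a hℓ hN hodd hθ hθ2⟩ (fun ψ => ?_) ?_
    -- The order of `a` is used here: `ψ(a)^ℓ = ψ(a^ℓ) = 1`.
    · obtain ⟨n, hn⟩ := hu (ψ a) (by rw [← hN, ← map_pow, pow_orderOf_eq_one, map_one])
      rw [Subalgebra.mem_comap, proj_dPsi χ a hn.symm]
      exact hg _
    · rw [Subalgebra.mem_comap]
      -- For `ℓ = 1` nilpotency gives `ξ = 0`; otherwise the scalar in the image of `e` can be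
      -- inverted.
      by_cases h : ℓ = 1
      · have h1 := xi_pow_orderOf χ a
        rw [hℓ, h, pow_one] at h1
        simp [dXi, h1]
      · have h1 := inv_sub_inv_pow_ne_zero hodd hθ (i := 1) (by have := hodd.pos; omega)
        rw [pow_one] at h1
        have h2 := R.smul_mem (show (θ - θ⁻¹)⁻¹ • proj χ a (dXi χ a) ∈ R from
          ⟨_, compare_e χ a hℓ hN hodd hθ hθ2⟩) ((θ - θ⁻¹)⁻¹)⁻¹
        rwa [smul_smul, inv_mul_cancel₀ h1, one_smul] at h2
  intro y
  obtain ⟨y, rfl⟩ := Ideal.Quotient.mkₐ_surjective k _ y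
  have hy : y ∈ R.comap (proj χ a) := by rw [hS]; trivial
  exact hy

end Comparison

end HD

/-! ### A spanning set of the small quantum group -/

namespace USL2

variable {k : Type*} [Field k] {θ : k} {ℓ : ℕ} (hθ : IsPrimitiveRoot θ ℓ) (hℓ : Odd ℓ)

lemma winv_eq : winv hθ hℓ = w hθ hℓ ^ (ℓ - 1) := by
  have h : w hθ hℓ * w hθ hℓ ^ (ℓ - 1) = 1 := by
    rw [← pow_succ', Nat.sub_add_cancel hℓ.pos, w_pow]
  rw [← mul_one (winv hθ hℓ), ← h, ← mul_assoc, winv_mul_w, one_mul]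

/-- The triangular decomposition of `𝔲_θ(𝔰𝔩₂)`. -/
lemma span_e_pow_mul_w_pow_mul_f_pow : Submodule.span k (Set.range fun p : Fin ℓ × Fin ℓ × Fin ℓ =>
    e hθ hℓ ^ (p.1 : ℕ) * w hθ hℓ ^ (p.2.1 : ℕ) * f hθ hℓ ^ (p.2.2 : ℕ)) = ⊤ := by
  set S := Submodule.span k (Set.range fun p : Fin ℓ × Fin ℓ × Fin ℓ =>
    e hθ hℓ ^ (p.1 : ℕ) * w hθ hℓ ^ (p.2.1 : ℕ) * f hθ hℓ ^ (p.2.2 : ℕ))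
  -- Arbitrary exponents are allowed: those of `ω` reduce modulo `ℓ`, and large powers of `e` or `f`
  -- vanish.
  have hm : ∀ i m j : ℕ, e hθ hℓ ^ i * w hθ hℓ ^ m * f hθ hℓ ^ j ∈ S := by
    intro i m j
    by_cases hi : i < ℓ
    · by_cases hj : j < ℓ
      · rw [pow_eq_pow_mod m (w_pow hθ hℓ)]
        exact Submodule.subset_span ⟨(⟨i, hi⟩, ⟨m % ℓ, Nat.mod_lt _ hℓ.pos⟩, ⟨j, hj⟩), rfl⟩
      · rw [pow_eq_zero_of_le (not_lt.mp hj) (f_pow hθ hℓ), mul_zero]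
        exact zero_mem _
    · rw [pow_eq_zero_of_le (not_lt.mp hi) (e_pow hθ hℓ), zero_mul, zero_mul]
      exact zero_mem _
  have hS : ∀ u : USL2 θ hθ hℓ, (∀ i m j : ℕ, u * (e hθ hℓ ^ i * w hθ hℓ ^ m * f hθ hℓ ^ j) ∈ S) →
      ∀ v ∈ S, u * v ∈ S := by
    intro u hu v hv
    suffices S ≤ S.comap (LinearMap.mulLeft k u) from this hv
    refine Submodule.span_le.mpr ?_
    rintro _ ⟨p, rfl⟩
    exact hu _ _ _
  have he : ∀ v ∈ S, e hθ hℓ * v ∈ S := hS _ fun i m j => by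
    rw [← mul_assoc, ← mul_assoc, ← pow_succ']
    exact hm _ _ _
  have hw : ∀ v ∈ S, w hθ hℓ * v ∈ S := hS _ fun i m j => by
    rw [← mul_assoc, ← mul_assoc, qCommute_pow (w_e hθ hℓ), smul_mul_assoc, smul_mul_assoc,
      mul_assoc (e hθ hℓ ^ i), ← pow_succ']
    exact Submodule.smul_mem _ _ (hm _ _ _)
  have hwpow : ∀ n : ℕ, ∀ v ∈ S, w hθ hℓ ^ n * v ∈ S := by
    intro n
    induction n with
    | zero => simp
    | succ n ih => exact fun v hv => by rw [pow_succ', mul_assoc]; exact hw _ (ih v hv)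
  have hv : ∀ v ∈ S, winv hθ hℓ * v ∈ S := by rw [winv_eq]; exact hwpow _
  -- Induction on the power of `e` that `f` has to cross. Each crossing creates a correction by `ω -
  -- ω⁻¹`, under which the span is already known to be stable.
  have hf : ∀ v ∈ S, f hθ hℓ * v ∈ S := hS _ fun i m j => by
    induction i with
    | zero =>
      have h1 : f hθ hℓ * w hθ hℓ ^ m = (θ ^ 2) ^ m • (w hθ hℓ ^ m * f hθ hℓ) :=
        qCommute_pow (f_w hθ hℓ) m
      rw [pow_zero, one_mul, ← mul_assoc, h1, smul_mul_assoc, mul_assoc, ← pow_succ',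
        ← one_mul (w hθ hℓ ^ m), ← pow_zero (e hθ hℓ)]
      exact Submodule.smul_mem _ _ (hm _ _ _)
    | succ i ih =>
      have h1 : f hθ hℓ * e hθ hℓ = e hθ hℓ * f hθ hℓ -
          (θ - θ⁻¹)⁻¹ • (w hθ hℓ - winv hθ hℓ) := by rw [← e_f hθ hℓ]; abel
      have h2 : f hθ hℓ * (e hθ hℓ ^ (i + 1) * w hθ hℓ ^ m * f hθ hℓ ^ j) =
          e hθ hℓ * (f hθ hℓ * (e hθ hℓ ^ i * w hθ hℓ ^ m * f hθ hℓ ^ j)) - (θ - θ⁻¹)⁻¹ •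
            (w hθ hℓ * (e hθ hℓ ^ i * w hθ hℓ ^ m * f hθ hℓ ^ j) -
              winv hθ hℓ * (e hθ hℓ ^ i * w hθ hℓ ^ m * f hθ hℓ ^ j)) := by
        rw [← sub_mul, ← smul_mul_assoc, ← mul_assoc (e hθ hℓ), ← sub_mul, ← h1, pow_succ']
        simp only [mul_assoc]
      rw [h2]
      exact sub_mem (he _ ih) (Submodule.smul_mem _ _ (sub_mem (hw _ (hm _ _ _)) (hv _ (hm _ _ _))))
  have hall : ∀ u v : USL2 θ hθ hℓ, v ∈ S → u * v ∈ S := by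
    intro u
    have hu : u ∈ Algebra.adjoin k {e hθ hℓ, f hθ hℓ, w hθ hℓ, winv hθ hℓ} :=
      adjoin_eq_top (hθ := hθ) (hℓ := hℓ) ▸ Algebra.mem_top
    induction hu using Algebra.adjoin_induction with
    | mem u hu => rcases hu with rfl | rfl | rfl | rfl <;> assumption
    | algebraMap r => exact fun v hv => by rw [← Algebra.smul_def]; exact Submodule.smul_mem _ _ hv
    | add b c _ _ hb hc => exact fun d hd => by rw [add_mul]; exact add_mem (hb d hd) (hc d hd)
    | mul b c _ _ hb hc => exact fun d hd => by rw [mul_assoc]; exact hb _ (hc d hd)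
  refine top_unique fun u _ => ?_
  simpa using hall u 1 (by simpa using hm 0 0 0)

end USL2

/-! ### Functionals on the double that vanish on the central ideal -/

namespace HD

open DrinfeldDouble

variable {k : Type*} [Field k] {G : Type*} [CommGroup G] (χ : G →* kˣ) (a : G) [Finite G]

/-- A central group-like element of the double is `ψ d` with `d` group-like and `χ(d) = ψ(a)`. -/
lemma exists_of_mem_centralGroupLikes {z : DrinfeldDouble k (HD χ a)}
    (hz : z ∈ centralGroupLikes k (DrinfeldDouble k (HD χ a))) :
    ∃ (ψ : G →* kˣ) (d : HD χ a), IsGroupLikeElem k d ∧ z = dPsi χ a ψ * incl d ∧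
      (orderOf (χ a) ≠ 1 → char χ a χ d = ψ a) := by
  obtain ⟨f, d, hd, rfl⟩ := exists_of_isGroupLikeElem hz.1
  obtain ⟨ψ, rfl⟩ := exists_char χ a f
  refine ⟨ψ, d, hd, rfl, fun h => ?_⟩
  have h1 := Semigroup.mem_center_iff.mp hz.2 (dX χ a)
  change dX χ a * (dPsi χ a ψ * incl d) = dPsi χ a ψ * incl d * dX χ a at h1
  rw [← mul_assoc, dX_mul_dPsi, smul_mul_assoc, mul_assoc, mul_assoc, ← map_mul, ← map_mul] at h1
  -- Evaluating the dual component at `1` and the other one by `ξ` compares `ψ(a)⁻¹ ξ(x d) = ψ(a)⁻¹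
  -- κ χ(d)` with `ξ(d x) = κ`. For `ℓ = 1` both are zero, which is why that case is excluded.
  have h2 := congrArg (fun y => xiForm χ a (toHom k _ y 1)) h1
  simp only [map_smul, LinearMap.smul_apply, toHom_inclDual_mul_incl, toDual_psi, xiForm_mul,
    counit_x, hd.counit_eq_one, xiForm_of_isGroupLike χ a hd] at h2
  have h3 := (ψ a).ne_zero
  simp [xiCoeff, h] at h2
  field_simp at h2
  exact h2

/-- The functional `f ⊗ h ↦ f(a^{-(s+i)} xⁱ) (χˢ ξʲ)(h)` on the double. -/
noncomputable def pairing (s i j : ℕ) : DrinfeldDouble k (HD χ a) →ₗ[k] k :=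
  DualCop.toDual k _ (psi χ a (χ ^ s) * xi χ a ^ j) ∘ₗ
    LinearMap.applyₗ (grp χ a ((a ^ (s + i))⁻¹) * x χ a ^ i) ∘ₗ (toHom k (HD χ a)).toLinearMap

lemma pairing_inclDual_mul_incl (s i j : ℕ) (f : DualCop k (HD χ a)) (h : HD χ a) :
    pairing χ a s i j (inclDual f * incl h) =
      DualCop.toDual k _ f (grp χ a ((a ^ (s + i))⁻¹) * x χ a ^ i) *
        DualCop.toDual k _ (psi χ a (χ ^ s) * xi χ a ^ j) h := by
  simp [pairing, toHom_inclDual_mul_incl]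

/-- The element `d` is not known to come from `G`, so the identity is taken from multiplicativity of
evaluation at a group-like element. -/
lemma char_pow (s : ℕ) {d : HD χ a} (hd : IsGroupLikeElem k d) :
    char χ a (χ ^ s) d = char χ a χ d ^ s := by
  induction s with
  | zero => rw [show χ ^ 0 = 1 from pow_zero χ, char_one, hd.counit_eq_one, pow_zero]
  | succ s ih =>
    have h := toDual_mul_of_isGroupLike χ a hd (psi χ a (χ ^ s)) (psi χ a χ)
    rw [psi_mul_psi, show χ ^ s * χ = χ ^ (s + 1) from (pow_succ χ s).symm] at h
    simpa [ih, pow_succ] using h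

/-- Writing `z = ψ d`, the character scales the dual side by `ψ(a)^{-(s+i)} ψ(a)ⁱ = ψ(a)^{-s}`, and
`d` scales the other side by `χ(d)ˢ`. These cancel because `χ(d) = ψ(a)`; the exponent `s + i` in
the functional is chosen for this. For `ℓ = 1` that equality is not available, and `s = i = 0` makes
it unnecessary. -/
lemma pairing_mul_of_mem_centralGroupLikes {s i : ℕ} (j : ℕ) (hi : orderOf (χ a) = 1 → s = 0 ∧ i = 0)
    {z : DrinfeldDouble k (HD χ a)}
    (hz : z ∈ centralGroupLikes k (DrinfeldDouble k (HD χ a))) (y : DrinfeldDouble k (HD χ a)) :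
    pairing χ a s i j (y * z) = pairing χ a s i j y := by
  obtain ⟨ψ, d, hd, rfl, h⟩ := exists_of_mem_centralGroupLikes χ a hz
  induction y using induction_on_mul with
  | h0 => simp
  | hadd y y' hy hy' => rw [add_mul, map_add, map_add, hy, hy']
  | hmul f b =>
    -- Centrality of `ψ d` moves it past `b`, so that the product is again in the form dual part
    -- times `H_𝒟` part without reordering `b` and `ψ`.
    have h1 : inclDual f * incl b * (dPsi χ a ψ * incl d) =
        inclDual (f * psi χ a ψ) * incl (d * b) := by
      rw [mul_assoc, Semigroup.mem_center_iff.mp hz.2, map_mul, map_mul]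
      simp only [mul_assoc]
    rw [h1, pairing_inclDual_mul_incl, pairing_inclDual_mul_incl, toDual_psi_mul_xi_pow_mul χ a hd,
      toDual_mul_psi, map_mul, map_pow, translate_grp, translate_x, smul_pow, smul_mul_smul_comm,
      map_smul, char_pow χ a s hd]
    have h2 : ((ψ (a ^ (s + i))⁻¹ : kˣ) : k) * (ψ a : k) ^ i * char χ a χ d ^ s = 1 := by
      have h3 := (ψ a).ne_zero
      by_cases hl : orderOf (χ a) = 1
      · obtain ⟨rfl, rfl⟩ := hi hl
        simp
      · rw [h hl, map_inv, map_pow, Units.val_inv_eq_inv_val, Units.val_pow_eq_pow_val, pow_add]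
        field_simp
    rw [smul_eq_mul]
    linear_combination (DualCop.toDual k _ f (grp χ a ((a ^ (s + i))⁻¹) * x χ a ^ i) *
        DualCop.toDual k _ (psi χ a (χ ^ s) * xi χ a ^ j) b) * h2

/-- By invariance, on `b · k G_C` the functional is a multiple of the counit, which vanishes on the
augmentation ideal. -/
lemma pairing_eq_zero {s i : ℕ} (j : ℕ) (hi : orderOf (χ a) = 1 → s = 0 ∧ i = 0)
    {y : DrinfeldDouble k (HD χ a)} (hy : y ∈ centralIdeal k (DrinfeldDouble k (HD χ a))) :
    pairing χ a s i j y = 0 := by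
  -- An arbitrary left factor `b` is carried along to absorb the coefficients of the left ideal; the
  -- claim is the case `b = 1`.
  refine Submodule.span_induction (p := fun y _ => ∀ b, pairing χ a s i j (b * y) = 0)
    ?_ ?_ ?_ ?_ hy 1 |> fun h => by simpa using h
  · intro y hy b
    have h1 : Set.EqOn (pairing χ a s i j ∘ₗ LinearMap.mulLeft k b)
        (pairing χ a s i j b • counit : DrinfeldDouble k (HD χ a) →ₗ[k] k)
        (Submodule.span k (centralGroupLikes k (DrinfeldDouble k (HD χ a)))) :=
      LinearMap.eqOn_span fun z hz => by
        simp [pairing_mul_of_mem_centralGroupLikes χ a j hi hz, hz.1.counit_eq_one]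
    have h2 : counit (R := k) y = 0 := hy.2
    simpa [h2] using h1 hy.1
  · simp
  · intro y z _ _ hy hz b
    rw [mul_add, map_add, hy, hz, add_zero]
  · intro c y _ hy b
    rw [smul_eq_mul, ← mul_assoc, hy]

/-- The power `ξⁱ` pairs only with `xⁱ`, and `xʲ` only with `ξʲ`. The group element inserted on the
dual side is invisible to `ξⁱ`, so the only trace of `g` is `χ(g)ˢ`. -/
lemma pairing_dXi_pow_mul_dGrp_mul_dX_pow (s i' j' i j : ℕ) (g : G) :
    pairing χ a s i' j' (dXi χ a ^ i * dGrp χ a g * dX χ a ^ j) =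
      if i' = i ∧ j = j' then xiCoeff χ a ^ i * qFact χ a i * (xiCoeff χ a ^ j * qFact χ a j) *
        (χ g : k) ^ s else 0 := by
  have h1 := toDual_psi_mul_xi_pow χ a 1 i ((a ^ (s + i'))⁻¹) i'
  rw [psi_one, one_mul] at h1
  rw [mul_assoc, ← map_pow, ← map_pow, ← map_mul, pairing_inclDual_mul_incl, h1,
    toDual_psi_mul_xi_pow]
  by_cases h : i' = i <;> by_cases h' : j = j' <;> simp [h, h']
  ring

/-! ### Injectivity of the comparison map -/

section Comparison

variable [CharZero k] [HasEnoughRootsOfUnity k (Monoid.exponent G)]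
variable {θ : k} {ℓ : ℕ} (hℓ : orderOf (χ a) = ℓ) (hN : orderOf a = ℓ)
  (hodd : Odd ℓ) (hθ : IsPrimitiveRoot θ ℓ) (hθ2 : θ ^ 2 = ((χ a)⁻¹ : kˣ))

/-- A combination of the monomials `eⁱ ωᵐ fʲ` in the kernel lifts to an element of the central
ideal. The functionals separate the pairs `(i, j)`, and varying `s` then separates the exponents
`m`, so all coefficients vanish. -/
lemma compare_injective : Function.Injective (compare χ a hℓ hN hodd hθ hθ2) := by
  refine (injective_iff_map_eq_zero _).mpr fun u hu => ?_
  have hmem : u ∈ Submodule.span k (Set.range fun p : Fin ℓ × Fin ℓ × Fin ℓ =>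
      USL2.e hθ hodd ^ (p.1 : ℕ) * USL2.w hθ hodd ^ (p.2.1 : ℕ) * USL2.f hθ hodd ^ (p.2.2 : ℕ)) := by
    rw [USL2.span_e_pow_mul_w_pow_mul_f_pow]; trivial
  obtain ⟨c, rfl⟩ := (Submodule.mem_span_range_iff_exists_fun k).mp hmem
  set t := (θ - θ⁻¹)⁻¹ with ht
  -- The obvious lift to the double; the factor `tⁱ` is the scalar by which `e` is sent to a
  -- multiple of `ξ`.
  set y : DrinfeldDouble k (HD χ a) := ∑ p : Fin ℓ × Fin ℓ × Fin ℓ, (c p * t ^ (p.1 : ℕ)) •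
    (dXi χ a ^ (p.1 : ℕ) * dGrp χ a (a⁻¹ ^ (p.2.1 : ℕ)) * dX χ a ^ (p.2.2 : ℕ)) with hy
  have hyu : proj χ a y = 0 := by
    rw [← hu, hy, map_sum, map_sum]
    refine Finset.sum_congr rfl fun p _ => ?_
    have h1 : dGrp χ a (a⁻¹ ^ (p.2.1 : ℕ)) = dGrp χ a a⁻¹ ^ (p.2.1 : ℕ) := by
      rw [dGrp, dGrp, ← map_pow, ← grpHom_apply, map_pow, grpHom_apply]
    rw [h1]
    simp only [map_smul, map_mul, map_pow, compare_e, compare_w, compare_f, smul_pow,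
      smul_mul_assoc, mul_smul, ← ht]
  have hyI : y ∈ centralIdeal k (DrinfeldDouble k (HD χ a)) := Ideal.Quotient.eq_zero_iff_mem.mp hyu
  have hc : ∀ i j m : Fin ℓ, c (i, m, j) = 0 := by
    intro i j
    -- The nodes of the Vandermonde system are the powers of `χ(a)⁻¹ = θ²`. They are distinct
    -- because `θ²` still has order `ℓ`, as `ℓ` is odd.
    have hq : IsPrimitiveRoot ((χ a⁻¹ : kˣ) : k) ℓ := by
      rw [map_inv, ← hθ2]
      exact USL2.isPrimitiveRoot_sq hθ hodd
    have h1 : ∀ s : Fin ℓ, ∑ m : Fin ℓ, c (i, m, j) * (((χ a⁻¹ : kˣ) : k) ^ (m : ℕ)) ^ (s : ℕ) = 0 := by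
      intro s
      have h2 := pairing_eq_zero χ a (s := s) (i := i) j
        -- For `ℓ = 1` the bounds `s, i < ℓ` force `s = i = 0`.
        (fun h => by have := s.2; have := i.2; omega) hyI
      rw [hy, map_sum, Fintype.sum_prod_type, Finset.sum_eq_single i] at h2
      · simp only [Fintype.sum_prod_type, map_smul, pairing_dXi_pow_mul_dGrp_mul_dX_pow, true_and,
          Fin.val_inj, smul_eq_mul, mul_ite, mul_zero, Finset.sum_ite_eq', Finset.mem_univ,
          if_true] at h2
        -- The common factor of the remaining terms is invertible because `i` and `j` are below `ℓ`,
        -- also in the degenerate case `ℓ = 1`.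
        have hn : t ^ (i : ℕ) * (xiCoeff χ a ^ (i : ℕ) * qFact χ a i *
            (xiCoeff χ a ^ (j : ℕ) * qFact χ a j)) ≠ 0 := by
          have hi : (i : ℕ) < orderOf (χ a) := hℓ ▸ i.2
          have hj : (j : ℕ) < orderOf (χ a) := hℓ ▸ j.2
          exact mul_ne_zero (inv_sub_inv_pow_ne_zero hodd hθ i.2) (mul_ne_zero
            (mul_ne_zero (xiCoeff_pow_ne_zero χ a hi) (qFact_ne_zero χ a hi))
            (mul_ne_zero (xiCoeff_pow_ne_zero χ a hj) (qFact_ne_zero χ a hj)))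
        refine (mul_eq_zero.mp ?_).resolve_left hn
        rw [Finset.mul_sum, ← h2]
        refine Finset.sum_congr rfl fun m _ => ?_
        rw [map_pow, Units.val_pow_eq_pow_val]
        ring
      · intro i' _ hi'
        refine Finset.sum_eq_zero fun p _ => ?_
        rw [map_smul, pairing_dXi_pow_mul_dGrp_mul_dX_pow, if_neg, smul_zero]
        exact fun h => hi' (Fin.ext h.1.symm)
      · simp
    -- There are `ℓ` equations, one for each `s < ℓ`, in `ℓ` unknowns with distinct nodes, so the
    -- Vandermonde matrix is invertible.
    refine fun m => congrFun (Matrix.eq_zero_of_forall_pow_sum_mul_pow_eq_zero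
      (v := fun m => c (i, m, j)) (f := fun m : Fin ℓ => ((χ a⁻¹ : kˣ) : k) ^ (m : ℕ)) ?_ h1) m
    exact fun m m' h => Fin.ext (hq.pow_inj m.2 m'.2 h)
  refine Finset.sum_eq_zero fun p _ => ?_
  rw [show c p = 0 from hc p.1 p.2.2 p.2.1, zero_smul]

end Comparison

end HD

theorem proposition3p12 {k : Type*} [Field k] [IsAlgClosed k] [CharZero k]
    {G : Type*} [CommGroup G] [Finite G] (χ : G →* kˣ) (a : G) (ℓ : ℕ)
    (hℓ : orderOf (χ a) = ℓ) (hN : orderOf a = ℓ) (hM : orderOf χ = ℓ) (hodd : Odd ℓ)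
    (θ : k) (hθ : IsPrimitiveRoot θ ℓ) (hθ2 : θ ^ 2 = ((χ a)⁻¹ : kˣ)) :
    Nonempty (CentralQuotient k (DrinfeldDouble k (HD χ a)) ≃ₐc[k] USL2 θ hθ hodd) := by
  -- The exponent of `G` is nonzero in `k`, so the algebraically closed field `k` contains enough
  -- roots of unity for the characters of `G` to separate its elements.
  have : NeZero ((Monoid.exponent G : ℕ) : k) :=
    ⟨Nat.cast_ne_zero.mpr Monoid.exponent_ne_zero_of_finite⟩
  -- The isomorphism is built from the presented algebra and then inverted; as an isomorphism of
  -- bialgebras it automatically respects the antipodes.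
  exact ⟨(BialgEquiv.ofBijective (HD.compareBialgHom χ a hℓ hN hodd hθ hθ2)
    ⟨HD.compare_injective χ a hℓ hN hodd hθ hθ2,
      HD.compare_surjective χ a hℓ hN hM hodd hθ hθ2⟩).symm⟩
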